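/- Consider fair division instances with a nonempty finite set $N$ of $n$ agents and a finite set $M$ of $m$ indivisible goods, in which every agent $i$ has a binary additive valuation, i.e. $v_i(g)\in\{0,1\}$ for all $g\in M$ and $v_i(S)=\sum_{g\in S}v_i(g)$ for $S\subseteq M$. An allocation $(A_i)_{i\in N}$ of a set $S$ of goods is a family of pairwise disjoint bundles with union $S$; it is complete if $S=M$. Let $M_{>0}$ be the set of goods $g$ with $v_i(g)>0$ for some $i$. A complete allocation $A$ is called a maximum Nash welfare (MNW) allocation if it arises as follows: take an allocation $B$ of $M_{>0}$ which, among all allocations of $M_{>0}$, (1) maximizes the number of agents with $v_i(B_i)>0$ and then (2), among those satisfying (1), maximizes the product $\prod_{i:\,v_i(B_i)>0}v_i(B_i)$; then give all goods of $M\setminus M_{>0}$ to one agent $i$ with the least value $v_i(B_i)$. A complete allocation $A$ is $\mathrm{EFX}_0$ if $v_i(A_i)\ge v_i(A_j\setminus\{g\})$ for all $i,j\in N$ and all $g\in A_j$. There is a deterministic algorithm (Turing machine) that, given the $n\times m$ matrix of values of any such binary instance, computes in time polynomial in the size of the input an MNW allocation of the instance, and this allocation is also $\mathrm{EFX}_0$.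 -/

import Mathlib

open scoped NNReal

namespace FairDivision

noncomputable section

section General

variable {N M : Type} [Fintype N] [DecidableEq N] [Fintype M] [DecidableEq M]

/-- The additive value `v_i(S)` of agent `i` for the bundle `S`. -/
def value (v : N → M → ℝ≥0) (i : N) (S : Finset M) : ℝ≥0 :=
  ∑ g ∈ S, v i g

/-- `A` allocates exactly the goods in `S`: the bundles are pairwise disjoint and their union
is `S`. A complete allocation of the instance is the case `S = Finset.univ`. -/
def IsAllocationOf (S : Finset M) (A : N → Finset M) : Prop :=
  (∀ i j, i ≠ j → Disjoint (A i) (A j)) ∧ Finset.univ.biUnion A = S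

/-- A complete allocation: all goods are allocated. -/
def IsAllocation (A : N → Finset M) : Prop :=
  IsAllocationOf Finset.univ A

/-- Envy-freeness up to any good (including goods of value zero to the envious agent). -/
def IsEFX0 (v : N → M → ℝ≥0) (A : N → Finset M) : Prop :=
  ∀ i j, ∀ g ∈ A j, value v i (A j \ {g}) ≤ value v i (A i)

/-- The agents that have positive value for their own bundle. -/
def positiveAgents (v : N → M → ℝ≥0) (A : N → Finset M) : Finset N :=
  {i | 0 < value v i (A i)}

/-- The product of the values of the agents that have positive value. It equals the Nash
welfare when every agent has positive value. -/
def positiveProduct (v : N → M → ℝ≥0) (A : N → Finset M) : ℝ≥0 :=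
  ∏ i ∈ positiveAgents v A, value v i (A i)

/-- Among all allocations of exactly the goods in `S`, the allocation `B` maximizes first the
number of agents with positive value, and then the product of the values of these agents. -/
def IsMNWOn (v : N → M → ℝ≥0) (S : Finset M) (B : N → Finset M) : Prop :=
  IsAllocationOf S B ∧
    ∀ C : N → Finset M, IsAllocationOf S C →
      (positiveAgents v C).card ≤ (positiveAgents v B).card ∧
      ((positiveAgents v C).card = (positiveAgents v B).card →
        positiveProduct v C ≤ positiveProduct v B)

/-- The goods that are positively valued by some agent. -/
def positiveGoods (v : N → M → ℝ≥0) : Finset M :=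
  {g | ∃ i, 0 < v i g}

/-- The goods for which all agents have value zero. -/
def zeroGoods (v : N → M → ℝ≥0) : Finset M :=
  {g | ∀ i, v i g = 0}

/-- Maximum Nash welfare allocations: take a maximum Nash welfare allocation `B` of the goods
that are positively valued by some agent, and give all zero-valued goods to one agent whose
value for its own bundle in `B` is least. -/
def IsMNW (v : N → M → ℝ≥0) (A : N → Finset M) : Prop :=
  ∃ B : N → Finset M, IsMNWOn v (positiveGoods v) B ∧
    ∃ i : N, (∀ j, value v i (B i) ≤ value v j (B j)) ∧
      A = Function.update B i (B i ∪ zeroGoods v)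

end General

/-- A fair division instance with at least one agent in which all values are `0` or `1`. -/
structure BinaryInstance : Type where
  /-- the number of agents -/
  n : ℕ
  /-- the number of goods -/
  m : ℕ
  /-- there is at least one agent -/
  n_pos : 0 < n
  /-- the value of each agent for each good -/
  v : Fin n → Fin m → ℝ≥0
  /-- all values are binary -/
  binary : ∀ i g, v i g = 0 ∨ v i g = 1

/-- A 0/1 matrix as a string: the rows one after the other, each row as the list of its
entries followed by the end-of-row symbol `none`. -/
def encodeMatrix {n m : ℕ} (x : Fin n → Fin m → Bool) : List (Option Bool) :=
  (List.ofFn fun i => (List.ofFn fun g => some (x i g)) ++ [none]).flatten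

open Classical in
/-- The input string of a binary instance: its matrix of values. -/
def BinaryInstance.encode (I : BinaryInstance) : List (Option Bool) :=
  encodeMatrix fun i g => decide (I.v i g = 1)

/-- The output string of an allocation: row `i` is the indicator vector of the bundle of
agent `i`. -/
def encodeAllocation {n m : ℕ} (A : Fin n → Finset (Fin m)) : List (Option Bool) :=
  encodeMatrix fun i g => decide (g ∈ A i)

end

end FairDivision

/-! Suppose that every good with positive value for someone belongs to an agent valuing it. A chain
of transfers towards `t` passes a good from an agent `i` to an agent `k` who values it, then another
good from `k` onwards, until `t` is reached. The allocation is balanced (`IsBalanced`) if each `t`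
lies in a set `R` that contains the owner of every good valued by a member, and whose members own at
most one good more than `t`.

A balanced allocation maximizes all truncated sums `∑ min (value i) t` at once
(`IsBalanced.sum_min_le`). Take the union `L` of the sets `R` of all agents with fewer than `t`
goods. Members of `L` own at most `t` goods and jointly own everything that they value, so no
allocation gives them more in total; agents outside `L` already attain the cap `t`. Truncation at
`1` counts the positive agents. A nondecreasing concave function vanishing at `0` is a nonnegative
combination of truncations, and a corrected logarithm then gives the product
(`prod_pos_le_of_min_le`). Balance also gives EFX: if `j` values a good of `i`, then `i` lies in the
set `R` of `j`, so `i` without one good owns no more goods than `j` (`IsBalanced.spec`).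

A balanced allocation is found by local search. From a target, a closure search collects the agents
at which chains can start (`grow_spec`). If one of them owns at least two goods more than the
target, executing a chain (`walk_spec`) lowers the sum of squared loads by at least `2`. That sum is
at most `(m + 1) ^ 2`, which bounds the number of improving passes (`improveAll_spec`).

For the running time, the algorithm is a term of `Prog`, a language of bounded loops over the rows
and columns of a bit matrix with one counter. Loop lengths are at most the input size, so each fixed
program takes polynomial time (`Prog.exec_code`). Programs compile to structured stack code, whose
runs are simulated step by step by a `TM2` machine (`Runs.exists_iterate`). -/

namespace StackProgram

/-! ### Structured stack programs and their simulation by `TM2` machines -/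

open Turing Function

/-- Structured programs over finitely many stacks and a finite register. -/
inductive Cmd {K : Type} (Γ : K → Type) (σ : Type) : Type
  | push (k : K) (f : σ → Γ k)
  | pop (k : K) (f : σ → Option (Γ k) → σ)
  | peek (k : K) (f : σ → Option (Γ k) → σ)
  | load (f : σ → σ)
  | seq (c d : Cmd Γ σ)
  | ite (p : σ → Bool) (c d : Cmd Γ σ)
  | loop (p : σ → Bool) (c : Cmd Γ σ)

variable {K : Type} {Γ : K → Type} {σ : Type}

/-- The program points of a structured program. -/
def Cmd.Lab : Cmd Γ σ → Type
  | .push _ _ => Unit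
  | .pop _ _ => Unit
  | .peek _ _ => Unit
  | .load _ => Unit
  | .seq c d => c.Lab ⊕ d.Lab
  | .ite _ c d => Option (c.Lab ⊕ d.Lab)
  | .loop _ c => Option c.Lab

noncomputable instance Cmd.fintypeLab : (c : Cmd Γ σ) → Fintype c.Lab
  | .push _ _ => inferInstanceAs (Fintype Unit)
  | .pop _ _ => inferInstanceAs (Fintype Unit)
  | .peek _ _ => inferInstanceAs (Fintype Unit)
  | .load _ => inferInstanceAs (Fintype Unit)
  | .seq c d =>
    let _ := c.fintypeLab
    let _ := d.fintypeLab
    inferInstanceAs (Fintype (c.Lab ⊕ d.Lab))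
  | .ite _ c d =>
    let _ := c.fintypeLab
    let _ := d.fintypeLab
    inferInstanceAs (Fintype (Option (c.Lab ⊕ d.Lab)))
  | .loop _ c =>
    let _ := c.fintypeLab
    inferInstanceAs (Fintype (Option c.Lab))

/-- The program point at which the execution of a program starts. -/
def Cmd.entry : (c : Cmd Γ σ) → c.Lab
  | .push _ _ => ()
  | .pop _ _ => ()
  | .peek _ _ => ()
  | .load _ => ()
  | .seq c _ => Sum.inl c.entry
  | .ite _ _ _ => none
  | .loop _ _ => none

/-- The machine statement at each program point, for a program embedded into a machine by `emb`
that continues at the label `exit`. -/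
def Cmd.stmt {Λ : Type} : (c : Cmd Γ σ) → (c.Lab → Λ) → Λ → c.Lab → TM2.Stmt Γ Λ σ
  | .push k f, _, exit => fun _ => .push k f (.goto fun _ => exit)
  | .pop k f, _, exit => fun _ => .pop k f (.goto fun _ => exit)
  | .peek k f, _, exit => fun _ => .peek k f (.goto fun _ => exit)
  | .load f, _, exit => fun _ => .load f (.goto fun _ => exit)
  | .seq c d, emb, exit => fun l => match l with
    | Sum.inl l => c.stmt (fun l => emb (Sum.inl l)) (emb (Sum.inr d.entry)) l
    | Sum.inr l => d.stmt (fun l => emb (Sum.inr l)) exit l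
  | .ite p c d, emb, exit => fun l => match l with
    | none => .branch p (.goto fun _ => emb (some (Sum.inl c.entry)))
        (.goto fun _ => emb (some (Sum.inr d.entry)))
    | some (Sum.inl l) => c.stmt (fun l => emb (some (Sum.inl l))) exit l
    | some (Sum.inr l) => d.stmt (fun l => emb (some (Sum.inr l))) exit l
  | .loop p c, emb, exit => fun l => match l with
    | none => .branch p (.goto fun _ => emb (some c.entry)) (.goto fun _ => exit)
    | some l => c.stmt (fun l => emb (some l)) (emb none) l

variable [DecidableEq K]

/-- `Runs c v S v' S' t`: the program `c` started with register `v` and stacks `S` terminates with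
register `v'` and stacks `S'` after at most `t` steps. -/
inductive Runs : Cmd Γ σ → σ → (∀ k, List (Γ k)) → σ → (∀ k, List (Γ k)) → ℕ → Prop
  | push (k f v S) : Runs (.push k f) v S v (update S k (f v :: S k)) 1
  | pop (k f v S) : Runs (.pop k f) v S (f v (S k).head?) (update S k (S k).tail) 1
  | peek (k f v S) : Runs (.peek k f) v S (f v (S k).head?) S 1
  | load (f v S) : Runs (.load f) v S (f v) S 1
  | seq {c d v₁ S₁ v₂ S₂ v₃ S₃ s t} : Runs c v₁ S₁ v₂ S₂ s → Runs d v₂ S₂ v₃ S₃ t →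
      Runs (.seq c d) v₁ S₁ v₃ S₃ (s + t)
  | ite_true {p c d v₁ S₁ v₂ S₂ t} : p v₁ = true → Runs c v₁ S₁ v₂ S₂ t →
      Runs (.ite p c d) v₁ S₁ v₂ S₂ (t + 1)
  | ite_false {p c d v₁ S₁ v₂ S₂ t} : p v₁ = false → Runs d v₁ S₁ v₂ S₂ t →
      Runs (.ite p c d) v₁ S₁ v₂ S₂ (t + 1)
  | loop_false {p c v S} : p v = false → Runs (.loop p c) v S v S 1
  | loop_true {p c v₁ S₁ v₂ S₂ v₃ S₃ s t} : p v₁ = true → Runs c v₁ S₁ v₂ S₂ s →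
      Runs (.loop p c) v₂ S₂ v₃ S₃ t → Runs (.loop p c) v₁ S₁ v₃ S₃ (s + t + 1)
  | mono {c v₁ S₁ v₂ S₂ s t} : Runs c v₁ S₁ v₂ S₂ s → s ≤ t → Runs c v₁ S₁ v₂ S₂ t

/-- A machine that contains a program simulates its runs. -/
theorem Runs.exists_iterate {c : Cmd Γ σ} {v v' : σ} {S S' : ∀ k, List (Γ k)} {t : ℕ}
    (h : Runs c v S v' S' t) {Λ : Type} (M : Λ → TM2.Stmt Γ Λ σ) (emb : c.Lab → Λ) (exit : Λ)
    (hM : ∀ l, M (emb l) = c.stmt emb exit l) :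
    ∃ s ≤ t, (flip bind (TM2.step M))^[s] (some ⟨some (emb c.entry), v, S⟩) =
      some ⟨some exit, v', S'⟩ := by
  -- The exit label has to vary: the first half of a sequence exits at the entry of the second half,
  -- and the body of a loop exits at the test of the loop.
  induction h generalizing exit with
  | push k f v S => exact ⟨1, le_rfl, by simp [flip, hM, Cmd.stmt]⟩
  | pop k f v S => exact ⟨1, le_rfl, by simp [flip, hM, Cmd.stmt]⟩
  | peek k f v S => exact ⟨1, le_rfl, by simp [flip, hM, Cmd.stmt]⟩
  | load f v S => exact ⟨1, le_rfl, by simp [flip, hM, Cmd.stmt]⟩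
  | @seq c d v₁ S₁ v₂ S₂ v₃ S₃ s t _ _ ih₁ ih₂ =>
    obtain ⟨a, ha, ea⟩ := ih₁ (fun l => emb (Sum.inl l)) (emb (Sum.inr d.entry))
      (fun l => hM (Sum.inl l))
    obtain ⟨b, hb, eb⟩ := ih₂ (fun l => emb (Sum.inr l)) exit (fun l => hM (Sum.inr l))
    refine ⟨b + a, by omega, ?_⟩
    rw [iterate_add_apply]
    exact (congrArg _ ea).trans eb
  | @ite_true p c d v₁ S₁ v₂ S₂ t hp _ ih =>
    obtain ⟨a, ha, ea⟩ := ih (fun l => emb (some (Sum.inl l))) exit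
      (fun l => hM (some (Sum.inl l)))
    refine ⟨a + 1, by omega, ?_⟩
    rw [iterate_add_apply]
    refine (congrArg _ ?_).trans ea
    have := hM none
    simp [flip, Cmd.entry, this, Cmd.stmt, hp]
  | @ite_false p c d v₁ S₁ v₂ S₂ t hp _ ih =>
    obtain ⟨a, ha, ea⟩ := ih (fun l => emb (some (Sum.inr l))) exit
      (fun l => hM (some (Sum.inr l)))
    refine ⟨a + 1, by omega, ?_⟩
    rw [iterate_add_apply]
    refine (congrArg _ ?_).trans ea
    have := hM none
    simp [flip, Cmd.entry, this, Cmd.stmt, hp]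
  | @loop_false p c v S hp =>
    refine ⟨1, le_rfl, ?_⟩
    have := hM none
    simp [flip, Cmd.entry, this, Cmd.stmt, hp]
  | @loop_true p c v₁ S₁ v₂ S₂ v₃ S₃ s t hp _ _ ih₁ ih₂ =>
    obtain ⟨a, ha, ea⟩ := ih₁ (fun l => emb (some l)) (emb none) (fun l => hM (some l))
    obtain ⟨b, hb, eb⟩ := ih₂ emb exit hM
    refine ⟨b + (a + 1), by omega, ?_⟩
    rw [iterate_add_apply, iterate_add_apply]
    refine (congrArg _ ((congrArg _ ?_).trans ea)).trans eb
    have := hM none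
    simp [flip, Cmd.entry, this, Cmd.stmt, hp]
  | mono _ hst ih =>
    obtain ⟨a, ha, ea⟩ := ih emb exit hM
    exact ⟨a, ha.trans hst, ea⟩

/-- A loop that runs through a sequence of states. -/
theorem Runs.loop_iterate {p : σ → Bool} {c : Cmd Γ σ} (v : ℕ → σ) (S : ℕ → ∀ k, List (Γ k))
    (N t : ℕ) (hp : ∀ j < N, p (v j) = true) (hN : p (v N) = false)
    (hc : ∀ j < N, Runs c (v j) (S j) (v (j + 1)) (S (j + 1)) t) :
    Runs (.loop p c) (v 0) (S 0) (v N) (S N) (N * (t + 1) + 1) := by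
  -- `Runs.loop_true` peels off the first iteration, so the induction runs over the number `r` of
  -- iterations that remain, starting from state `N - r`.
  suffices ∀ r ≤ N, Runs (.loop p c) (v (N - r)) (S (N - r)) (v N) (S N) (r * (t + 1) + 1) by
    simpa using this N le_rfl
  intro r
  induction r with
  | zero => intro _; simpa using Runs.loop_false hN
  | succ r ih =>
    intro hr
    have h₁ := hc (N - (r + 1)) (by omega)
    rw [show N - (r + 1) + 1 = N - r by omega] at h₁
    exact (Runs.loop_true (hp _ (by omega)) h₁ (ih (by omega))).mono (by ring_nf; omega)

/-- The Turing machine that executes a program and halts. -/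
noncomputable def Cmd.machine [Fintype K] [Fintype σ] (c : Cmd Γ σ) (k₀ k₁ : K) [Fintype (Γ k₀)] (v₀ : σ) :
    FinTM2 :=
  letI : DecidableEq K := inferInstance
  letI := c.fintypeLab
  { K := K
    k₀ := k₀
    k₁ := k₁
    Γ := Γ
    Λ := Option c.Lab
    main := some c.entry
    σ := σ
    initialState := v₀
    m := fun l => match l with
      | none => .halt
      | some l => c.stmt some none l }

/-- The initial and final configurations of a `FinTM2` are defined with a cast along an equality of
stack indices; `update` is the form in which runs are stated. -/
theorem dite_eq_update {k₀ : K} (l : List (Γ k₀)) :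
    (fun k => if h : k = k₀ then (congrArg (fun k => List (Γ k)) h).mpr l else []) =
      update (fun _ => []) k₀ l := by
  funext k
  by_cases hk : k = k₀
  · subst hk
    simp
  · simp [hk]

/-- The one additional step executes `halt` at the label `none`. The register has to return to `v₀`
because the halting configuration prescribes the initial state. -/
theorem Runs.outputsInTime [Fintype K] [Fintype σ] {c : Cmd Γ σ} {k₀ k₁ : K} [Fintype (Γ k₀)]
    {v₀ : σ} {l : List (Γ k₀)} {l' : List (Γ k₁)} {t : ℕ}
    (h : Runs c v₀ (update (fun _ => []) k₀ l) v₀ (update (fun _ => []) k₁ l') t) :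
    Nonempty (TM2OutputsInTime (c.machine k₀ k₁ v₀) l (some l') (t + 1)) := by
  obtain ⟨s, hs, e⟩ := h.exists_iterate (c.machine k₀ k₁ v₀).m some none (fun _ => rfl)
  have h₀ : initList (c.machine k₀ k₁ v₀) l =
      (⟨some (some c.entry), v₀, update (fun _ => []) k₀ l⟩ : TM2.Cfg Γ (Option c.Lab) σ) :=
    congrArg (TM2.Cfg.mk _ _) (dite_eq_update l)
  have h₁ : haltList (c.machine k₀ k₁ v₀) l' =
      (⟨none, v₀, update (fun _ => []) k₁ l'⟩ : TM2.Cfg Γ (Option c.Lab) σ) :=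
    congrArg (TM2.Cfg.mk _ _) (dite_eq_update l')
  refine ⟨⟨⟨s + 1, ?_⟩, Nat.succ_le_succ hs⟩⟩
  refine Eq.trans ?_ (congrArg some h₁).symm
  rw [h₀, add_comm, iterate_add_apply]
  exact (congrArg _ e).trans rfl

end StackProgram

/-! ### Moving and clearing whole stacks -/

namespace StackProgram

open Turing Function

variable {K : Type} {Γ : K → Type} {σ : Type} [DecidableEq K]

/-- Moves the stack `k` symbol by symbol to the stack `k'`. -/
def Cmd.move (k k' : K) (get : σ → Option (Γ k) → σ) (p : σ → Bool) (put : σ → Γ k') :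
    Cmd Γ σ :=
  .seq (.pop k get) (.loop p (.seq (.push k' put) (.pop k get)))

/-- By `h₃` a read forgets what the previous read left in the register. Hence all registers in the
loop have the form `get v o`, and the last read, from the empty stack, leaves `get v none`. -/
theorem Runs.move {k k' : K} (hk : k ≠ k') {get : σ → Option (Γ k) → σ} {p : σ → Bool}
    {put : σ → Γ k'} (g : Γ k → Γ k') (h₀ : ∀ v, p (get v none) = false)
    (h₁ : ∀ v a, p (get v (some a)) = true) (h₂ : ∀ v a, put (get v (some a)) = g a)
    (h₃ : ∀ v a o, get (get v (some a)) o = get v o) (v : σ) (S : ∀ k, List (Γ k)) :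
    Runs (.move k k' get p put) v S (get v none)
      (update (update S k []) k' (((S k).map g).reverse ++ S k')) (3 * (S k).length + 2) := by
  -- At the loop test the top symbol is already in the register, so the list `l` still to be moved
  -- is one symbol longer than the stack.
  suffices ∀ (l : List (Γ k)) (S : ∀ k, List (Γ k)), S k = l.tail →
      Runs (.loop p (.seq (.push k' put) (.pop k get))) (get v l.head?) S (get v none)
        (update (update S k []) k' ((l.map g).reverse ++ S k')) (3 * l.length + 1) by
    have h := this (S k) (update S k (S k).tail) (by simp)
    rw [update_idem, update_of_ne hk.symm] at h
    exact ((Runs.pop k get v S).seq h).mono (by omega)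
  intro l
  induction l with
  | nil =>
    intro S hS
    have : update (update S k []) k' ((([] : List (Γ k)).map g).reverse ++ S k') = S := by
      funext j
      by_cases hj : j = k'
      · subst hj
        simp
      · by_cases hj' : j = k
        · subst hj'
          simp [hj, hS]
        · simp [hj, hj']
    rw [this]
    exact Runs.loop_false (h₀ v)
  | cons a l ih =>
    intro S hS
    have h := ih (update (update S k' (g a :: S k')) k l.tail) (by simp)
    have e₁ := Runs.push k' put (get v (some a)) S
    rw [h₂] at e₁
    have e₂ := Runs.pop k get (get v (some a)) (update S k' (g a :: S k'))
    rw [h₃, update_of_ne hk, hS] at e₂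
    have e := (Runs.loop_true (h₁ v a) (e₁.seq e₂) h).mono
      (t := 3 * (a :: l).length + 1) (by simp only [List.length_cons]; omega)
    convert e using 1
    · rfl
    funext j
    by_cases hj : j = k'
    · subst hj
      simp [hk.symm]
    · by_cases hj' : j = k
      · subst hj'
        simp [hj]
      · simp [hj, hj']

/-- Empties the stack `k`. -/
def Cmd.clear (k : K) (get : σ → Option (Γ k) → σ) (p : σ → Bool) : Cmd Γ σ :=
  .seq (.pop k get) (.loop p (.pop k get))

theorem Runs.clear {k : K} {get : σ → Option (Γ k) → σ} {p : σ → Bool}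
    (h₀ : ∀ v, p (get v none) = false) (h₁ : ∀ v a, p (get v (some a)) = true)
    (h₃ : ∀ v a o, get (get v (some a)) o = get v o) (v : σ) (S : ∀ k, List (Γ k)) :
    Runs (.clear k get p) v S (get v none) (update S k []) (2 * (S k).length + 2) := by
  suffices ∀ (l : List (Γ k)) (S : ∀ k, List (Γ k)), S k = l.tail →
      Runs (.loop p (.pop k get)) (get v l.head?) S (get v none) (update S k [])
        (2 * l.length + 1) by
    have h := this (S k) (update S k (S k).tail) (by simp)
    rw [update_idem] at h
    exact ((Runs.pop k get v S).seq h).mono (by omega)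
  intro l
  induction l with
  | nil =>
    intro S hS
    have : update S k [] = S := by
      rw [← show S k = [] from hS, update_eq_self]
    rw [this]
    exact Runs.loop_false (h₀ v)
  | cons a l ih =>
    intro S hS
    have h := ih (update S k l.tail) (by simp)
    rw [update_idem] at h
    have e := Runs.pop k get (get v (some a)) S
    rw [h₃, hS] at e
    exact (Runs.loop_true (h₁ v a) e h).mono (by simp only [List.length_cons]; omega)

end StackProgram

/-! ### Matrix programs, and the stacks that represent their memory -/

namespace MatrixProgram

open Function StackProgram

/-- Variables that range over the rows of the matrix. -/
inductive RVar
  | target | round | source | dest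
  deriving DecidableEq

/-- Variables that range over the columns of the matrix. -/
inductive CVar
  | outer | inner | good | header
  deriving DecidableEq

/-- The fields of an entry of the matrix. -/
inductive Fld
  | val | own | give | recv | reach | cur | cand
  deriving DecidableEq

instance : Fintype RVar := ⟨{.target, .round, .source, .dest}, by intro x; cases x <;> decide⟩

instance : Fintype CVar := ⟨{.outer, .inner, .good, .header}, by intro x; cases x <;> decide⟩

instance : Fintype Fld :=
  ⟨{.val, .own, .give, .recv, .reach, .cur, .cand}, by intro x; cases x <;> decide⟩

/-- Loop variables. -/
abbrev Var := RVar ⊕ CVar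

instance : BEq Var := instBEqOfDecidableEq

/-- A memory: a matrix of records of bits and a counter. -/
@[ext]
structure Mem where
  /-- the bit in a field of an entry -/
  bit : Fld → ℕ → ℕ → Bool
  /-- the counter -/
  ctr : ℕ

/-- Sets the bit in the field `f` of the entry `(x, y)`. -/
def Mem.set (μ : Mem) (f : Fld) (x y : ℕ) (b : Bool) : Mem where
  bit f' x' y' := if f' = f ∧ x' = x ∧ y' = y then b else μ.bit f' x' y'
  ctr := μ.ctr

/-- Programs that operate on a memory by bounded loops. -/
inductive Prog
  | skip
  | seq (p q : Prog)
  | set (x : RVar) (y : CVar) (f : Fld) (b : Bool)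
  | test (x : RVar) (y : CVar) (f : Fld) (p q : Prog)
  | for_ (x : Var) (p : Prog)
  | inc
  | dec
  | pos (p q : Prog)

/-- The number of values of a loop variable. Column `0` is an additional header column. -/
def dim (n m : ℕ) : Var → ℕ
  | .inl _ => n
  | .inr _ => m + 1

/-- The effect of a program on the memory, for given values of the loop variables. -/
def Prog.denote (n m : ℕ) : Prog → (Var → ℕ) → Mem → Mem
  | .skip, _, μ => μ
  | .seq p q, ρ, μ => q.denote n m ρ (p.denote n m ρ μ)
  | .set x y f b, ρ, μ => μ.set f (ρ (.inl x)) (ρ (.inr y)) b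
  | .test x y f p q, ρ, μ =>
    if μ.bit f (ρ (.inl x)) (ρ (.inr y)) then p.denote n m ρ μ else q.denote n m ρ μ
  | .for_ x p, ρ, μ =>
    (List.range (dim n m x)).foldl (fun μ j => p.denote n m (update ρ x j) μ) μ
  | .inc, _, μ => { μ with ctr := μ.ctr + 1 }
  | .dec, _, μ => { μ with ctr := μ.ctr - 1 }
  | .pos p q, ρ, μ => if 0 < μ.ctr then p.denote n m ρ μ else q.denote n m ρ μ

/-- A program does not loop over a variable inside a loop over that variable. -/
def Prog.WF : Prog → Finset Var → Prop
  | .seq p q, V => p.WF V ∧ q.WF V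
  | .test _ _ _ p q, V => p.WF V ∧ q.WF V
  | .for_ x p, V => x ∉ V ∧ p.WF (insert x V)
  | .pos p q, V => p.WF V ∧ q.WF V
  | _, _ => True

instance Prog.decidableWF : (p : Prog) → (V : Finset Var) → Decidable (p.WF V)
  | .skip, _ => inferInstanceAs (Decidable True)
  | .seq p q, V =>
    let _ := p.decidableWF V
    let _ := q.decidableWF V
    inferInstanceAs (Decidable (p.WF V ∧ q.WF V))
  | .set _ _ _ _, _ => inferInstanceAs (Decidable True)
  | .test _ _ _ p q, V =>
    let _ := p.decidableWF V
    let _ := q.decidableWF V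
    inferInstanceAs (Decidable (p.WF V ∧ q.WF V))
  | .for_ x p, V =>
    let _ := p.decidableWF (insert x V)
    inferInstanceAs (Decidable (x ∉ V ∧ p.WF (insert x V)))
  | .inc, _ => inferInstanceAs (Decidable True)
  | .dec, _ => inferInstanceAs (Decidable True)
  | .pos p q, V =>
    let _ := p.decidableWF V
    let _ := q.decidableWF V
    inferInstanceAs (Decidable (p.WF V ∧ q.WF V))

/-- The stacks of the machine. -/
inductive Stk
  | inp | out | left | right | tmp | ctr
  | lo (x : Var)
  | hi (x : Var)
  deriving DecidableEq

instance : Fintype Stk :=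
  ⟨{.inp, .out, .left, .right, .tmp, .ctr} ∪ Finset.univ.image .lo ∪ Finset.univ.image .hi, by
    intro x; cases x <;> simp⟩

/-- A tape symbol: whether it is a header, and the fields. -/
abbrev Sym := Bool × (Fld → Bool)

/-- The stack alphabets. -/
abbrev Alph : Stk → Type
  | .inp => Option Bool
  | .out => Option Bool
  | .left => Sym
  | .right => Sym
  | _ => Unit

/-- The finite register of the machine: a flag, a bit, and a buffer. -/
abbrev Reg := Bool × Bool × Sym

/-- The register with given flag and bit, and an empty buffer. -/
abbrev reg (flag bit : Bool) : Reg := (flag, bit, (false, fun _ => false))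

/-- The contents of the stacks. -/
structure Store where
  /-- input -/
  inp : List (Option Bool)
  /-- output -/
  out : List (Option Bool)
  /-- tape to the left of the head -/
  left : List Sym
  /-- tape to the right of the head -/
  right : List Sym
  /-- temporary counter -/
  tmp : ℕ
  /-- the counter -/
  ctr : ℕ
  /-- the values of the loop variables -/
  lo : Var → ℕ
  /-- the number of values from the value of the loop variable on -/
  hi : Var → ℕ

/-- The stacks with given contents. -/
def Store.stk (s : Store) : ∀ k, List (Alph k)
  | .inp => s.inp
  | .out => s.out
  | .left => s.left
  | .right => s.right
  | .tmp => List.replicate s.tmp ()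
  | .ctr => List.replicate s.ctr ()
  | .lo x => List.replicate (s.lo x) ()
  | .hi x => List.replicate (s.hi x) ()

namespace Store

variable (s : Store)

theorem update_inp (l : List (Option Bool)) :
    update s.stk .inp l = stk { s with inp := l } := by
  funext k
  cases k <;> simp [stk, update]

theorem update_out (l : List (Option Bool)) :
    update s.stk .out l = stk { s with out := l } := by
  funext k
  cases k <;> simp [stk, update]

theorem update_left (l : List Sym) : update s.stk .left l = stk { s with left := l } := by
  funext k
  cases k <;> simp [stk, update]

theorem update_right (l : List Sym) : update s.stk .right l = stk { s with right := l } := by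
  funext k
  cases k <;> simp [stk, update]

theorem update_tmp (l : List Unit) : update s.stk .tmp l = stk { s with tmp := l.length } := by
  funext k
  cases k <;> simp [stk, update]
  exact List.eq_replicate_length.2 (fun _ _ => rfl)

theorem update_ctr (l : List Unit) : update s.stk .ctr l = stk { s with ctr := l.length } := by
  funext k
  cases k <;> simp [stk, update]
  exact List.eq_replicate_length.2 (fun _ _ => rfl)

theorem update_lo (x : Var) (l : List Unit) :
    update s.stk (.lo x) l = stk { s with lo := update s.lo x l.length } := by
  funext k
  by_cases hk : k = .lo x
  · subst hk
    simp only [update_self, stk]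
    exact List.eq_replicate_length.2 (fun _ _ => rfl)
  · rw [update_of_ne hk]
    cases k with
    | lo x' => simp [stk, show x' ≠ x by rintro rfl; exact hk rfl]
    | _ => rfl

theorem update_hi (x : Var) (l : List Unit) :
    update s.stk (.hi x) l = stk { s with hi := update s.hi x l.length } := by
  funext k
  by_cases hk : k = .hi x
  · subst hk
    simp only [update_self, stk]
    exact List.eq_replicate_length.2 (fun _ _ => rfl)
  · rw [update_of_ne hk]
    cases k with
    | hi x' => simp [stk, show x' ≠ x by rintro rfl; exact hk rfl]
    | _ => rfl

end Store

/-- Sets the flag if a symbol is present. -/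
def getUnit (v : Reg) (o : Option Unit) : Reg := reg o.isSome v.2.1

/-- Loads a symbol into the buffer. -/
def getSym (v : Reg) (o : Option Sym) : Reg :=
  o.elim (reg false v.2.1) fun a => (true, v.2.1, a)

/-- Sets the flag if an entry is present that is not a header. -/
def getEntry (v : Reg) (o : Option Sym) : Reg := reg (o.elim false fun a => !a.1) v.2.1

abbrev Code := Cmd Alph Reg

/-- `Exec c v s v' s' t`: the code `c` runs from `v, s` to `v', s'` within time `t`. -/
abbrev Exec (c : Code) (v : Reg) (s : Store) (v' : Reg) (s' : Store) (t : ℕ) : Prop :=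
  Runs c v s.stk v' s'.stk t

theorem Exec.congr {c : Code} {v v' v'' : Reg} {s s' s'' : Store} {t t' : ℕ}
    (h : Exec c v s v' s' t) (hv : v' = v'') (hs : s' = s'') (ht : t ≤ t') :
    Exec c v s v'' s'' t' := by
  subst hv hs
  exact Runs.mono h ht

theorem exec_pop_right (f) (v : Reg) (s : Store) :
    Exec (.pop .right f) v s (f v s.right.head?) { s with right := s.right.tail } 1 := by
  have := Runs.pop (Γ := Alph) Stk.right f v s.stk
  erw [Store.update_right] at this
  exact this

theorem exec_peek_right (f) (v : Reg) (s : Store) :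
    Exec (.peek .right f) v s (f v s.right.head?) s 1 :=
  Runs.peek (Γ := Alph) Stk.right f v s.stk

theorem exec_push_right (f) (v : Reg) (s : Store) :
    Exec (.push .right f) v s v { s with right := f v :: s.right } 1 := by
  have := Runs.push (Γ := Alph) Stk.right f v s.stk
  erw [Store.update_right] at this
  exact this

theorem exec_push_left (f) (v : Reg) (s : Store) :
    Exec (.push .left f) v s v { s with left := f v :: s.left } 1 := by
  have := Runs.push (Γ := Alph) Stk.left f v s.stk
  erw [Store.update_left] at this
  exact this

theorem exec_pop_inp (f) (v : Reg) (s : Store) :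
    Exec (.pop .inp f) v s (f v s.inp.head?) { s with inp := s.inp.tail } 1 := by
  have := Runs.pop (Γ := Alph) Stk.inp f v s.stk
  erw [Store.update_inp] at this
  exact this

theorem exec_push_tmp (f) (v : Reg) (s : Store) :
    Exec (.push .tmp f) v s v { s with tmp := s.tmp + 1 } 1 := by
  have := Runs.push (Γ := Alph) Stk.tmp f v s.stk
  erw [Store.update_tmp] at this
  exact Exec.congr this rfl (by simp [Store.stk]) (by simp)

theorem exec_push_ctr (f) (v : Reg) (s : Store) :
    Exec (.push .ctr f) v s v { s with ctr := s.ctr + 1 } 1 := by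
  have := Runs.push (Γ := Alph) Stk.ctr f v s.stk
  erw [Store.update_ctr] at this
  exact Exec.congr this rfl (by simp [Store.stk]) (by simp)

theorem head?_replicate_unit (c : ℕ) (v : Reg) :
    getUnit v (List.replicate c ()).head? = reg (decide (0 < c)) v.2.1 := by
  cases c <;> simp [getUnit, List.replicate_succ]

theorem exec_pop_ctr (v : Reg) (s : Store) :
    Exec (.pop .ctr getUnit) v s (reg (decide (0 < s.ctr)) v.2.1) { s with ctr := s.ctr - 1 } 1 := by
  have := Runs.pop (Γ := Alph) Stk.ctr getUnit v s.stk
  erw [Store.update_ctr, head?_replicate_unit] at this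
  exact Exec.congr this rfl (by simp [Store.stk]) (by simp)

theorem exec_peek_ctr (v : Reg) (s : Store) :
    Exec (.peek .ctr getUnit) v s (reg (decide (0 < s.ctr)) v.2.1) s 1 := by
  have := Runs.peek (Γ := Alph) Stk.ctr getUnit v s.stk
  erw [head?_replicate_unit] at this
  exact this

theorem exec_pop_lo (x : Var) (v : Reg) (s : Store) :
    Exec (.pop (.lo x) getUnit) v s (reg (decide (0 < s.lo x)) v.2.1)
      { s with lo := update s.lo x (s.lo x - 1) } 1 := by
  have := Runs.pop (Γ := Alph) (Stk.lo x) getUnit v s.stk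
  erw [Store.update_lo, head?_replicate_unit] at this
  exact Exec.congr this rfl (by simp [Store.stk]) (by simp)

theorem exec_push_lo (x : Var) (f) (v : Reg) (s : Store) :
    Exec (.push (.lo x) f) v s v { s with lo := update s.lo x (s.lo x + 1) } 1 := by
  have := Runs.push (Γ := Alph) (Stk.lo x) f v s.stk
  erw [Store.update_lo] at this
  exact Exec.congr this rfl (by simp [Store.stk]) (by simp)

theorem exec_pop_hi (x : Var) (v : Reg) (s : Store) :
    Exec (.pop (.hi x) getUnit) v s (reg (decide (0 < s.hi x)) v.2.1)
      { s with hi := update s.hi x (s.hi x - 1) } 1 := by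
  have := Runs.pop (Γ := Alph) (Stk.hi x) getUnit v s.stk
  erw [Store.update_hi, head?_replicate_unit] at this
  exact Exec.congr this rfl (by simp [Store.stk]) (by simp)

theorem exec_peek_hi (x : Var) (v : Reg) (s : Store) :
    Exec (.peek (.hi x) getUnit) v s (reg (decide (0 < s.hi x)) v.2.1) s 1 := by
  have := Runs.peek (Γ := Alph) (Stk.hi x) getUnit v s.stk
  erw [head?_replicate_unit] at this
  exact this

theorem exec_push_hi (x : Var) (f) (v : Reg) (s : Store) :
    Exec (.push (.hi x) f) v s v { s with hi := update s.hi x (s.hi x + 1) } 1 := by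
  have := Runs.push (Γ := Alph) (Stk.hi x) f v s.stk
  erw [Store.update_hi] at this
  exact Exec.congr this rfl (by simp [Store.stk]) (by simp)

theorem exec_move_tmp_lo (x : Var) (v : Reg) (s : Store) :
    Exec (.move .tmp (.lo x) getUnit Prod.fst fun _ => ()) v s (reg false v.2.1)
      { s with tmp := 0, lo := update s.lo x (s.tmp + s.lo x) } (3 * s.tmp + 2) := by
  have := Runs.move (Γ := Alph) (k := Stk.tmp) (k' := Stk.lo x) (by simp) (get := getUnit)
    (p := Prod.fst) (put := fun _ => ()) (fun _ => ()) (fun _ => rfl) (fun _ _ => rfl)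
    (fun _ _ => rfl) (fun _ _ _ => rfl) v s.stk
  erw [Store.update_tmp, Store.update_lo] at this
  exact Exec.congr this rfl (by simp [Store.stk]) (by simp [Store.stk])

theorem exec_move_lo_hi (x : Var) (v : Reg) (s : Store) :
    Exec (.move (.lo x) (.hi x) getUnit Prod.fst fun _ => ()) v s (reg false v.2.1)
      { s with lo := update s.lo x 0, hi := update s.hi x (s.lo x + s.hi x) }
      (3 * s.lo x + 2) := by
  have := Runs.move (Γ := Alph) (k := Stk.lo x) (k' := Stk.hi x) (by simp) (get := getUnit)
    (p := Prod.fst) (put := fun _ => ()) (fun _ => ()) (fun _ => rfl) (fun _ _ => rfl)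
    (fun _ _ => rfl) (fun _ _ _ => rfl) v s.stk
  erw [Store.update_lo, Store.update_hi] at this
  exact Exec.congr this rfl (by simp [Store.stk]) (by simp [Store.stk])

theorem exec_move_left_right (v : Reg) (s : Store) :
    Exec (.move .left .right getSym Prod.fst fun v => v.2.2) v s (reg false v.2.1)
      { s with left := [], right := s.left.reverse ++ s.right } (3 * s.left.length + 2) := by
  have := Runs.move (Γ := Alph) (k := Stk.left) (k' := Stk.right) (by simp) (get := getSym)
    (p := Prod.fst) (put := fun v => v.2.2) (fun a => a) (fun _ => rfl) (fun _ _ => rfl)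
    (fun _ _ => rfl) (fun _ _ _ => rfl) v s.stk
  erw [Store.update_left, Store.update_right] at this
  exact Exec.congr this rfl (by simp [Store.stk]) (by simp [Store.stk])

theorem exec_move_right_left (v : Reg) (s : Store) :
    Exec (.move .right .left getSym Prod.fst fun v => v.2.2) v s (reg false v.2.1)
      { s with right := [], left := s.right.reverse ++ s.left } (3 * s.right.length + 2) := by
  have := Runs.move (Γ := Alph) (k := Stk.right) (k' := Stk.left) (by simp) (get := getSym)
    (p := Prod.fst) (put := fun v => v.2.2) (fun a => a) (fun _ => rfl) (fun _ _ => rfl)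
    (fun _ _ => rfl) (fun _ _ _ => rfl) v s.stk
  erw [Store.update_right, Store.update_left] at this
  exact Exec.congr this rfl (by simp [Store.stk]) (by simp [Store.stk])

/-- The output symbol of a tape symbol. -/
def outSym (a : Sym) : Option Bool := if a.1 then none else some (a.2 .own)

theorem exec_move_left_out (v : Reg) (s : Store) :
    Exec (.move .left .out getSym Prod.fst fun v => outSym v.2.2) v s (reg false v.2.1)
      { s with left := [], out := (s.left.map outSym).reverse ++ s.out }
      (3 * s.left.length + 2) := by
  have := Runs.move (Γ := Alph) (k := Stk.left) (k' := Stk.out) (by simp) (get := getSym)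
    (p := Prod.fst) (put := fun v => outSym v.2.2) outSym (fun _ => rfl) (fun _ _ => rfl)
    (fun _ _ => rfl) (fun _ _ _ => rfl) v s.stk
  erw [Store.update_left, Store.update_out] at this
  exact Exec.congr this rfl (by simp [Store.stk]) (by simp [Store.stk])

theorem exec_clear_hi (x : Var) (v : Reg) (s : Store) :
    Exec (.clear (.hi x) getUnit Prod.fst) v s (reg false v.2.1)
      { s with hi := update s.hi x 0 } (2 * s.hi x + 2) := by
  have := Runs.clear (Γ := Alph) (k := Stk.hi x) (get := getUnit) (p := Prod.fst)
    (fun _ => rfl) (fun _ _ => rfl) (fun _ _ _ => rfl) v s.stk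
  erw [Store.update_hi] at this
  exact Exec.congr this rfl (by simp) (by simp [Store.stk])

end MatrixProgram

/-! ### Compilation of matrix programs to stack code, with time bounds -/

namespace MatrixProgram

open Function StackProgram

/-- Resets the register. -/
def resetReg : Code := .load fun _ => reg false false

/-- Moves the head one symbol to the right. -/
def advance : Code :=
  .seq (.pop .right getSym) (.seq (.push .left fun v => v.2.2) (.load fun v => reg true v.2.1))

/-- Moves the head to the next header. -/
def skipRow : Code :=
  .seq advance (.seq (.peek .right getEntry)
    (.loop Prod.fst (.seq advance (.peek .right getEntry))))

/-- Repeats `c` as often as the value of the variable `x` says. -/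
def repeatVar (x : Var) (c : Code) : Code :=
  .seq (.pop (.lo x) getUnit)
    (.seq (.loop Prod.fst (.seq (.push .tmp fun _ => ()) (.seq c (.pop (.lo x) getUnit))))
      (.move .tmp (.lo x) getUnit Prod.fst fun _ => ()))

/-- Executes `c` with the head at the entry `(x, y)` of the matrix. -/
def atEntry (x : RVar) (y : CVar) (c : Code) : Code :=
  .seq (repeatVar (.inl x) skipRow) (.seq (repeatVar (.inr y) advance)
    (.seq c (.move .left .right getSym Prod.fst fun v => v.2.2)))

/-- The code of a program. -/
def Prog.code : Prog → Code
  | .skip => resetReg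
  | .seq p q => .seq p.code q.code
  | .set x y f b => atEntry x y
      (.seq (.pop .right getSym) (.push .right fun v => (v.2.2.1, update v.2.2.2 f b)))
  | .test x y f p q =>
    .seq (atEntry x y (.peek .right fun _ o => reg false (o.elim false fun a => a.2 f)))
      (.ite (fun v => v.2.1) (.seq resetReg p.code) (.seq resetReg q.code))
  | .for_ x p =>
    .seq (.peek (.hi x) getUnit)
      (.seq (.loop Prod.fst (.seq resetReg (.seq p.code (.seq (.pop (.hi x) getUnit)
        (.seq (.push (.lo x) fun _ => ()) (.peek (.hi x) getUnit))))))
        (.move (.lo x) (.hi x) getUnit Prod.fst fun _ => ()))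
  | .inc => .push .ctr fun _ => ()
  | .dec => .seq (.pop .ctr getUnit) resetReg
  | .pos p q => .seq (.peek .ctr getUnit)
      (.ite Prod.fst (.seq resetReg p.code) (.seq resetReg q.code))

/-- A bound on the running time of a program in terms of the size of the matrix. -/
noncomputable def Prog.time : Prog → Polynomial ℕ
  | .skip => 1
  | .seq p q => p.time + q.time
  | .set _ _ _ _ => 24 * .X + 12
  | .test _ _ _ p q => 24 * .X + 12 + (p.time + q.time + 2)
  | .for_ _ p => .X * (p.time + 5) + 3 * .X + 4
  | .inc => 1
  | .dec => 2
  | .pos p q => p.time + q.time + 3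

theorem exec_resetReg (v : Reg) (s : Store) : Exec resetReg v s (reg false false) s 1 :=
  Runs.load _ v _

theorem exec_advance (v : Reg) (s : Store) (a : Sym) (r : List Sym) (h : s.right = a :: r) :
    Exec advance v s (reg true v.2.1) { s with left := a :: s.left, right := r } 3 := by
  refine Runs.seq (s := 1) (t := 2) (exec_pop_right _ v s)
    (Runs.seq (s := 1) (t := 1) (exec_push_left _ _ _) ?_)
  have := Runs.load (Γ := Alph) (fun v : Reg => reg true v.2.1) (getSym v s.right.head?)
    (Store.stk { s with left := a :: s.left, right := r })
  rw [h] at this ⊢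
  exact this

/-- The loop stops by looking ahead at the next symbol, so the head comes to rest directly before
the next header, or at the end of the tape. -/
theorem exec_skipRow (v : Reg) (s : Store) (h : Sym) (cells r : List Sym)
    (hs : s.right = h :: (cells ++ r)) (hc : ∀ a ∈ cells, a.1 = false)
    (hr : ∀ a ∈ r.head?, a.1 = true) :
    Exec skipRow v s (reg false v.2.1)
      { s with left := cells.reverse ++ h :: s.left, right := r } (5 * cells.length + 6) := by
  have hrf : ∀ w, getEntry w r.head? = reg false w.2.1 := by
    intro w
    cases hr' : r.head? with
    | none => rfl
    | some a => simp [getEntry, hr a hr']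
  suffices ∀ (l : List Sym) (s : Store), s.right = l ++ r → (∀ a ∈ l, a.1 = false) →
      Exec (.loop Prod.fst (.seq advance (.peek .right getEntry)))
        (getEntry (reg true v.2.1) (l ++ r).head?) s (reg false v.2.1)
        { s with left := l.reverse ++ s.left, right := r } (5 * l.length + 1) by
    refine Exec.congr (Runs.seq (exec_advance v s h _ hs) (Runs.seq (exec_peek_right _ _ _)
      (this cells _ rfl hc))) rfl rfl ?_
    omega
  intro l
  induction l with
  | nil =>
    intro s hs _
    rw [List.nil_append, hrf]
    refine Exec.congr (s' := s) (Runs.loop_false rfl) rfl ?_ le_rfl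
    cases s
    simp_all
  | cons a l ih =>
    intro s hs hl
    have ha : getEntry (reg true v.2.1) (a :: l ++ r).head? = reg true v.2.1 := by
      simp [getEntry, hl a (by simp)]
    rw [ha]
    have e := ih { s with left := a :: s.left, right := l ++ r } rfl
      (fun b hb => hl b (by simp [hb]))
    have e' := exec_peek_right getEntry (reg true v.2.1)
      { s with left := a :: s.left, right := l ++ r }
    refine Exec.congr (Runs.loop_true rfl (Runs.seq (exec_advance _ s a (l ++ r) hs) e') e) rfl
      (by simp) ?_
    simp only [List.length_cons]
    omega

/-- Each iteration shifts one unit from `lo x` to `tmp`, and the final move restores `lo x`. The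
body therefore has to work for arbitrary `tmp` and `lo`; the flag it leaves is irrelevant, since the
next pop overwrites it. -/
theorem exec_repeatVar (x : Var) (c : Code) (s : Store) (hs : s.tmp = 0) (bit : Bool)
    (l r : ℕ → List Sym) (t : ℕ) (hl : s.left = l 0) (hr : s.right = r 0)
    (hc : ∀ j < s.lo x, ∀ T A, ∃ f, Exec c (reg true bit)
      { s with left := l j, right := r j, tmp := T, lo := A } (reg f bit)
      { s with left := l (j + 1), right := r (j + 1), tmp := T, lo := A } t)
    (f : Bool) :
    Exec (repeatVar x c) (reg f bit) s (reg false bit)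
      { s with left := l (s.lo x), right := r (s.lo x) } (s.lo x * (t + 6) + 4) := by
  set N := s.lo x with hN
  have h := Runs.loop_iterate (Γ := Alph) (p := Prod.fst)
    (c := .seq (.push .tmp fun _ => ()) (.seq c (.pop (.lo x) getUnit)))
    (fun j => reg (decide (j < N)) bit)
    (fun j => Store.stk { s with left := l j, right := r j, tmp := j,
                                 lo := update s.lo x (N - 1 - j) })
    N (t + 2) (by simp) (by simp) (by
      intro j hj
      obtain ⟨f, e⟩ := hc j hj (j + 1) (update s.lo x (N - 1 - j))
      simp only [hj, decide_true]
      refine Exec.congr (Runs.seq (exec_push_tmp _ _ _) (Runs.seq e (exec_pop_lo x _ _))) ?_ ?_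
        (by omega)
      · simp only [update_self]
        congr 2
        exact eq_iff_iff.2 (by omega)
      · simp only [update_self, update_idem]
        congr 2)
  have h₁ := exec_pop_lo x (reg f bit) s
  have h₂ := exec_move_tmp_lo x (reg (decide (N < N)) bit)
    { s with left := l N, right := r N, tmp := N, lo := update s.lo x (N - 1 - N) }
  refine Exec.congr (Runs.seq (Exec.congr h₁ rfl ?_ le_rfl) (Runs.seq h h₂)) rfl ?_ ?_
  · cases s
    simp_all
  · simp only [update_self, update_idem]
    rw [show N + (N - 1 - N) = s.lo x by omega, update_eq_self, hs]
  · simp only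
    ring_nf
    omega

/-- The tape symbol of an entry. -/
def sym (bit : Fld → ℕ → ℕ → Bool) (x y : ℕ) : Sym := (decide (y = 0), fun f => bit f x y)

/-- The tape symbols of the entries `a, …, b - 1` of a row. -/
def rowSyms (bit : Fld → ℕ → ℕ → Bool) (x a b : ℕ) : List Sym :=
  (List.range' a (b - a)).map (sym bit x)

/-- The tape symbols of the rows `a, …, b - 1`. -/
def rowsSyms (bit : Fld → ℕ → ℕ → Bool) (m a b : ℕ) : List Sym :=
  (List.range' a (b - a)).flatMap fun x => rowSyms bit x 0 (m + 1)

/-- The header after the last row. -/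
def sentinel : Sym := (true, fun _ => false)

/-- The tape of a matrix. -/
def tape (n m : ℕ) (bit : Fld → ℕ → ℕ → Bool) : List Sym := rowsSyms bit m 0 n ++ [sentinel]

section tape

variable (bit : Fld → ℕ → ℕ → Bool) (m : ℕ)

theorem rowSyms_cons {x a b : ℕ} (h : a < b) :
    rowSyms bit x a b = sym bit x a :: rowSyms bit x (a + 1) b := by
  obtain ⟨d, rfl⟩ := Nat.exists_eq_add_of_lt h
  simp [rowSyms, show a + d + 1 - a = d + 1 by omega, show a + d + 1 - (a + 1) = d by omega,
    List.range'_succ]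

theorem rowSyms_concat (x b : ℕ) :
    rowSyms bit x 0 (b + 1) = rowSyms bit x 0 b ++ [sym bit x b] := by
  simp [rowSyms, List.range'_concat]

theorem rowsSyms_cons {a b : ℕ} (h : a < b) :
    rowsSyms bit m a b = rowSyms bit a 0 (m + 1) ++ rowsSyms bit m (a + 1) b := by
  obtain ⟨d, rfl⟩ := Nat.exists_eq_add_of_lt h
  simp [rowsSyms, show a + d + 1 - a = d + 1 by omega, show a + d + 1 - (a + 1) = d by omega,
    List.range'_succ]

theorem rowsSyms_concat (b : ℕ) :
    rowsSyms bit m 0 (b + 1) = rowsSyms bit m 0 b ++ rowSyms bit b 0 (m + 1) := by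
  simp [rowsSyms, List.range'_concat]

theorem length_rowSyms (x a b : ℕ) : (rowSyms bit x a b).length = b - a := by
  simp [rowSyms]

theorem length_rowsSyms (b : ℕ) : (rowsSyms bit m 0 b).length = b * (m + 1) := by
  induction b with
  | zero => simp [rowsSyms]
  | succ b ih =>
    rw [rowsSyms_concat, List.length_append, ih, length_rowSyms]
    ring_nf
    omega

variable {bit m}

theorem rowSyms_congr {bit' : Fld → ℕ → ℕ → Bool} {x a b : ℕ}
    (h : ∀ y, a ≤ y → y < b → ∀ f, bit f x y = bit' f x y) :
    rowSyms bit x a b = rowSyms bit' x a b := by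
  refine List.map_congr_left fun y hy => ?_
  rw [List.mem_range'_1] at hy
  simp only [sym, Prod.mk.injEq, true_and]
  exact funext fun f => h y (by omega) (by omega) f

theorem rowsSyms_congr {bit' : Fld → ℕ → ℕ → Bool} {a b : ℕ}
    (h : ∀ x, a ≤ x → x < b → ∀ y ≤ m, ∀ f, bit f x y = bit' f x y) :
    rowsSyms bit m a b = rowsSyms bit' m a b := by
  refine List.flatMap_congr fun x hx => ?_
  rw [List.mem_range'_1] at hx
  exact rowSyms_congr fun y _ hy => h x (by omega) (by omega) y (by omega)

variable (bit m)

/-- The part of the tape before an entry. -/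
def tapeBefore (x y : ℕ) : List Sym := rowsSyms bit m 0 x ++ rowSyms bit x 0 y

/-- The part of the tape after an entry. -/
def tapeAfter (n x y : ℕ) : List Sym :=
  rowSyms bit x (y + 1) (m + 1) ++ (rowsSyms bit m (x + 1) n ++ [sentinel])

theorem rowSyms_split {x y : ℕ} (hy : y ≤ m) :
    rowSyms bit x 0 (m + 1) = rowSyms bit x 0 y ++ rowSyms bit x y (m + 1) := by
  rw [rowSyms, rowSyms, rowSyms, ← List.map_append]
  congr 1
  have := List.range'_append_1 (s := 0) (m := y) (n := m + 1 - y)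
  rw [zero_add] at this
  rw [Nat.sub_zero, Nat.sub_zero, this]
  congr 1
  omega

theorem rowsSyms_split {n x : ℕ} (hx : x ≤ n) :
    rowsSyms bit m 0 n = rowsSyms bit m 0 x ++ rowsSyms bit m x n := by
  rw [rowsSyms, rowsSyms, rowsSyms, ← List.flatMap_append]
  congr 1
  have := List.range'_append_1 (s := 0) (m := x) (n := n - x)
  rw [zero_add] at this
  rw [Nat.sub_zero, Nat.sub_zero, this]
  congr 1
  omega

theorem tape_eq {n x y : ℕ} (hx : x < n) (hy : y ≤ m) :
    tape n m bit = tapeBefore bit m x y ++ sym bit x y :: tapeAfter bit m n x y := by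
  rw [tape, rowsSyms_split bit m hx.le, rowsSyms_cons bit m hx, rowSyms_split bit m hy,
    rowSyms_cons bit (by omega : y < m + 1), tapeBefore, tapeAfter]
  simp

theorem tape_set {n x y : ℕ} (hx : x < n) (hy : y ≤ m) (μ : Mem) (f : Fld) (b : Bool) :
    tape n m (μ.set f x y b).bit = tapeBefore μ.bit m x y ++
      (decide (y = 0), update (fun f => μ.bit f x y) f b) :: tapeAfter μ.bit m n x y := by
  rw [tape_eq _ m hx hy]
  congr 1
  · rw [tapeBefore, tapeBefore]
    congr 1
    · refine rowsSyms_congr fun x' _ hx' y' _ f' => ?_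
      simp only [Mem.set]
      rw [if_neg (by omega)]
    · refine rowSyms_congr fun y' _ hy' f' => ?_
      simp only [Mem.set]
      rw [if_neg (by omega)]
  · congr 1
    · simp only [sym, Prod.mk.injEq, true_and]
      funext f'
      by_cases hf : f' = f
      · subst hf
        simp [Mem.set]
      · simp [Mem.set, hf]
    · rw [tapeAfter, tapeAfter]
      congr 1
      · refine rowSyms_congr fun y' hy' _ f' => ?_
        simp only [Mem.set]
        rw [if_neg (by omega)]
      · congr 1
        refine rowsSyms_congr fun x' hx' _ y' _ f' => ?_
        simp only [Mem.set]
        rw [if_neg (by omega)]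

end tape

/-- The store that represents a memory and the values of the loop variables. -/
def conf (n m : ℕ) (ρ : Var → ℕ) (μ : Mem) : Store where
  inp := []
  out := []
  left := []
  right := tape n m μ.bit
  tmp := 0
  ctr := μ.ctr
  lo := ρ
  hi x := dim n m x - ρ x

/-- The head skips as many rows and then as many symbols as the two variables say, lets `c` change
at most the symbol under it, and rewinds. Skipping rows, advancing and rewinding are each linear in
the length of the tape. -/
theorem exec_atEntry {n m : ℕ} {x : RVar} {y : CVar} {c : Code} {ρ : Var → ℕ} {μ : Mem} {v : Reg}
    {a : Sym} (hx : ρ (.inl x) < n) (hy : ρ (.inr y) ≤ m)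
    (hc : ∀ L R : List Sym, Exec c (reg false false)
      { conf n m ρ μ with left := L, right := sym μ.bit (ρ (.inl x)) (ρ (.inr y)) :: R } v
      { conf n m ρ μ with left := L, right := a :: R } 2) :
    Exec (atEntry x y c) (reg false false) (conf n m ρ μ) (reg false v.2.1)
      { conf n m ρ μ with right := (tapeBefore μ.bit m (ρ (.inl x)) (ρ (.inr y)) ++
          a :: tapeAfter μ.bit m n (ρ (.inl x)) (ρ (.inr y))) } (24 * (n * (m + 1)) + 12) := by
  set X := ρ (.inl x) with hX
  set Y := ρ (.inr y) with hY
  have e₁ := exec_repeatVar (.inl x) skipRow (conf n m ρ μ) rfl false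
    (fun j => (rowsSyms μ.bit m 0 j).reverse)
    (fun j => rowsSyms μ.bit m j n ++ [sentinel]) (5 * m + 6) rfl rfl (by
      intro j hj T A
      have hj' : j < n := lt_trans hj hx
      refine ⟨false, Exec.congr (exec_skipRow _ _ (sym μ.bit j 0) (rowSyms μ.bit j 1 (m + 1))
        (rowsSyms μ.bit m (j + 1) n ++ [sentinel]) ?_ ?_ ?_) rfl ?_ ?_⟩
      · simp only
        rw [rowsSyms_cons _ _ hj', rowSyms_cons _ (Nat.succ_pos m)]
        simp
      · intro a ha
        simp only [rowSyms, List.mem_map, List.mem_range'_1] at ha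
        obtain ⟨y', hy', rfl⟩ := ha
        simp only [sym, decide_eq_false_iff_not]
        omega
      · intro a ha
        rcases Nat.lt_or_ge (j + 1) n with h | h
        · rw [rowsSyms_cons _ _ h, rowSyms_cons _ (Nat.succ_pos m)] at ha
          simp only [List.cons_append, List.head?_cons, Option.mem_def, Option.some.injEq] at ha
          subst ha
          rfl
        · simp only [rowsSyms, show n - (j + 1) = 0 by omega, List.range'_zero, List.flatMap_nil,
            List.nil_append, List.head?_cons, Option.mem_def, Option.some.injEq] at ha
          subst ha
          rfl
      · simp only
        congr 1
        rw [rowsSyms_concat, rowSyms_cons _ (Nat.succ_pos m)]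
        simp
      · rw [length_rowSyms]
        omega) false
  have e₂ := exec_repeatVar (.inr y) advance
    { conf n m ρ μ with left := (rowsSyms μ.bit m 0 X).reverse,
                        right := rowsSyms μ.bit m X n ++ [sentinel] } rfl false
    (fun j => (rowSyms μ.bit X 0 j).reverse ++ (rowsSyms μ.bit m 0 X).reverse)
    (fun j => rowSyms μ.bit X j (m + 1) ++ (rowsSyms μ.bit m (X + 1) n ++ [sentinel])) 3
    rfl (by simp [rowsSyms_cons _ _ hx]) (by
      intro j hj T A
      have hj' : j < m + 1 := lt_of_lt_of_le hj (hy.trans (Nat.le_succ m))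
      refine ⟨true, Exec.congr (exec_advance _ _ (sym μ.bit X j) _ (by
        simp only
        rw [rowSyms_cons _ hj', List.cons_append])) rfl ?_ le_rfl⟩
      simp only
      congr 1
      rw [rowSyms_concat]
      simp) false
  have e₃ := hc ((rowSyms μ.bit X 0 Y).reverse ++ (rowsSyms μ.bit m 0 X).reverse)
    (tapeAfter μ.bit m n X Y)
  have e₄ := exec_move_left_right v { conf n m ρ μ with
    left := (rowSyms μ.bit X 0 Y).reverse ++ (rowsSyms μ.bit m 0 X).reverse,
    right := a :: tapeAfter μ.bit m n X Y }
  refine Exec.congr (Runs.seq e₁ (Runs.seq (Exec.congr e₂ rfl ?_ le_rfl) (Runs.seq e₃ e₄))) rfl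
    ?_ ?_
  · simp only
    congr 1
    change rowSyms μ.bit X Y (m + 1) ++ _ = _
    rw [rowSyms_cons _ (by omega : Y < m + 1), tapeAfter, List.cons_append]
  · simp [tapeBefore, conf]
  · simp only [List.length_append, List.length_reverse, length_rowSyms, length_rowsSyms]
    change X * (5 * m + 6 + 6) + 4 + (Y * (3 + 6) + 4 + _) ≤ _
    have h₁ : X * (m + 1) + (m + 1) ≤ n * (m + 1) := by
      rw [← Nat.succ_mul]
      exact Nat.mul_le_mul_right _ hx
    have h₂ : X * (5 * m + 6 + 6) ≤ 12 * (X * (m + 1)) := by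
      rw [mul_left_comm]
      exact Nat.mul_le_mul_left _ (by omega)
    omega

/-- `V` collects the variables of the enclosing loops. All others have value `0`, so a loop finds
its `lo` stack empty and its `hi` stack full, and it leaves them in the same state. -/
theorem Prog.exec_code {n m : ℕ} (hn : 0 < n) (p : Prog) {V : Finset Var} (hp : p.WF V)
    {ρ : Var → ℕ} (hρ : ∀ x, ρ x < dim n m x) (hV : ∀ x, x ∉ V → ρ x = 0) (μ : Mem) :
    Exec p.code (reg false false) (conf n m ρ μ) (reg false false)
      (conf n m ρ (p.denote n m ρ μ)) (p.time.eval (n * (m + 1))) := by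
  have at_time : (24 * Polynomial.X + 12 : Polynomial ℕ).eval (n * (m + 1)) =
      24 * (n * (m + 1)) + 12 := by
    simp
  induction p generalizing V ρ μ with
  | skip => exact (exec_resetReg _ _).congr rfl rfl (by simp [time])
  | seq p q ihp ihq =>
    exact Exec.congr (Runs.seq (ihp hp.1 hρ hV μ) (ihq hp.2 hρ hV _)) rfl rfl (by simp [time])
  | set x y f b =>
    refine Exec.congr (exec_atEntry (hρ (.inl x)) (Nat.lt_succ_iff.1 (hρ (.inr y)))
      (v := (true, false, sym μ.bit _ _)) (a := (decide (ρ (.inr y) = 0),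
        update (fun f => μ.bit f (ρ (.inl x)) (ρ (.inr y))) f b)) fun L R =>
        Runs.seq (s := 1) (t := 1) (exec_pop_right _ _ _) (exec_push_right _ _ _))
      rfl ?_ (by rw [time, at_time])
    simp only [conf]
    rw [denote, tape_set (n := n) m (hρ (.inl x)) (Nat.lt_succ_iff.1 (hρ (.inr y)))]
    rfl
  | test x y f p q ihp ihq =>
    have e := exec_atEntry (n := n) (μ := μ)
      (v := reg false (μ.bit f (ρ (.inl x)) (ρ (.inr y))))
      (a := sym μ.bit (ρ (.inl x)) (ρ (.inr y))) (c := .peek .right fun _ o => reg false (o.elim false fun a => a.2 f))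
      (hρ (.inl x)) (Nat.lt_succ_iff.1 (hρ (.inr y))) fun L R =>
        Exec.congr (exec_peek_right _ _ _) rfl rfl (Nat.le_succ 1)
    rw [time, Polynomial.eval_add, at_time, denote]
    refine Runs.seq (e.congr rfl (s'' := conf n m ρ μ) ?_ le_rfl) ?_
    · rw [← tape_eq (n := n) μ.bit m (hρ (.inl x)) (Nat.lt_succ_iff.1 (hρ (.inr y)))]
      rfl
    · by_cases h : μ.bit f (ρ (.inl x)) (ρ (.inr y)) = true
      · rw [if_pos h]
        refine Exec.congr (Runs.ite_true h (Runs.seq (exec_resetReg _ _) (ihp hp.1 hρ hV μ)))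
          rfl rfl ?_
        simp
        omega
      · rw [if_neg h]
        refine Exec.congr (Runs.ite_false (Bool.eq_false_iff.2 h)
          (Runs.seq (exec_resetReg _ _) (ihq hp.2 hρ hV μ))) rfl rfl ?_
        simp
        omega
  | for_ x p ih =>
    set N := dim n m x with hN
    have hNL : N ≤ n * (m + 1) := by
      rw [hN]
      cases x
      · exact Nat.le_mul_of_pos_right _ (Nat.succ_pos m)
      · exact Nat.le_mul_of_pos_left _ hn
    have hx : ρ x = 0 := hV x hp.1
    -- `ν j` is the memory after `j` iterations; `s j` is the corresponding store at the loop test,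
    -- with `j` units on `lo x` and `N - j` on `hi x`.
    let ν : ℕ → Mem := fun j =>
      (List.range j).foldl (fun μ j => p.denote n m (update ρ x j) μ) μ
    have hν : ∀ j, ν (j + 1) = p.denote n m (update ρ x j) (ν j) := by
      intro j
      simp [ν, List.range_succ]
    let s : ℕ → Store := fun j =>
      { conf n m ρ (ν j) with lo := update ρ x j, hi := update (conf n m ρ μ).hi x (N - j) }
    have hconf : ∀ j, conf n m (update ρ x j) (ν j) = s j := by
      intro j
      simp only [conf, s]
      congr 1
      funext x'
      by_cases h : x' = x
      · subst h
        simp [hN]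
      · simp [h]
    -- After the body the memory has advanced to `ν (j + 1)` while the loop variable is still `j`;
    -- the pop and push that follow make up the difference.
    have hconf' : ∀ j, conf n m (update ρ x j) (ν (j + 1)) =
        { s (j + 1) with lo := update ρ x j, hi := update (conf n m ρ μ).hi x (N - j) } := by
      intro j
      simp only [conf, s]
      congr 1
      funext x'
      by_cases h : x' = x
      · subst h
        simp [hN]
      · simp [h]
    have e := Runs.loop_iterate (Γ := Alph) (p := Prod.fst)
      (c := .seq resetReg (.seq p.code (.seq (.pop (.hi x) getUnit)
        (.seq (.push (.lo x) fun _ => ()) (.peek (.hi x) getUnit)))))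
      (fun j => reg (decide (j < N)) false) (fun j => (s j).stk) N
      (p.time.eval (n * (m + 1)) + 4) (by simp) (by simp) (by
        intro j hj
        have e₁ := ih hp.2 (ρ := update ρ x j) (by
            intro x'
            by_cases h : x' = x
            · subst h
              simpa using hj
            · simpa [h] using hρ x')
          (by
            intro x' hx'
            rw [Finset.mem_insert, not_or] at hx'
            simpa [hx'.1] using hV x' hx'.2) (ν j)
        rw [← hν, hconf, hconf'] at e₁
        refine Exec.congr (Runs.seq (exec_resetReg _ _) (Runs.seq e₁ (Runs.seq
          (exec_pop_hi x _ _) (Runs.seq (exec_push_lo x _ _ _) (exec_peek_hi x _ _))))) ?_ ?_ ?_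
        · simp only [update_self]
          congr 2
          exact eq_iff_iff.2 (by omega)
        · simp only [update_self, update_idem, s]
          congr 2
        · omega)
    have e₀ := exec_peek_hi x (reg false false) (conf n m ρ μ)
    have e₂ := exec_move_lo_hi x (reg (decide (N < N)) false) (s N)
    refine Exec.congr (Runs.seq (Exec.congr e₀ ?_ ?_ le_rfl) (Runs.seq e e₂)) rfl ?_ ?_
    · simp [conf, hN, hx]
    · rw [← hconf]
      change _ = conf n m (update ρ x 0) μ
      rw [← hx, update_eq_self]
    · simp only [s, update_self, update_idem]
      change _ = conf n m ρ (ν N)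
      rw [← hx, update_eq_self, Nat.sub_self, Nat.add_zero, conf, conf]
      congr 1
      funext x'
      by_cases h : x' = x
      · subst h
        simp [hx, hN]
      · simp [h]
    · simp only [s, update_self, time]
      have : N * (p.time.eval (n * (m + 1)) + 4 + 1) ≤
          n * (m + 1) * (p.time.eval (n * (m + 1)) + 5) := Nat.mul_le_mul_right _ hNL
      simp only [Polynomial.eval_add, Polynomial.eval_mul, Polynomial.eval_X,
        Polynomial.eval_ofNat]
      omega
  | inc => exact (exec_push_ctr _ _ _).congr rfl rfl (by simp [time])
  | dec =>
    exact Exec.congr (Runs.seq (exec_pop_ctr _ _) (exec_resetReg _ _)) rfl rfl (by simp [time])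
  | pos p q ihp ihq =>
    rw [denote]
    by_cases h : 0 < μ.ctr
    · rw [if_pos h]
      refine Exec.congr (Runs.seq (exec_peek_ctr _ _) (Runs.ite_true (decide_eq_true h)
        (Runs.seq (exec_resetReg _ _) (ihp hp.1 hρ hV μ)))) rfl rfl ?_
      simp [time]
      omega
    · rw [if_neg h]
      refine Exec.congr (Runs.seq (exec_peek_ctr _ _) (Runs.ite_false (decide_eq_false h)
        (Runs.seq (exec_resetReg _ _) (ihq hp.2 hρ hV μ)))) rfl rfl ?_
      simp [time]
      omega

end MatrixProgram

/-! ### Reading the input and writing the output -/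

namespace MatrixProgram

open Function StackProgram Turing

/-- The tape symbol of an input symbol. -/
def inSym : Option Bool → Sym
  | none => sentinel
  | some b => (false, fun f => decide (f = .val) && b)

/-- Loads an input symbol into the buffer. -/
def getInp (v : Reg) (o : Option (Option Bool)) : Reg :=
  o.elim (reg false v.2.1) fun a => (true, v.2.1, inSym a)

/-- Increments the number of values of each of the variables. -/
def pushAll : List Var → Code
  | [] => .load id
  | x :: l => .seq (.push (.hi x) fun _ => ()) (pushAll l)

/-- Resets the number of values of each of the variables. -/
def clearAll : List Var → Code
  | [] => resetReg
  | x :: l => .seq (.clear (.hi x) getUnit Prod.fst) (clearAll l)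

/-- The row variables. -/
def rowVars : List Var := [.inl .target, .inl .round, .inl .source, .inl .dest]

/-- The column variables. -/
def colVars : List Var := [.inr .outer, .inr .inner, .inr .good, .inr .header]

/-- Handles one input symbol. The bit tells whether the first row is being read. -/
def readSymbol : Code :=
  .seq (.push .left fun v => v.2.2)
    (.seq (.ite (fun v => v.2.1) (pushAll colVars) (.load id))
      (.seq (.ite (fun v => v.2.2.1) (.seq (pushAll rowVars) (.load fun _ => reg true false))
        (.load id)) (.pop .inp getInp)))

/-- Reads the input, determines the size of the matrix and sets up the tape. -/
def readInput : Code :=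
  .seq (.load fun _ => reg false true) (.seq (.pop .inp getInp) (.seq (.loop Prod.fst readSymbol)
    (.seq (.move .left .right getSym Prod.fst fun v => v.2.2)
      (.seq (.push .right fun _ => sentinel) resetReg))))

/-- Writes the output and clears all other stacks. -/
def writeOutput : Code :=
  .seq (.pop .right getSym) (.seq (.move .right .left getSym Prod.fst fun v => v.2.2)
    (.seq (.move .left .out getSym Prod.fst fun v => outSym v.2.2)
      (clearAll (rowVars ++ colVars))))

theorem exec_pushAll (l : List Var) (v : Reg) (s : Store) :
    Exec (pushAll l) v s v { s with hi := fun x => s.hi x + l.count x } (l.length + 1) := by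
  induction l generalizing s with
  | nil => exact Runs.load id v _
  | cons x l ih =>
    refine Exec.congr (Runs.seq (exec_push_hi x _ v s) (ih _)) rfl ?_ ?_
    · simp only
      congr 1
      funext x'
      by_cases h : x' = x
      · subst h
        simp
        omega
      · rw [update_of_ne h, List.count_cons_of_ne (Ne.symm h)]
    · simp only [List.length_cons]
      omega

theorem exec_clearAll {L : ℕ} (l : List Var) (v : Reg) (s : Store) (hs : ∀ x, s.hi x ≤ L) :
    Exec (clearAll l) v s (reg false false) { s with hi := fun x => if x ∈ l then 0 else s.hi x }
      (l.length * (2 * L + 2) + 1) := by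
  induction l generalizing s v with
  | nil => simpa [clearAll] using exec_resetReg v s
  | cons x l ih =>
    refine Exec.congr (Runs.seq (exec_clear_hi x v s) (ih _ _ ?_)) rfl ?_ ?_
    · intro x'
      by_cases h : x' = x
      · subst h
        simp
      · simpa [h] using hs x'
    · simp only
      congr 1
      funext x'
      by_cases h : x' = x
      · subst h
        simp
      · simp [h]
    · have := hs x
      simp only [List.length_cons, Nat.succ_mul]
      omega

/-- The number of symbols up to the end of the first row. -/
def colCount : List (Option Bool) → ℕ
  | [] => 0
  | none :: _ => 1
  | some _ :: l => colCount l + 1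

/-- Every end-of-row symbol counts as one row. Columns are counted only while the bit is set, that
is, up to and including the first end-of-row symbol; this symbol accounts for the header column. -/
theorem exec_loop_readSymbol (l : List (Option Bool)) (bit : Bool) (s : Store)
    (hs : s.inp = l.tail) :
    ∃ bit', Exec (.loop Prod.fst readSymbol) (getInp (reg false bit) l.head?) s (reg false bit')
      { s with
        inp := []
        left := (l.map inSym).reverse ++ s.left
        hi := Sum.elim (fun r => s.hi (.inl r) + l.count none)
          (fun c => s.hi (.inr c) + if bit then colCount l else 0) } (17 * l.length + 1) := by
  induction l generalizing bit s with
  | nil =>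
    refine ⟨bit, Exec.congr (s' := s) (Runs.loop_false rfl) rfl ?_ le_rfl⟩
    cases s
    simp only [List.tail_nil] at hs
    subst hs
    simp only [List.map_nil, List.reverse_nil, List.nil_append, List.count_nil, colCount, ite_self,
      Nat.add_zero]
    congr 1
    funext x
    cases x <;> rfl
  | cons a l ih =>
    have e₁ := exec_push_left (fun v => v.2.2) (true, bit, inSym a) s
    let s₂ : Store := { s with
      left := inSym a :: s.left,
      hi := fun x => s.hi x + if bit then colVars.count x else 0 }
    have e₂ : Exec (.ite (fun v => v.2.1) (pushAll colVars) (.load id)) (true, bit, inSym a)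
        { s with left := inSym a :: s.left } (true, bit, inSym a) s₂ 6 := by
      cases bit
      · exact Exec.congr (Runs.ite_false rfl (Runs.load _ _ _)) rfl rfl (by omega)
      · exact Exec.congr (Runs.ite_true rfl (exec_pushAll _ _ _)) rfl rfl le_rfl
    cases a with
    | none =>
      let s₃ : Store := { s₂ with hi := fun x => s₂.hi x + rowVars.count x }
      have e₃ : Exec (.ite (fun v => v.2.2.1) (.seq (pushAll rowVars)
          (.load fun _ => reg true false)) (.load id)) (true, bit, inSym none) s₂
          (reg true false) s₃ 7 :=
        Exec.congr (Runs.ite_true rfl (Runs.seq (exec_pushAll _ _ _) (Runs.load _ _ _))) rfl rfl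
          le_rfl
      have e₄ := exec_pop_inp getInp (reg true false) s₃
      obtain ⟨bit', e₅⟩ := ih false { s₃ with inp := s₃.inp.tail } (by simp [s₃, s₂, hs])
      rw [show s₃.inp = l from hs] at e₄
      rw [show s₃.inp = l from hs] at e₅
      refine ⟨bit', Exec.congr (Runs.loop_true rfl
        (Runs.seq e₁ (Runs.seq e₂ (Runs.seq e₃ e₄))) e₅) rfl ?_ ?_⟩
      · simp only [s₃, s₂]
        congr 1
        · simp
        · funext x
          cases x with
          | inl r => cases r <;> simp [rowVars, colVars] <;> omega
          | inr c => cases c <;> simp [rowVars, colVars, colCount]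
      · simp only [List.length_cons]
        omega
    | some b =>
      have e₃ : Exec (.ite (fun v => v.2.2.1) (.seq (pushAll rowVars)
          (.load fun _ => reg true false)) (.load id)) (true, bit, inSym (some b)) s₂
          (true, bit, inSym (some b)) s₂ 7 :=
        Exec.congr (Runs.ite_false rfl (Runs.load _ _ _)) rfl rfl (by omega)
      have e₄ := exec_pop_inp getInp (true, bit, inSym (some b)) s₂
      obtain ⟨bit', e₅⟩ := ih bit { s₂ with inp := s₂.inp.tail } (by simp [s₂, hs])
      rw [show s₂.inp = l from hs] at e₄
      rw [show s₂.inp = l from hs] at e₅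
      refine ⟨bit', Exec.congr (Runs.loop_true rfl
        (Runs.seq e₁ (Runs.seq e₂ (Runs.seq e₃ e₄))) e₅) rfl ?_ ?_⟩
      · simp only [s₂]
        congr 1
        · simp
        · funext x
          cases x with
          | inl r => cases r <;> simp [colVars]
          | inr c => cases c <;> cases bit <;> simp [colVars, colCount] <;> omega
      · simp only [List.length_cons]
        omega

/-- The store that contains just an input and an output. -/
def ioStore (l l' : List (Option Bool)) : Store where
  inp := l
  out := l'
  left := []
  right := []
  tmp := 0
  ctr := 0
  lo _ := 0
  hi _ := 0

theorem exec_readInput (l : List (Option Bool)) :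
    Exec readInput (reg false false) (ioStore l []) (reg false false)
      { ioStore [] [] with
        right := sentinel :: l.map inSym
        hi := Sum.elim (fun _ => l.count none) (fun _ => colCount l) } (20 * l.length + 7) := by
  have e₀ := Runs.load (Γ := Alph) (fun _ => reg false true) (reg false false) (ioStore l []).stk
  have e₁ := exec_pop_inp getInp (reg false true) (ioStore l [])
  obtain ⟨bit', e₂⟩ := exec_loop_readSymbol l true { ioStore l [] with inp := l.tail } rfl
  refine Exec.congr (Runs.seq e₀ (Runs.seq e₁ (Runs.seq e₂ (Runs.seq (exec_move_left_right _ _)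
    (Runs.seq (exec_push_right _ _ _) (exec_resetReg _ _)))))) rfl ?_ ?_
  · simp [ioStore]
  · simp [ioStore]
    omega

/-- The two moves reverse the order twice, so the output appears in tape order. The first header is
dropped because the output has row ends instead of row beginnings. -/
theorem exec_writeOutput {L : ℕ} (s : Store) (a : Sym) (r : List Sym) (hs : s.right = a :: r)
    (hL : r.length ≤ L) (hhi : ∀ x, s.hi x ≤ L) (h : { s with right := [], hi := fun _ => 0 } =
      ioStore [] []) :
    Exec writeOutput (reg false false) s (reg false false) (ioStore [] (r.map outSym))
      (22 * L + 22) := by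
  have e₁ := exec_pop_right getSym (reg false false) s
  rw [hs] at e₁
  have e₄ := exec_clearAll (L := L) (rowVars ++ colVars) (reg false false) { s with
    right := [], left := [], out := r.map outSym } hhi
  refine Exec.congr (Runs.seq e₁ (Runs.seq (exec_move_right_left _ _)
    (Runs.seq (exec_move_left_out _ _) (Exec.congr (exec_clearAll (L := L) _ _ _ hhi) rfl rfl
    le_rfl)))) rfl ?_ ?_
  · cases s
    simp only [ioStore, Store.mk.injEq] at h ⊢
    obtain ⟨rfl, rfl, rfl, -, rfl, rfl, rfl, -⟩ := h
    simp only [List.tail_cons, List.append_nil, List.map_reverse, List.reverse_reverse, true_and]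
    funext x
    rw [if_pos]
    rcases x with x | x <;> cases x <;> decide
  · have : s.left = [] := congrArg Store.left h
    simp [this, rowVars, colVars]
    omega

/-- The memory with a given matrix in the field `val`. -/
def Mem.ofMatrix (X : ℕ → ℕ → Bool) : Mem where
  bit f i g := decide (f = .val) && X i g
  ctr := 0

/-- One symbol in front turns the end of each row into the header of the next: the encoding closes
every row by `none`, while the tape opens every row by a header and has one more at the end. -/
theorem cons_encodeMatrix {n m : ℕ} (X : ℕ → ℕ → Bool) :
    none :: FairDivision.encodeMatrix (fun (i : Fin n) (g : Fin m) => X i (g + 1)) =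
      ((List.range' 0 n).flatMap fun i => none :: (List.range' 1 m).map fun g => some (X i g)) ++
        [none] := by
  have h₁ : ∀ {α : Type} (k : ℕ) (F : ℕ → α), (List.ofFn fun i : Fin k => F i) =
      (List.range' 0 k).map F := by
    intro α k F
    rw [List.ofFn_eq_map, ← List.range_eq_range', ← List.map_coe_finRange_eq_range, List.map_map]
    rfl
  have h₂ : ∀ i, (List.ofFn fun g : Fin m => some (X i (g + 1))) =
      (List.range' 1 m).map fun g => some (X i g) := by
    intro i
    rw [h₁ m fun g => some (X i (g + 1)), ← List.range_eq_range', List.range'_eq_map_range,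
      List.map_map]
    refine List.map_congr_left fun g _ => ?_
    simp [add_comm]
  have h₃ : ∀ l : List ℕ, none :: (l.map fun i =>
        ((List.range' 1 m).map fun g => some (X i g)) ++ [none]).flatten =
      (l.flatMap fun i => none :: (List.range' 1 m).map fun g => some (X i g)) ++ [none] := by
    intro l
    induction l with
    | nil => rfl
    | cons i l ih => simp [← ih]
  rw [← h₃, FairDivision.encodeMatrix]
  simp only [h₂]
  rw [h₁ n fun i => (List.range' 1 m).map (fun g => some (X i g)) ++ [none]]

theorem rowSyms_eq_cons (bit : Fld → ℕ → ℕ → Bool) (m i : ℕ) :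
    rowSyms bit i 0 (m + 1) = sym bit i 0 :: (List.range' 1 m).map (sym bit i) := by
  rw [rowSyms_cons _ (Nat.succ_pos m), rowSyms]
  simp

theorem map_outSym_tape (n m : ℕ) (bit : Fld → ℕ → ℕ → Bool) :
    (tape n m bit).map outSym =
      none :: FairDivision.encodeMatrix (fun (i : Fin n) (g : Fin m) => bit .own i (g + 1)) := by
  rw [cons_encodeMatrix (bit .own), tape, rowsSyms, List.map_append, List.map_flatMap]
  congr 1
  refine List.flatMap_congr fun i _ => ?_
  rw [rowSyms_eq_cons, List.map_cons, List.map_map]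
  congr 1
  refine List.map_congr_left fun g hg => ?_
  rw [List.mem_range'_1] at hg
  simp [sym, outSym, show g ≠ 0 by omega]

/-- The header column must be zero because end-of-row symbols are read as symbols with all fields
`false`. -/
theorem cons_map_inSym (n m : ℕ) (X : ℕ → ℕ → Bool) (hX : ∀ i, X i 0 = false) :
    sentinel :: (FairDivision.encodeMatrix (fun (i : Fin n) (g : Fin m) => X i (g + 1))).map inSym =
      tape n m (Mem.ofMatrix X).bit := by
  rw [show sentinel = inSym none from rfl, ← List.map_cons, cons_encodeMatrix X, tape, rowsSyms,
    List.map_append, List.map_flatMap]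
  congr 1
  refine List.flatMap_congr fun i _ => ?_
  rw [rowSyms_eq_cons, List.map_cons, List.map_map]
  congr 1
  · simp [sym, inSym, sentinel, Mem.ofMatrix, hX]
  · refine List.map_congr_left fun g hg => ?_
    rw [List.mem_range'_1] at hg
    simp [sym, inSym, Mem.ofMatrix, show g ≠ 0 by omega]

theorem count_encodeMatrix {n m : ℕ} (x : Fin n → Fin m → Bool) :
    (FairDivision.encodeMatrix x).count none = n := by
  have : ∀ i, (((List.ofFn fun g => some (x i g)) ++ [none]).count none) = 1 := by
    intro i
    rw [List.count_append, List.count_eq_zero.2 (by simp [List.mem_ofFn])]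
    simp
  rw [FairDivision.encodeMatrix, List.count_flatten, List.map_ofFn]
  simp [comp_def, this]

theorem colCount_encodeMatrix {n m : ℕ} (hn : 0 < n) (x : Fin n → Fin m → Bool) :
    colCount (FairDivision.encodeMatrix x) = m + 1 := by
  have h : ∀ (l : List Bool) (r), colCount (l.map some ++ none :: r) = l.length + 1 := by
    intro l r
    induction l with
    | nil => rfl
    | cons b l ih => simp [colCount, ih]
  obtain ⟨n, rfl⟩ := Nat.exists_eq_succ_of_ne_zero hn.ne'
  rw [FairDivision.encodeMatrix, List.ofFn_succ, List.flatten_cons, List.append_assoc]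
  have := h (List.ofFn (x 0))
  rw [List.map_ofFn, List.length_ofFn] at this
  exact this _

theorem length_encodeMatrix {n m : ℕ} (x : Fin n → Fin m → Bool) :
    (FairDivision.encodeMatrix x).length = n * (m + 1) := by
  simp [FairDivision.encodeMatrix, List.length_flatten, List.map_ofFn, comp_def]

/-- The counter has to end at `0` because only the output stack may be nonempty at the end. The
polynomial adds the `20 L + 7` steps of reading and the `22 L + 22` steps of writing to the time of
the program. -/
theorem Prog.exec_main {n m : ℕ} (hn : 0 < n) (p : Prog) (hp : p.WF ∅) (X : ℕ → ℕ → Bool)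
    (hX : ∀ i, X i 0 = false)
    (hctr : (p.denote n m (fun _ => 0) (Mem.ofMatrix X)).ctr = 0) :
    Exec (.seq readInput (.seq p.code writeOutput)) (reg false false)
      (ioStore (FairDivision.encodeMatrix fun (i : Fin n) (g : Fin m) => X i (g + 1)) [])
      (reg false false)
      (ioStore [] (FairDivision.encodeMatrix fun (i : Fin n) (g : Fin m) =>
        (p.denote n m (fun _ => 0) (Mem.ofMatrix X)).bit .own i (g + 1)))
      ((p.time + 42 * .X + 29).eval (n * (m + 1))) := by
  have hdim : ∀ x, 0 < dim n m x := by
    intro x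
    cases x
    · exact hn
    · exact Nat.succ_pos m
  have hdimL : ∀ x, dim n m x ≤ n * (m + 1) := by
    intro x
    cases x
    · exact Nat.le_mul_of_pos_right _ (Nat.succ_pos m)
    · exact Nat.le_mul_of_pos_left _ hn
  have e₁ := exec_readInput (FairDivision.encodeMatrix fun (i : Fin n) (g : Fin m) => X i (g + 1))
  have e₂ := p.exec_code (m := m) hn hp hdim (fun _ _ => rfl) (Mem.ofMatrix X)
  set ν := p.denote n m (fun _ => 0) (Mem.ofMatrix X)
  have hout := map_outSym_tape n m ν.bit
  obtain ⟨a, r, har⟩ : ∃ a r, tape n m ν.bit = a :: r :=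
    List.exists_cons_of_ne_nil (by rw [tape_eq (y := 0) ν.bit m hn (Nat.zero_le m)]; simp)
  have hlen := congrArg List.length hout
  rw [har, List.length_map, List.length_cons, List.length_cons, length_encodeMatrix] at hlen
  have e₃ := exec_writeOutput (L := n * (m + 1)) (conf n m (fun _ => 0) ν) a r har (by omega)
    (fun x => hdimL x) (by simp [conf, ioStore, hctr])
  rw [har, List.map_cons] at hout
  rw [(List.cons.inj hout).2] at e₃
  refine Exec.congr (Runs.seq (Exec.congr e₁ rfl ?_ le_rfl) (Runs.seq e₂ e₃)) rfl rfl ?_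
  · rw [cons_map_inSym n m X hX, count_encodeMatrix, colCount_encodeMatrix hn]
    refine congrArg (Store.mk [] [] [] (tape n m (Mem.ofMatrix X).bit) 0 0 fun _ => 0)
      (funext fun x => ?_)
    cases x <;> rfl
  · rw [length_encodeMatrix]
    simp
    omega

theorem stk_ioStore_inp (l : List (Option Bool)) :
    (ioStore l []).stk = update (β := fun k => List (Alph k)) (fun _ => []) Stk.inp l := by
  funext k
  cases k <;> rfl

theorem stk_ioStore_out (l : List (Option Bool)) :
    (ioStore [] l).stk = update (β := fun k => List (Alph k)) (fun _ => []) Stk.out l := by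
  funext k
  cases k <;> rfl

/-- A program that operates on matrices yields a Turing machine that runs in polynomial time. -/
theorem Prog.computableInPolyTime (p : Prog) (hp : p.WF ∅) {ι : Type} (n m : ι → ℕ)
    (hn : ∀ I, 0 < n I) (X : ι → ℕ → ℕ → Bool) (hX : ∀ I i, X I i 0 = false)
    (hctr : ∀ I, (p.denote (n I) (m I) (fun _ => 0) (Mem.ofMatrix (X I))).ctr = 0) :
    Nonempty (TM2ComputableInPolyTime
      (fun I => FairDivision.encodeMatrix fun (i : Fin (n I)) (g : Fin (m I)) => X I i (g + 1))
      (id : List (Option Bool) → List (Option Bool))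
      (fun I => FairDivision.encodeMatrix fun (i : Fin (n I)) (g : Fin (m I)) =>
        (p.denote (n I) (m I) (fun _ => 0) (Mem.ofMatrix (X I))).bit .own i (g + 1))) := by
  let _ : Fintype (Alph .inp) := inferInstanceAs (Fintype (Option Bool))
  refine ⟨{
    tm := Cmd.machine (.seq readInput (.seq p.code writeOutput)) .inp .out (reg false false)
    inputAlphabet := Equiv.refl _
    outputAlphabet := Equiv.refl _
    -- The last `1` pays for the halting step.
    time := p.time + 42 * .X + 29 + 1
    outputsFun := fun I => Classical.choice ?_ }⟩
  have h := p.exec_main (m := m I) (hn I) hp (X I) (hX I) (hctr I)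
  rw [Exec, stk_ioStore_inp, stk_ioStore_out] at h
  refine cast (congrArg Nonempty ?_) h.outputsInTime
  refine congr (congr (congrArg (TM2OutputsInTime _) (List.map_id _).symm)
    (congrArg some (List.map_id _).symm)) ?_
  simp [length_encodeMatrix]

end MatrixProgram

open scoped NNReal

/-! ### Truncated sums control concave functions and the Nash product -/

namespace FairDivision

/-- The increment representation of a function on `ℕ` in terms of truncations. -/
theorem apply_min_eq_sum (f : ℕ → ℝ) (h0 : f 0 = 0) (T x : ℕ) :
    f (min x (T + 1)) = ∑ t ∈ Finset.range T, (2 * f (t + 1) - f t - f (t + 2)) *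
      (min x (t + 1) : ℕ) + (f (T + 1) - f T) * (min x (T + 1) : ℕ) := by
  induction T with
  | zero =>
    rcases Nat.eq_zero_or_pos x with rfl | hx
    · simp [h0]
    · simp [h0, Nat.min_eq_right hx]
  | succ T ih =>
    rw [Finset.sum_range_succ]
    rcases Nat.lt_or_ge (T + 1) x with h | h
    · rw [Nat.min_eq_right h.le] at ih ⊢
      rw [Nat.min_eq_right (show T + 1 + 1 ≤ x from h)]
      push_cast at ih ⊢
      linarith
    · rw [Nat.min_eq_left h] at ih ⊢
      rw [Nat.min_eq_left (h.trans (Nat.le_succ _)), ih]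
      ring

/-- Domination of all truncated sums implies domination for monotone concave functions. -/
theorem sum_le_sum_of_min_le {N : Type} [Fintype N] (f : ℕ → ℝ) (h0 : f 0 = 0) (hf : Monotone f)
    (hcc : ∀ t, f t + f (t + 2) ≤ 2 * f (t + 1)) (b c : N → ℕ)
    (h : ∀ t, ∑ i, min (c i) t ≤ ∑ i, min (b i) t) : ∑ i, f (c i) ≤ ∑ i, f (b i) := by
  -- `T` bounds all entries, so truncating at `T + 1` changes nothing.
  set T := ∑ i, (b i + c i)
  have hT : ∀ i, b i ≤ T + 1 ∧ c i ≤ T + 1 := by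
    intro i
    have := Finset.single_le_sum (f := fun i => b i + c i) (fun _ _ => Nat.zero_le _)
      (Finset.mem_univ i)
    omega
  have key : ∀ a : N → ℕ, (∀ i, a i ≤ T + 1) → ∑ i, f (a i) =
      ∑ t ∈ Finset.range T, (2 * f (t + 1) - f t - f (t + 2)) *
        ((∑ i, min (a i) (t + 1) : ℕ) : ℝ) +
        (f (T + 1) - f T) * ((∑ i, min (a i) (T + 1) : ℕ) : ℝ) := by
    intro a ha
    have : ∀ i, f (a i) = f (min (a i) (T + 1)) := fun i => by rw [Nat.min_eq_left (ha i)]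
    simp only [this, apply_min_eq_sum f h0 T]
    rw [Finset.sum_add_distrib, Finset.sum_comm]
    congr 1
    · refine Finset.sum_congr rfl fun t _ => ?_
      rw [Nat.cast_sum, Finset.mul_sum]
    · rw [Nat.cast_sum, Finset.mul_sum]
  rw [key b fun i => (hT i).1, key c fun i => (hT i).2]
  -- The coefficients are nonnegative: negated second differences by concavity, and the last
  -- increment by monotonicity.
  refine add_le_add (Finset.sum_le_sum fun t _ => ?_) ?_
  · exact mul_le_mul_of_nonneg_left (Nat.cast_le.2 (h _)) (by linarith [hcc t])
  · exact mul_le_mul_of_nonneg_left (Nat.cast_le.2 (h _))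
      (sub_nonneg.2 (hf (Nat.le_succ T)))

/-- If the truncated sums are dominated and equally many entries are positive, then the product
of the positive entries is dominated. -/
theorem prod_pos_le_of_min_le {N : Type} [Fintype N] [DecidableEq N] (b c : N → ℕ)
    (h : ∀ t, ∑ i, min (c i) t ≤ ∑ i, min (b i) t)
    (h1 : ∑ i, min (c i) 1 = ∑ i, min (b i) 1) :
    ∏ i with 0 < c i, c i ≤ ∏ i with 0 < b i, b i := by
  -- With `Real.log 0 = 0`, the logarithm increases by `0` from `0` to `1` and by `log 2` from `1`
  -- to `2`, which violates concavity. Adding `log 2` on the positive numbers makes both increments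
  -- equal; the correction cancels by `h1`, as both sides have equally many positive entries.
  let f : ℕ → ℝ := fun x => Real.log x + Real.log 2 * (min x 1 : ℕ)
  have hf2 : 0 ≤ Real.log 2 := Real.log_nonneg (by norm_num)
  have hf : ∀ x, f (x + 1) = Real.log (x + 1) + Real.log 2 := by
    intro x
    simp [f]
  have f0 : f 0 = 0 := by simp [f]
  have hmono : Monotone f := by
    refine monotone_nat_of_le_succ fun x => ?_
    rcases x with _ | x
    · rw [f0, hf]
      simpa using hf2
    · rw [hf, hf]
      gcongr
      linarith
  have hcc : ∀ t, f t + f (t + 2) ≤ 2 * f (t + 1) := by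
    intro t
    rcases t with _ | t
    · rw [f0, hf, hf]
      norm_num
      linarith
    · rw [hf, hf, hf]
      have ht : (0 : ℝ) ≤ t := Nat.cast_nonneg t
      have : Real.log ((t : ℝ) + 1) + Real.log ((t : ℝ) + 3) ≤ 2 * Real.log ((t : ℝ) + 2) := by
        rw [← Real.log_mul (by positivity) (by positivity), two_mul,
          ← Real.log_mul (by positivity) (by positivity)]
        exact Real.log_le_log (by positivity) (by nlinarith)
      push_cast
      rw [show (t : ℝ) + 2 + 1 = t + 3 by ring, show (t : ℝ) + 1 + 1 = t + 2 by ring]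
      linarith
  have key := sum_le_sum_of_min_le f f0 hmono hcc b c h
  have hsum : ∀ a : N → ℕ, ∑ i, f (a i) = Real.log ((∏ i with 0 < a i, a i : ℕ) : ℝ) +
      Real.log 2 * ((∑ i, min (a i) 1 : ℕ) : ℝ) := by
    intro a
    rw [Finset.sum_add_distrib, ← Finset.mul_sum, ← Nat.cast_sum, Nat.cast_prod, Real.log_prod,
      Finset.sum_filter]
    · congr 1
      refine Finset.sum_congr rfl fun i _ => ?_
      split_ifs with hi
      · rfl
      · simp [Nat.eq_zero_of_not_pos hi]
    · intro i hi
      exact Nat.cast_ne_zero.2 (Finset.mem_filter.1 hi).2.ne'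
  have hpos : ∀ a : N → ℕ, (0 : ℝ) < ((∏ i with 0 < a i, a i : ℕ) : ℝ) := fun a =>
    Nat.cast_pos.2 (Finset.prod_pos fun i hi => (Finset.mem_filter.1 hi).2)
  rw [hsum, hsum, h1, add_le_add_iff_right, Real.log_le_log_iff (hpos c) (hpos b)] at key
  exact_mod_cast key

variable {N M : Type}

theorem value_eq_card {v : N → M → ℝ≥0} (hv : ∀ i g, v i g = 0 ∨ v i g = 1) (i : N)
    (S : Finset M) : value v i S = ({g ∈ S | v i g = 1} : Finset M).card := by
  rw [value, Finset.card_filter, Nat.cast_sum]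
  refine Finset.sum_congr rfl fun g _ => ?_
  rcases hv i g with h | h <;> simp [h]

/-- This makes the first criterion of maximum Nash welfare the truncated sum at `1`. -/
theorem card_positiveAgents_eq [Fintype N] {v : N → M → ℝ≥0} {a : N → ℕ} {C : N → Finset M}
    (ha : ∀ i, value v i (C i) = a i) : (positiveAgents v C).card = ∑ i, min (a i) 1 := by
  rw [positiveAgents, Finset.card_filter]
  refine Finset.sum_congr rfl fun i _ => ?_
  rw [ha]
  split_ifs with h
  · exact (min_eq_right (Nat.cast_pos.1 h)).symm
  · simp only [Nat.cast_pos, not_lt, Nat.le_zero] at h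
    simp [h]

theorem positiveProduct_eq [Fintype N] {v : N → M → ℝ≥0} {a : N → ℕ} {C : N → Finset M}
    (ha : ∀ i, value v i (C i) = a i) : positiveProduct v C = (∏ i with 0 < a i, a i : ℕ) := by
  rw [positiveProduct, positiveAgents, Nat.cast_prod]
  simp only [ha, Nat.cast_pos]

/-! ### Balanced allocations maximize Nash welfare and are envy-free up to any good -/

variable [Fintype N] [DecidableEq N] [Fintype M] [DecidableEq M]

/-- An allocation in which every agent values its goods and every target of an envy-reducing chain
of transfers has almost the value of its possible sources. -/
structure IsBalanced (v : N → M → ℝ≥0) (B : N → Finset M) : Prop where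
  alloc : IsAllocationOf (positiveGoods v) B
  valued : ∀ i, ∀ g ∈ B i, v i g = 1
  chain : ∀ t, ∃ R : Finset N, t ∈ R ∧ (∀ i k g, k ∈ R → v k g = 1 → g ∈ B i → i ∈ R) ∧
    ∀ s ∈ R, (B s).card ≤ (B t).card + 1

variable {v : N → M → ℝ≥0} {B : N → Finset M}

theorem IsBalanced.value_eq (h : IsBalanced v B) (hv : ∀ i g, v i g = 0 ∨ v i g = 1) (i : N) :
    value v i (B i) = (B i).card := by
  rw [value_eq_card hv, Finset.filter_true_of_mem (h.valued i)]

/-- Inside `L` the truncation at `t` does not bite for `B`, and closure of `L` gives its members all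
the goods that they value, so their total cannot be exceeded. Outside `L` every agent has the
maximal truncated value `t` under `B`. -/
theorem IsBalanced.sum_min_le (h : IsBalanced v B) {C : N → Finset M}
    (hC : IsAllocationOf (positiveGoods v) C) (t : ℕ) :
    ∑ i, min ({g ∈ C i | v i g = 1} : Finset M).card t ≤ ∑ i, min (B i).card t := by
  choose R hR hcl hle using h.chain
  -- The agents below the threshold and all those from whom chains lead to them. A member of `L` has
  -- at most one good more than some agent with fewer than `t` goods.
  let L : Finset N := Finset.univ.filter (fun i => (B i).card < t) |>.biUnion R
  have hL : ∀ i ∈ L, (B i).card ≤ t := by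
    intro i hi
    obtain ⟨s, hs, hi⟩ := Finset.mem_biUnion.1 hi
    have := hle s i hi
    have := (Finset.mem_filter.1 hs).2
    omega
  have hL' : ∀ i ∉ L, t ≤ (B i).card := by
    intro i hi
    by_contra hlt
    exact hi (Finset.mem_biUnion.2
      ⟨i, Finset.mem_filter.2 ⟨Finset.mem_univ i, not_le.1 hlt⟩, hR i⟩)
  have hsum : ∑ i ∈ L, ({g ∈ C i | v i g = 1} : Finset M).card ≤ ∑ i ∈ L, (B i).card := by
    rw [← Finset.card_biUnion fun i _ j _ hij => Finset.disjoint_filter_filter (hC.1 i j hij),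
      ← Finset.card_biUnion fun i _ j _ hij => h.alloc.1 i j hij]
    refine Finset.card_le_card fun g hg => ?_
    obtain ⟨k, hk, hg⟩ := Finset.mem_biUnion.1 hg
    obtain ⟨hgC, hkg⟩ := Finset.mem_filter.1 hg
    have hg : g ∈ positiveGoods v :=
      hC.2 ▸ Finset.mem_biUnion.2 ⟨k, Finset.mem_univ k, hgC⟩
    rw [← h.alloc.2] at hg
    obtain ⟨i, -, hi⟩ := Finset.mem_biUnion.1 hg
    obtain ⟨s, hs, hks⟩ := Finset.mem_biUnion.1 hk
    exact Finset.mem_biUnion.2 ⟨i, Finset.mem_biUnion.2 ⟨s, hs, hcl s i k g hks hkg hi⟩, hi⟩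
  rw [← Finset.sum_add_sum_compl L, ← Finset.sum_add_sum_compl L]
  refine add_le_add ?_ (Finset.sum_le_sum fun i hi => ?_)
  · calc _ ≤ ∑ i ∈ L, ({g ∈ C i | v i g = 1} : Finset M).card :=
        Finset.sum_le_sum fun i _ => min_le_left _ _
      _ ≤ ∑ i ∈ L, (B i).card := hsum
      _ = _ := Finset.sum_congr rfl fun i hi => (min_eq_left (hL i hi)).symm
  · rw [min_eq_right (hL' i (Finset.mem_compl.1 hi))]
    exact min_le_right _ _

theorem IsBalanced.isMNWOn (h : IsBalanced v B) (hv : ∀ i g, v i g = 0 ∨ v i g = 1) :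
    IsMNWOn v (positiveGoods v) B := by
  refine ⟨h.alloc, fun C hC => ?_⟩
  have hc := fun i => value_eq_card hv i (C i)
  rw [card_positiveAgents_eq hc, card_positiveAgents_eq (h.value_eq hv), positiveProduct_eq hc,
    positiveProduct_eq (h.value_eq hv)]
  refine ⟨h.sum_min_le hC 1, fun h1 => ?_⟩
  exact_mod_cast prod_pos_le_of_min_le _ _ (h.sum_min_le hC) h1

/-- The recipient `l` of the zero goods envies nobody more than before, and nobody envies `l`: the
added goods are worthless and `l` owns the fewest goods of `B`. All other pairs are handled by the
chain condition. -/
theorem IsBalanced.spec (h : IsBalanced v B) (hv : ∀ i g, v i g = 0 ∨ v i g = 1) {l : N}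
    (hl : ∀ j, (B l).card ≤ (B j).card) :
    IsAllocation (Function.update B l (B l ∪ zeroGoods v)) ∧
      IsMNW v (Function.update B l (B l ∪ zeroGoods v)) ∧
      IsEFX0 v (Function.update B l (B l ∪ zeroGoods v)) := by
  have hdisj : ∀ i, Disjoint (B i) (zeroGoods v) := by
    intro i
    rw [Finset.disjoint_left]
    intro g hg hz
    have h0 := (Finset.mem_filter.1 hz).2 i
    rw [h.valued i g hg] at h0
    exact one_ne_zero h0
  refine ⟨⟨?_, ?_⟩, ⟨B, h.isMNWOn hv, l, fun j => ?_, rfl⟩, ?_⟩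
  · intro i j hij
    by_cases hi : i = l
    · subst hi
      rw [Function.update_self, Function.update_of_ne hij.symm, Finset.disjoint_union_left]
      exact ⟨h.alloc.1 i j hij, (hdisj j).symm⟩
    · rw [Function.update_of_ne hi]
      by_cases hj : j = l
      · subst hj
        rw [Function.update_self, Finset.disjoint_union_right]
        exact ⟨h.alloc.1 i j hij, hdisj i⟩
      · rw [Function.update_of_ne hj]
        exact h.alloc.1 i j hij
  · refine Finset.eq_univ_of_forall fun g => ?_
    by_cases hg : g ∈ positiveGoods v
    · rw [← h.alloc.2] at hg
      obtain ⟨i, -, hi⟩ := Finset.mem_biUnion.1 hg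
      refine Finset.mem_biUnion.2 ⟨i, Finset.mem_univ i, ?_⟩
      by_cases hil : i = l
      · subst hil
        rw [Function.update_self]
        exact Finset.mem_union_left _ hi
      · rwa [Function.update_of_ne hil]
    · refine Finset.mem_biUnion.2 ⟨l, Finset.mem_univ l, ?_⟩
      rw [Function.update_self]
      refine Finset.mem_union_right _ (Finset.mem_filter.2 ⟨Finset.mem_univ g, fun i => ?_⟩)
      by_contra hi
      exact hg (Finset.mem_filter.2 ⟨Finset.mem_univ g, i, pos_iff_ne_zero.2 hi⟩)
  · rw [h.value_eq hv, h.value_eq hv]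
    exact_mod_cast hl j
  · intro j i g hg
    have hj : ((B j).card : ℝ≥0) ≤
        value v j (Function.update B l (B l ∪ zeroGoods v) j) := by
      rw [← h.value_eq hv]
      refine Finset.sum_le_sum_of_subset ?_
      by_cases hjl : j = l
      · subst hjl
        rw [Function.update_self]
        exact Finset.subset_union_left
      · rw [Function.update_of_ne hjl]
    refine le_trans ?_ hj
    rw [value_eq_card hv, Nat.cast_le]
    by_cases hi : i = l
    · subst hi
      refine le_trans (Finset.card_le_card fun g' hg' => ?_) (hl j)
      rw [Function.update_self, Finset.mem_filter, Finset.mem_sdiff, Finset.mem_union] at hg'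
      obtain ⟨⟨hB | hz, -⟩, hv'⟩ := hg'
      · exact hB
      · rw [(Finset.mem_filter.1 hz).2 j] at hv'
        exact absurd hv' zero_ne_one
    · rw [Function.update_of_ne hi] at hg ⊢
      -- If `j` values any remaining good of `i`, then `i` lies in the closed set of `j`, so `B i`
      -- has at most one good more than `B j`, and removing `g` cancels that one.
      rcases Finset.eq_empty_or_nonempty ({g' ∈ B i \ {g} | v j g' = 1} : Finset M)
        with he | ⟨g', hg'⟩
      · rw [he]
        exact Nat.zero_le _
      · obtain ⟨hg', hv'⟩ := Finset.mem_filter.1 hg'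
        obtain ⟨R, hR, hcl, hle⟩ := h.chain j
        have := hle i (hcl i j g' hR hv' (Finset.mem_sdiff.1 hg').1)
        have h1 := Finset.card_filter_le (B i \ {g}) fun g' => v j g' = 1
        rw [Finset.card_sdiff_of_subset (Finset.singleton_subset_iff.2 hg),
          Finset.card_singleton] at h1
        omega

end FairDivision

/-! ### Reasoning about matrix programs, and basic subroutines -/

namespace MatrixProgram

open Function

variable {n m : ℕ}

/-- All loop variables have values in their range, and the header variable points to the header
column. -/
structure Env (n m : ℕ) (ρ : Var → ℕ) : Prop where
  lt : ∀ x, ρ x < dim n m x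
  header : ρ (.inr .header) = 0

theorem Env.update {ρ : Var → ℕ} (h : Env n m ρ) {x : Var} (hx : x ≠ .inr .header) {j : ℕ}
    (hj : j < dim n m x) : Env n m (update ρ x j) where
  lt x' := by
    by_cases hx' : x' = x
    · subst hx'
      simpa using hj
    · simpa [hx'] using h.lt x'
  header := by rw [update_of_ne hx.symm, h.header]

/-- The program does not loop over the header variable. -/
def Prog.NoHeader : Prog → Prop
  | .seq p q => p.NoHeader ∧ q.NoHeader
  | .test _ _ _ p q => p.NoHeader ∧ q.NoHeader
  | .for_ x p => x ≠ .inr .header ∧ p.NoHeader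
  | .pos p q => p.NoHeader ∧ q.NoHeader
  | _ => True

/-- The program does not write to the field `f`. -/
def Prog.Keeps (f : Fld) : Prog → Prop
  | .seq p q => p.Keeps f ∧ q.Keeps f
  | .set _ _ f' _ => f ≠ f'
  | .test _ _ _ p q => p.Keeps f ∧ q.Keeps f
  | .for_ _ p => p.Keeps f
  | .pos p q => p.Keeps f ∧ q.Keeps f
  | _ => True

/-- The program does not change the counter. -/
def Prog.KeepsCtr : Prog → Prop
  | .seq p q => p.KeepsCtr ∧ q.KeepsCtr
  | .test _ _ _ p q => p.KeepsCtr ∧ q.KeepsCtr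
  | .for_ _ p => p.KeepsCtr
  | .pos p q => p.KeepsCtr ∧ q.KeepsCtr
  | .inc => False
  | .dec => False
  | _ => True

/-- Invariants of loops. -/
theorem Prog.for_inv {x : Var} {p : Prog} {ρ : Var → ℕ} {μ : Mem} (P : ℕ → Mem → Prop)
    (h0 : P 0 μ) (hs : ∀ j < dim n m x, ∀ ν, P j ν → P (j + 1) (p.denote n m (update ρ x j) ν)) :
    P (dim n m x) ((for_ x p).denote n m ρ μ) := by
  rw [denote]
  suffices ∀ k ≤ dim n m x,
      P k ((List.range k).foldl (fun μ j => p.denote n m (update ρ x j) μ) μ) from this _ le_rfl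
  intro k
  induction k with
  | zero => exact fun _ => h0
  | succ k ih =>
    intro hk
    rw [List.range_succ, List.foldl_append, List.foldl_cons, List.foldl_nil]
    exact hs k hk _ (ih (Nat.le_of_succ_le hk))

/-- A property that is preserved by all iterations and established by one of them. -/
theorem Prog.for_hit {x : Var} {p : Prog} {ρ : Var → ℕ} {μ : Mem} (P Q : Mem → Prop) (k : ℕ)
    (hk : k < dim n m x) (h0 : P μ)
    (hP : ∀ j < dim n m x, ∀ ν, P ν → P (p.denote n m (update ρ x j) ν))
    (hQ : ∀ j < dim n m x, ∀ ν, Q ν → Q (p.denote n m (update ρ x j) ν))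
    (hk' : ∀ ν, P ν → Q (p.denote n m (update ρ x k) ν)) :
    Q ((for_ x p).denote n m ρ μ) := by
  refine (for_inv (n := n) (m := m) (x := x) (p := p) (ρ := ρ) (μ := μ)
    (fun j ν => P ν ∧ (k < j → Q ν)) ⟨h0, fun h => absurd h (Nat.not_lt_zero k)⟩
    fun j hj ν ⟨h₁, h₂⟩ => ⟨hP j hj ν h₁, fun h => ?_⟩).2 hk
  rcases Nat.lt_succ_iff_lt_or_eq.1 h with h | rfl
  · exact hQ j hj ν (h₂ h)
  · exact hk' ν h₁

theorem Prog.denote_bit_of_keeps {f : Fld} (p : Prog) (hp : p.Keeps f) (ρ : Var → ℕ) (μ : Mem) :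
    (p.denote n m ρ μ).bit f = μ.bit f := by
  induction p generalizing ρ μ with
  | seq p q ihp ihq => rw [denote, ihq hp.2, ihp hp.1]
  | set x y f' b =>
    funext i g
    simp [denote, Mem.set, show f ≠ f' from hp]
  | test x y f' p q ihp ihq =>
    rw [denote]
    split_ifs
    exacts [ihp hp.1 _ _, ihq hp.2 _ _]
  | for_ x p ih =>
    exact for_inv (n := n) (m := m) (fun _ ν => ν.bit f = μ.bit f) rfl
      fun j _ ν h => (ih hp _ _).trans h
  | pos p q ihp ihq =>
    rw [denote]
    split_ifs
    exacts [ihp hp.1 _ _, ihq hp.2 _ _]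
  | _ => rfl

theorem Prog.denote_ctr_of_keepsCtr (p : Prog) (hp : p.KeepsCtr) (ρ : Var → ℕ) (μ : Mem) :
    (p.denote n m ρ μ).ctr = μ.ctr := by
  induction p generalizing ρ μ with
  | seq p q ihp ihq => rw [denote, ihq hp.2, ihp hp.1]
  | test x y f' p q ihp ihq =>
    rw [denote]
    split_ifs
    exacts [ihp hp.1 _ _, ihq hp.2 _ _]
  | for_ x p ih =>
    exact for_inv (n := n) (m := m) (fun _ ν => ν.ctr = μ.ctr) rfl
      fun j _ ν h => (ih hp _ _).trans h
  | pos p q ihp ihq =>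
    rw [denote]
    split_ifs
    exacts [ihp hp.1 _ _, ihq hp.2 _ _]
  | inc => exact hp.elim
  | dec => exact hp.elim
  | _ => rfl

/-- All bits outside of the matrix are `false`. -/
def Mem.Bounded (n m : ℕ) (μ : Mem) : Prop := ∀ f i g, n ≤ i ∨ m < g → μ.bit f i g = false

theorem Prog.bounded_denote (p : Prog) (hp : p.NoHeader) {ρ : Var → ℕ} (hρ : Env n m ρ) {μ : Mem}
    (hμ : μ.Bounded n m) : (p.denote n m ρ μ).Bounded n m := by
  induction p generalizing ρ μ with
  | seq p q ihp ihq => exact ihq hp.2 hρ (ihp hp.1 hρ hμ)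
  | set x y f' b =>
    intro f i g h
    simp only [denote, Mem.set]
    rw [if_neg, hμ f i g h]
    rintro ⟨-, rfl, rfl⟩
    have h₁ := hρ.lt (.inl x)
    have h₂ := hρ.lt (.inr y)
    simp only [dim] at h₁ h₂
    omega
  | test x y f' p q ihp ihq =>
    rw [denote]
    split_ifs
    exacts [ihp hp.1 hρ hμ, ihq hp.2 hρ hμ]
  | for_ x p ih =>
    exact for_inv (n := n) (m := m) (fun _ ν => ν.Bounded n m) hμ
      fun j hj ν h => ih hp.2 (hρ.update hp.1 hj) h
  | pos p q ihp ihq =>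
    rw [denote]
    split_ifs
    exacts [ihp hp.1 hρ hμ, ihq hp.2 hρ hμ]
  | _ => exact hμ

theorem Mem.bit_set (μ : Mem) (f : Fld) (i g : ℕ) (b : Bool) (f' : Fld) (i' g' : ℕ) :
    (μ.set f i g b).bit f' i' g' = if f' = f ∧ i' = i ∧ g' = g then b else μ.bit f' i' g' :=
  rfl

theorem Mem.set_set (μ : Mem) (f : Fld) (i g : ℕ) (b b' : Bool) :
    (μ.set f i g b).set f i g b' = μ.set f i g b' := by
  ext
  · simp only [bit_set]
    split_ifs <;> rfl
  · rfl

/-- Sets a field to `false` in a column. -/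
def clearCol (y : CVar) (f : Fld) : Prog := .for_ (.inl .dest) (.set .dest y f false)

theorem bit_clearCol (y : CVar) (f : Fld) (ρ : Var → ℕ) (μ : Mem) (f' : Fld) (i g : ℕ) :
    ((clearCol y f).denote n m ρ μ).bit f' i g =
      if f' = f ∧ i < n ∧ g = ρ (.inr y) then false else μ.bit f' i g := by
  refine Prog.for_inv (n := n) (m := m) (x := .inl .dest) (fun j ν => ν.bit f' i g =
    if f' = f ∧ i < j ∧ g = ρ (.inr y) then false else μ.bit f' i g) (by simp) ?_
  intro j hj ν h
  simp only [Prog.denote, Mem.bit_set, h, update_self, ne_eq, reduceCtorEq, not_false_eq_true,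
    update_of_ne]
  split_ifs <;> first | rfl | grind

/-- Sets a field to `false` everywhere. -/
def clearFld (f : Fld) : Prog :=
  .for_ (.inr .good) (clearCol .good f)

theorem bit_clearFld (f : Fld) (ρ : Var → ℕ) {μ : Mem} (hμ : μ.Bounded n m) (i g : ℕ) :
    ((clearFld f).denote n m ρ μ).bit f i g = false := by
  have : ((clearFld f).denote n m ρ μ).bit f i g =
      if i < n ∧ g < m + 1 then false else μ.bit f i g := by
    refine Prog.for_inv (n := n) (m := m) (x := .inr .good) (fun j ν => ν.bit f i g =
      if i < n ∧ g < j then false else μ.bit f i g) (by simp) ?_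
    intro j hj ν h
    rw [bit_clearCol, h, update_self]
    split_ifs <;> first | rfl | (exfalso; omega) | grind
  rw [this]
  split_ifs with h
  · rfl
  · exact hμ f i g (by omega)

/-- Selects a row with the field `g` in a column, and marks it by the field `f`. -/
def pick (y : CVar) (g f : Fld) : Prog :=
  .for_ (.inl .source) (.test .source y g (.seq (clearCol y f) (.set .source y f true)) .skip)

/-- Every hit wipes the column before marking its own row, so exactly the last hit stays marked.
Without a hit nothing is written. -/
theorem pick_spec (y : CVar) {g f : Fld} (hgf : g ≠ f) (ρ : Var → ℕ) (μ : Mem) :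
    (∀ i < n, μ.bit g i (ρ (.inr y)) = false) ∧ (pick y g f).denote n m ρ μ = μ ∨
    ∃ l < n, μ.bit g l (ρ (.inr y)) = true ∧
      (∀ i < n, ((pick y g f).denote n m ρ μ).bit f i (ρ (.inr y)) = decide (i = l)) ∧
      ∀ i c, c ≠ ρ (.inr y) → ((pick y g f).denote n m ρ μ).bit f i c = μ.bit f i c := by
  set Y := ρ (.inr y)
  refine (Prog.for_inv (n := n) (m := m) (x := .inl .source) (fun j ν => ν.bit g = μ.bit g ∧
    ((∀ i < j, μ.bit g i Y = false) ∧ ν = μ ∨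
    ∃ l < j, μ.bit g l Y = true ∧ (∀ i < n, ν.bit f i Y = decide (i = l)) ∧
      ∀ i c, c ≠ Y → ν.bit f i c = μ.bit f i c)) ?_ ?_).2
  · exact ⟨rfl, .inl ⟨by simp, rfl⟩⟩
  · intro j hj ν ⟨h₁, h₂⟩
    simp only [Prog.denote, update_self, ne_eq, reduceCtorEq, not_false_eq_true, update_of_ne]
    change j < n at hj
    change _ ∧ (_ ∨ _)
    rw [show ρ (.inr y) = Y from rfl, h₁]
    split_ifs with hg
    · refine ⟨?_, .inr ⟨j, Nat.lt_succ_self j, hg, fun i hi => ?_, fun i c hc => ?_⟩⟩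
      · funext i c
        rw [Mem.bit_set, if_neg (fun h => hgf h.1), bit_clearCol, if_neg (fun h => hgf h.1), h₁]
      · rw [Mem.bit_set, bit_clearCol, update_of_ne (by simp)]
        by_cases hij : i = j
        · simp [hij]
        · simp [hij, hi, Y]
      · rw [Mem.bit_set, bit_clearCol, update_of_ne (by simp), if_neg (fun h => hc h.2.2),
          if_neg (fun h => hc h.2.2)]
        rcases h₂ with ⟨-, rfl⟩ | ⟨l, -, -, -, h⟩
        · rfl
        · exact h i c hc
    · refine ⟨h₁, ?_⟩
      rcases h₂ with ⟨h₂, rfl⟩ | ⟨l, hl, h⟩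
      · refine .inl ⟨fun i hi => ?_, rfl⟩
        rcases Nat.lt_succ_iff_lt_or_eq.1 hi with hi | rfl
        · exact h₂ i hi
        · exact Bool.eq_false_iff.2 hg
      · exact .inr ⟨l, Nat.lt_succ_of_lt hl, h⟩

/-- The number of goods owned by an agent. -/
def load (m : ℕ) (own : ℕ → ℕ → Bool) (i : ℕ) : ℕ :=
  ((Finset.range (m + 1)).filter fun g => own i g = true).card

theorem load_le (own : ℕ → ℕ → Bool) (i : ℕ) : load m own i ≤ m + 1 := by
  simpa [load] using Finset.card_filter_le (Finset.range (m + 1)) fun g => own i g = true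

/-- Computes the difference of the loads of two agents in the counter. -/
def countDiff (x x' : RVar) : Prog :=
  .seq (.for_ (.inr .good) (.test x .good .own .inc .skip))
    (.for_ (.inr .good) (.test x' .good .own .dec .skip))

/-- Resets the counter. -/
def clearCtr : Prog := .for_ (.inr .good) .dec

theorem card_filter_range_succ (P : ℕ → Prop) [DecidablePred P] (j : ℕ) :
    ((Finset.range (j + 1)).filter P).card =
      ((Finset.range j).filter P).card + if P j then 1 else 0 := by
  rw [Finset.range_add_one, Finset.filter_insert]
  split_ifs with h
  · rw [Finset.card_insert_of_notMem (by simp)]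
  · rfl

/-- All increments precede the decrements, so truncation at `0` can be deferred to one subtraction.
A positive result, starting from counter `0`, means that the first agent owns more goods. -/
theorem denote_countDiff (x x' : RVar) (ρ : Var → ℕ) (μ : Mem) :
    (countDiff x x').denote n m ρ μ = ⟨μ.bit, μ.ctr + load m (μ.bit .own) (ρ (.inl x)) -
      load m (μ.bit .own) (ρ (.inl x'))⟩ := by
  have h₁ : (Prog.for_ (.inr .good) (.test x .good .own .inc .skip)).denote n m ρ μ =
      ⟨μ.bit, μ.ctr + load m (μ.bit .own) (ρ (.inl x))⟩ := by
    refine Prog.for_inv (n := n) (m := m) (x := .inr .good) (fun j ν => ν = ⟨μ.bit, μ.ctr +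
      ((Finset.range j).filter fun g => μ.bit .own (ρ (.inl x)) g = true).card⟩) (by simp) ?_
    rintro j hj ν rfl
    simp only [Prog.denote, update_self, ne_eq, reduceCtorEq, not_false_eq_true, update_of_ne,
      card_filter_range_succ]
    split_ifs <;> rfl
  rw [countDiff, Prog.denote, h₁]
  refine Prog.for_inv (n := n) (m := m) (x := .inr .good) (fun j ν => ν = ⟨μ.bit, μ.ctr +
    load m (μ.bit .own) (ρ (.inl x)) -
      ((Finset.range j).filter fun g => μ.bit .own (ρ (.inl x')) g = true).card⟩) (by simp) ?_
  rintro j hj ν rfl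
  simp only [Prog.denote, update_self, ne_eq, reduceCtorEq, not_false_eq_true, update_of_ne,
    card_filter_range_succ]
  split_ifs
  · rw [Nat.sub_add_eq]
  · rfl

theorem denote_clearCtr (ρ : Var → ℕ) {μ : Mem} (h : μ.ctr ≤ m + 1) :
    clearCtr.denote n m ρ μ = ⟨μ.bit, 0⟩ := by
  have : clearCtr.denote n m ρ μ = ⟨μ.bit, μ.ctr - (m + 1)⟩ := by
    refine Prog.for_inv (n := n) (m := m) (x := .inr .good) (fun j ν => ν = ⟨μ.bit, μ.ctr - j⟩)
      rfl ?_
    rintro j hj ν rfl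
    simp [Prog.denote, Nat.sub_add_eq]
  rw [this, Nat.sub_eq_zero_of_le h]

end MatrixProgram

/-! ### The initial allocation and the closure search from a target -/

namespace MatrixProgram

open Function

variable {n m : ℕ}

/-- Every good is owned by exactly one of the agents that value it, if there is such an agent. -/
structure IsAlloc (V own : ℕ → ℕ → Bool) : Prop where
  valued : ∀ {i g}, own i g = true → V i g = true
  unique : ∀ {i j g}, own i g = true → own j g = true → i = j
  covered : ∀ {i g}, V i g = true → ∃ j, own j g = true

/-- A memory between two phases of the algorithm. -/
structure Ready (n m : ℕ) (V : ℕ → ℕ → Bool) (μ : Mem) : Prop where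
  val : μ.bit .val = V
  ctr : μ.ctr = 0
  bounded : μ.Bounded n m

theorem Ready.denote {V : ℕ → ℕ → Bool} {μ : Mem} (h : Ready n m V μ) {p : Prog}
    (h₁ : p.Keeps .val) (h₂ : p.KeepsCtr) (h₃ : p.NoHeader) {ρ : Var → ℕ} (hρ : Env n m ρ) :
    Ready n m V (p.denote n m ρ μ) where
  val := (p.denote_bit_of_keeps h₁ ρ μ).trans h.val
  ctr := (p.denote_ctr_of_keepsCtr h₂ ρ μ).trans h.ctr
  bounded := p.bounded_denote h₃ hρ h.bounded

/-- Gives every good to an agent that values it. -/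
def initAlloc : Prog := .for_ (.inr .good) (pick .good .val .own)

theorem initAlloc_spec {V : ℕ → ℕ → Bool} {μ : Mem} (h : Ready n m V μ)
    (hown : ∀ i g, μ.bit .own i g = false) {ρ : Var → ℕ} (hρ : Env n m ρ) :
    Ready n m V (initAlloc.denote n m ρ μ) ∧
      IsAlloc V ((initAlloc.denote n m ρ μ).bit .own) := by
  have hV : ∀ i g, V i g = true → i < n ∧ g < m + 1 := by
    intro i g hi
    rw [← h.val] at hi
    by_contra hn
    rw [h.bounded .val i g (by omega)] at hi
    exact Bool.false_ne_true hi
  -- Columns are settled from left to right: each is untouched and unowned, or valued by nobody and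
  -- unowned, or owned by exactly one agent who values it.
  suffices Ready n m V (initAlloc.denote n m ρ μ) ∧ ∀ g, m + 1 ≤ g ∧
      (∀ i, (initAlloc.denote n m ρ μ).bit .own i g = false) ∨ g < m + 1 ∧
      ((∀ i, V i g = false) ∧ (∀ i, (initAlloc.denote n m ρ μ).bit .own i g = false) ∨
      ∃ l, V l g = true ∧
        ∀ i, (initAlloc.denote n m ρ μ).bit .own i g = decide (i = l)) by
    refine ⟨this.1, fun {i g} hi => ?_, fun {i j g} hi hj => ?_, fun {i g} hi => ?_⟩ <;>
      rcases this.2 g with ⟨hg, h⟩ | ⟨-, ⟨h', h⟩ | ⟨l, hl, h⟩⟩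
    · simp [h] at hi
    · simp [h] at hi
    · rw [h, decide_eq_true_eq] at hi
      exact hi ▸ hl
    · simp [h] at hi
    · simp [h] at hi
    · rw [h, decide_eq_true_eq] at hi hj
      exact hi.trans hj.symm
    · have := hV i g hi
      omega
    · simp [h'] at hi
    · exact ⟨l, by simp [h]⟩
  refine Prog.for_inv (n := n) (m := m) (x := .inr .good) (fun j ν => Ready n m V ν ∧
    ∀ g, j ≤ g ∧ (∀ i, ν.bit .own i g = false) ∨ g < j ∧
      ((∀ i, V i g = false) ∧ (∀ i, ν.bit .own i g = false) ∨
      ∃ l, V l g = true ∧ ∀ i, ν.bit .own i g = decide (i = l))) ?_ ?_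
  · exact ⟨h, fun g => .inl ⟨Nat.zero_le g, fun i => hown i g⟩⟩
  · intro j hj ν ⟨h₁, h₂⟩
    have hρ' := hρ.update (x := .inr .good) (by simp) hj
    have h₁' := h₁.denote (p := pick .good .val .own) (by simp [pick, clearCol, Prog.Keeps])
      (by simp [pick, clearCol, Prog.KeepsCtr]) (by simp [pick, clearCol, Prog.NoHeader]) hρ'
    refine ⟨h₁', fun g => ?_⟩
    have hp := pick_spec (n := n) (m := m) .good (show Fld.val ≠ .own by simp)
      (update ρ (.inr .good) j) ν
    rw [update_self, h₁.val] at hp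
    rcases hp with ⟨hp, hp'⟩ | ⟨l, hl, hlj, hp, hp'⟩
    · rw [hp']
      rcases h₂ g with ⟨hg, h₂⟩ | ⟨hg, h₂⟩
      · rcases hg.eq_or_lt with rfl | hg
        · refine .inr ⟨Nat.lt_succ_self _, .inl ⟨fun i => ?_, h₂⟩⟩
          by_contra hi
          rw [Bool.not_eq_false] at hi
          rw [hp i (hV i _ hi).1] at hi
          exact Bool.false_ne_true hi
        · exact .inl ⟨hg, h₂⟩
      · exact .inr ⟨Nat.lt_succ_of_lt hg, h₂⟩
    · by_cases hg : g = j
      · subst hg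
        refine .inr ⟨Nat.lt_succ_self _, .inr ⟨l, hlj, fun i => ?_⟩⟩
        rcases Nat.lt_or_ge i n with hi | hi
        · exact hp i hi
        · rw [h₁'.bounded _ _ _ (.inl hi)]
          exact (decide_eq_false (by omega)).symm
      · simp only [hp' _ g hg]
        rcases h₂ g with ⟨hg', h₂⟩ | ⟨hg', h₂⟩
        · exact .inl ⟨by omega, h₂⟩
        · exact .inr ⟨by omega, h₂⟩

/-- Adds an agent to the search if it owns a good that is valued by an agent reached before. -/
def growStep : Prog :=
  .test .source .header .reach .skip (.test .source .good .own (.test .dest .header .reach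
    (.test .dest .good .val (.seq (.set .source .header .reach true)
      (.seq (.set .source .good .give true) (.set .dest .good .recv true))) .skip) .skip) .skip)

/-- One round of the search. -/
def growSweep : Prog := .for_ (.inl .source) (.for_ (.inl .dest) (.for_ (.inr .good) growStep))

/-- Searches all agents from which a good can be transferred to the target by a chain. -/
def grow : Prog := .for_ (.inl .round) growSweep

/-- The agents reached by the search. -/
def reached (n : ℕ) (μ : Mem) : Finset ℕ :=
  (Finset.range n).filter fun i => μ.bit .reach i 0 = true

/-- The memory during a search. The function `rk` tells in which order the agents are reached. -/
structure Search (n : ℕ) (V : ℕ → ℕ → Bool) (t : ℕ) (rk : ℕ → ℕ) (μ : Mem) : Prop where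
  target : μ.bit .reach t 0 = true
  rk_lt : ∀ {i}, μ.bit .reach i 0 = true → rk i < (reached n μ).card
  give : ∀ {i g}, μ.bit .give i g = true → μ.bit .own i g = true ∧ μ.bit .reach i 0 = true ∧
    i ≠ t ∧ ∃ k, μ.bit .recv k g = true ∧ V k g = true ∧ μ.bit .reach k 0 = true ∧ rk k < rk i
  total : ∀ {i}, μ.bit .reach i 0 = true → i ≠ t → ∃ g, μ.bit .give i g = true
  give_unique : ∀ {i g g'}, μ.bit .give i g = true → μ.bit .give i g' = true → g = g'
  recv_unique : ∀ {k k' g}, μ.bit .recv k g = true → μ.bit .recv k' g = true → k = k'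
  recv_give : ∀ {k g}, μ.bit .recv k g = true → ∃ i, μ.bit .give i g = true

theorem denote_growStep {ρ : Var → ℕ} (hρ : Env n m ρ) (μ : Mem) :
    (growStep.denote n m ρ μ = μ ∧ ¬ (μ.bit .reach (ρ (.inl .source)) 0 = false ∧
      μ.bit .own (ρ (.inl .source)) (ρ (.inr .good)) = true ∧
      μ.bit .reach (ρ (.inl .dest)) 0 = true ∧
      μ.bit .val (ρ (.inl .dest)) (ρ (.inr .good)) = true)) ∨
    (growStep.denote n m ρ μ = ((μ.set .reach (ρ (.inl .source)) 0 true).set .give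
      (ρ (.inl .source)) (ρ (.inr .good)) true).set .recv (ρ (.inl .dest)) (ρ (.inr .good)) true ∧
      μ.bit .reach (ρ (.inl .source)) 0 = false ∧
      μ.bit .own (ρ (.inl .source)) (ρ (.inr .good)) = true ∧
      μ.bit .reach (ρ (.inl .dest)) 0 = true ∧
      μ.bit .val (ρ (.inl .dest)) (ρ (.inr .good)) = true) := by
  simp only [growStep, Prog.denote, hρ.header]
  split_ifs <;> simp_all

/-- A newly reached agent gets as its rank the number of agents reached so far, which exceeds the
ranks of all of them, in particular that of the receiver of its good. -/
theorem Search.step {V : ℕ → ℕ → Bool} {t : ℕ} {rk : ℕ → ℕ} {μ : Mem} (hμ : Ready n m V μ)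
    (ha : IsAlloc V (μ.bit .own)) (h : Search n V t rk μ) {ρ : Var → ℕ} (hρ : Env n m ρ) :
    ∃ rk', Search n V t rk' (growStep.denote n m ρ μ) := by
  have hlt : ρ (.inl .source) < n := hρ.lt (.inl .source)
  rcases denote_growStep hρ μ with ⟨e, -⟩ | ⟨e, h₁, h₂, h₃, h₄⟩
  · exact ⟨rk, by rwa [e]⟩
  rw [e]
  rw [hμ.val] at h₄
  generalize ρ (.inl .source) = s at *
  generalize ρ (.inl .dest) = k at *
  generalize ρ (.inr .good) = y at *
  have hst : s ≠ t := by
    rintro rfl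
    rw [h.target] at h₁
    exact Bool.false_ne_true h₁.symm
  have hks : k ≠ s := by
    rintro rfl
    rw [h₃] at h₁
    exact Bool.false_ne_true h₁.symm
  have hng : ∀ g, μ.bit .give s g ≠ true := by
    intro g hg
    rw [(h.give hg).2.1] at h₁
    exact Bool.false_ne_true h₁.symm
  -- A receiver of `y` would presuppose a giver of `y`; as owners are unique, the giver would be
  -- `s`, which has given nothing yet.
  have hnr : ∀ k, μ.bit .recv k y ≠ true := by
    intro k hk
    obtain ⟨i, hi⟩ := h.recv_give hk
    rw [ha.unique (h.give hi).1 h₂] at hi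
    exact hng y hi
  have hcard : (reached n (((μ.set .reach s 0 true).set .give s y true).set .recv k y true)).card =
      (reached n μ).card + 1 := by
    have : reached n (((μ.set .reach s 0 true).set .give s y true).set .recv k y true) =
        insert s (reached n μ) := by
      ext i
      simp only [reached, Mem.bit_set, Finset.mem_filter, Finset.mem_insert, Finset.mem_range]
      by_cases hi : i = s
      · subst hi
        simpa using hlt
      · simp [hi]
    rw [this, Finset.card_insert_of_notMem (by simp [reached, h₁])]
  refine ⟨update rk s (reached n μ).card, ?_, ?_, ?_, ?_, ?_, ?_, ?_⟩
  · simp [Mem.bit_set, h.target]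
  · intro i hi
    rw [hcard]
    by_cases his : i = s
    · simp [his]
    · simp only [Mem.bit_set, reduceCtorEq, false_and, if_false, his, and_false] at hi
      rw [update_of_ne his]
      exact (h.rk_lt hi).trans (Nat.lt_succ_self _)
  · intro i g hi
    simp only [Mem.bit_set, reduceCtorEq, false_and, if_false, true_and, and_true] at hi ⊢
    by_cases his : i = s ∧ g = y
    · obtain ⟨rfl, rfl⟩ := his
      refine ⟨h₂, by simp, hst, k, by simp, h₄, by simp [h₃], ?_⟩
      rw [update_self, update_of_ne hks]
      exact h.rk_lt h₃
    · rw [if_neg his] at hi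
      obtain ⟨e₁, e₂, e₃, k', e₄, e₅, e₆, e₇⟩ := h.give hi
      have hi' : i ≠ s := by
        rintro rfl
        exact hng g hi
      have hk' : k' ≠ s := by
        rintro rfl
        rw [e₆] at h₁
        exact Bool.false_ne_true h₁.symm
      refine ⟨e₁, by simp [e₂], e₃, k', by simp [e₄], e₅, by simp [e₆], ?_⟩
      rwa [update_of_ne hi', update_of_ne hk']
  · intro i hi hit
    simp only [Mem.bit_set, reduceCtorEq, false_and, if_false, true_and, and_true] at hi ⊢
    by_cases his : i = s
    · exact ⟨y, by simp [his]⟩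
    · rw [if_neg his] at hi
      obtain ⟨g, hg⟩ := h.total hi hit
      exact ⟨g, by simp [hg]⟩
  · intro i g g' hg hg'
    simp only [Mem.bit_set, reduceCtorEq, false_and, if_false, true_and] at hg hg'
    by_cases his : i = s
    · subst his
      grind
    · simp only [his, false_and, if_false] at hg hg'
      exact h.give_unique hg hg'
  · intro i i' g hg hg'
    simp only [Mem.bit_set, true_and] at hg hg'
    by_cases hgy : g = y
    · subst hgy
      grind
    · simp only [hgy, and_false, if_false, reduceCtorEq, false_and] at hg hg'
      exact h.recv_unique hg hg'
  · intro i g hg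
    simp only [Mem.bit_set, true_and, reduceCtorEq, false_and, if_false] at hg ⊢
    by_cases hgy : g = y
    · exact ⟨s, by simp [hgy]⟩
    · simp only [hgy, and_false, if_false] at hg
      obtain ⟨i', hi'⟩ := h.recv_give hg
      exact ⟨i', by simp [hi']⟩

/-- No further agent can be added to the search. -/
def Closed (V : ℕ → ℕ → Bool) (μ : Mem) : Prop :=
  ∀ {i k g}, μ.bit .own i g = true → V k g = true → μ.bit .reach k 0 = true →
    μ.bit .reach i 0 = true

theorem growSweep_of_closed {V : ℕ → ℕ → Bool} {μ : Mem} (hV : μ.bit .val = V) (h : Closed V μ)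
    {ρ : Var → ℕ} (hρ : Env n m ρ) : growSweep.denote n m ρ μ = μ := by
  refine Prog.for_inv (fun _ ν => ν = μ) rfl fun i hi ν hν => ?_
  subst hν
  refine Prog.for_inv (fun _ ν' => ν' = ν) rfl fun k hk ν' hν' => ?_
  subst hν'
  refine Prog.for_inv (fun _ ν => ν = ν') rfl fun g hg ν hν => ?_
  subst hν
  rcases denote_growStep (((hρ.update (by simp) hi).update (by simp) hk).update (by simp) hg) ν
    with ⟨e, -⟩ | ⟨-, h₁, h₂, h₃, h₄⟩
  · exact e
  · rw [hV] at h₄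
    rw [h h₂ h₄ h₃] at h₁
    exact absurd h₁.symm Bool.false_ne_true

/-- The fields that a search does not change and the agents reached. -/
structure Reaches (V own : ℕ → ℕ → Bool) (i : ℕ) (μ : Mem) : Prop where
  val : μ.bit .val = V
  own : μ.bit .own = own
  reach : μ.bit .reach i 0 = true

theorem Reaches.step {V own : ℕ → ℕ → Bool} {i : ℕ} {μ : Mem} (h : Reaches V own i μ)
    {ρ : Var → ℕ} (hρ : Env n m ρ) : Reaches V own i (growStep.denote n m ρ μ) := by
  refine ⟨(Prog.denote_bit_of_keeps _ (by simp [growStep, Prog.Keeps]) _ _).trans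
    h.val, (Prog.denote_bit_of_keeps _ (by simp [growStep, Prog.Keeps]) _ _).trans
    h.own, ?_⟩
  rcases denote_growStep hρ μ with ⟨e, -⟩ | ⟨e, -⟩
  · rw [e, h.reach]
  · simp [e, Mem.bit_set, h.reach]

theorem Reaches.sweep {V own : ℕ → ℕ → Bool} {i : ℕ} {μ : Mem} (h : Reaches V own i μ)
    {ρ : Var → ℕ} (hρ : Env n m ρ) : Reaches V own i (growSweep.denote n m ρ μ) :=
  Prog.for_inv (fun _ ν => Reaches V own i ν) h fun _ hi _ h =>
    Prog.for_inv (fun _ ν => Reaches V own i ν) h fun _ hk _ h =>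
      Prog.for_inv (fun _ ν => Reaches V own i ν) h fun _ hg _ h =>
        h.step (((hρ.update (by simp) hi).update (by simp) hk).update (by simp) hg)

/-- The sweep visits the triple `(i, k, g)`. Reached agents stay reached, so `k` is still reached at
that visit; then `i` is added unless it was reached already. -/
theorem reaches_growSweep {V own : ℕ → ℕ → Bool} {i k g : ℕ} {μ : Mem} (h : Reaches V own k μ)
    (hi : i < n) (hk : k < n) (hg : g < m + 1) (h₁ : own i g = true) (h₂ : V k g = true)
    {ρ : Var → ℕ} (hρ : Env n m ρ) : Reaches V own i (growSweep.denote n m ρ μ) := by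
  have step : ∀ {j j' : ℕ} (hj : j < dim n m (.inl .source)) (hj' : j' < dim n m (.inl .dest)) {c}
      (hc : c < dim n m (.inr .good)) {l} ν, Reaches V own l ν → Reaches V own l
        (growStep.denote n m (update (update (update ρ (.inl .source) j) (.inl .dest) j')
          (.inr .good) c) ν) := fun hj hj' _ hc _ _ h =>
    h.step (((hρ.update (by simp) hj).update (by simp) hj').update (by simp) hc)
  refine Prog.for_hit (Reaches V own k) (Reaches V own i) i hi h
    (fun j hj ν h => Prog.for_inv (fun _ ν => Reaches V own k ν) h fun j' hj' ν h =>
      Prog.for_inv (fun _ ν => Reaches V own k ν) h fun c hc ν h => step hj hj' hc ν h)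
    (fun j hj ν h => Prog.for_inv (fun _ ν => Reaches V own i ν) h fun j' hj' ν h =>
      Prog.for_inv (fun _ ν => Reaches V own i ν) h fun c hc ν h => step hj hj' hc ν h)
    fun ν h => ?_
  refine Prog.for_hit (Reaches V own k) (Reaches V own i) k hk h
    (fun j' hj' ν h => Prog.for_inv (fun _ ν => Reaches V own k ν) h fun c hc ν h =>
      step hi hj' hc ν h)
    (fun j' hj' ν h => Prog.for_inv (fun _ ν => Reaches V own i ν) h fun c hc ν h =>
      step hi hj' hc ν h)
    fun ν h => ?_
  refine Prog.for_hit (Reaches V own k) (Reaches V own i) g hg h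
    (fun c hc ν h => step hi hk hc ν h) (fun c hc ν h => step hi hk hc ν h) fun ν h => ?_
  have h' := step hi hk hg ν h
  refine ⟨h'.val, h'.own, ?_⟩
  rcases denote_growStep (((hρ.update (x := .inl .source) (by simp) hi).update (x := .inl .dest)
    (by simp) hk).update (x := .inr .good) (by simp) hg) ν with ⟨e, e'⟩ | ⟨e, -⟩
  · rw [e]
    by_contra hn
    refine e' ⟨?_, ?_, ?_, ?_⟩
    · simpa using hn
    · simpa [h.own] using h₁
    · simpa using h.reach
    · simpa [h.val] using h₂
  · simp [e, Mem.bit_set]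

theorem Search.sweep {V : ℕ → ℕ → Bool} {t : ℕ} {rk : ℕ → ℕ} {μ : Mem} (hμ : Ready n m V μ)
    (ha : IsAlloc V (μ.bit .own)) (h : Search n V t rk μ) {ρ : Var → ℕ} (hρ : Env n m ρ) :
    ∃ rk', Search n V t rk' (growSweep.denote n m ρ μ) := by
  have step : ∀ {ρ} (hρ : Env n m ρ) (ν : Mem), (Ready n m V ν ∧ IsAlloc V (ν.bit .own) ∧
      ∃ rk', Search n V t rk' ν) → (Ready n m V (growStep.denote n m ρ ν) ∧
        IsAlloc V ((growStep.denote n m ρ ν).bit .own) ∧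
          ∃ rk', Search n V t rk' (growStep.denote n m ρ ν)) := by
    rintro ρ hρ ν ⟨h₁, h₂, rk', h₃⟩
    refine ⟨h₁.denote (by simp [growStep, Prog.Keeps])
      (by simp [growStep, Prog.KeepsCtr])
      (by simp [growStep, Prog.NoHeader]) hρ, ?_, h₃.step h₁ h₂ hρ⟩
    rwa [Prog.denote_bit_of_keeps _ (by simp [growStep, Prog.Keeps])]
  exact (Prog.for_inv (fun _ ν => Ready n m V ν ∧ IsAlloc V (ν.bit .own) ∧
    ∃ rk', Search n V t rk' ν) ⟨hμ, ha, rk, h⟩ fun _ hi _ h =>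
      Prog.for_inv (fun _ ν => Ready n m V ν ∧ IsAlloc V (ν.bit .own) ∧
        ∃ rk', Search n V t rk' ν) h fun _ hk _ h =>
          Prog.for_inv (fun _ ν => Ready n m V ν ∧ IsAlloc V (ν.bit .own) ∧
            ∃ rk', Search n V t rk' ν) h fun _ hg _ h =>
              step (((hρ.update (by simp) hi).update (by simp) hk).update (by simp) hg) _ h).2.2

/-- A round that starts from a search not yet closed adds an agent. If the search were not closed
after `n` rounds, more than `n` agents would be reached. -/
theorem grow_spec {V : ℕ → ℕ → Bool} {t : ℕ} {rk : ℕ → ℕ} {μ : Mem} (hμ : Ready n m V μ)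
    (ha : IsAlloc V (μ.bit .own)) (h : Search n V t rk μ) {ρ : Var → ℕ} (hρ : Env n m ρ) :
    Closed V (grow.denote n m ρ μ) ∧ ∃ rk', Search n V t rk' (grow.denote n m ρ μ) := by
  have hinv := Prog.for_inv (n := n) (m := m) (x := .inl .round) (p := growSweep) (ρ := ρ) (μ := μ)
    (fun j ν => Ready n m V ν ∧ IsAlloc V (ν.bit .own) ∧
      (∃ rk', Search n V t rk' ν) ∧ (Closed V ν ∨ j < (reached n ν).card)) ?_ ?_
  · obtain ⟨-, -, h₃, h₄ | h₄⟩ := hinv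
    · exact ⟨h₄, h₃⟩
    · have := (Finset.card_filter_le (Finset.range n) fun i =>
        (grow.denote n m ρ μ).bit .reach i 0 = true)
      rw [Finset.card_range] at this
      exact absurd h₄ (not_lt.2 this)
  · exact ⟨hμ, ha, ⟨rk, h⟩, .inr ((Nat.zero_le _).trans_lt (h.rk_lt h.target))⟩
  · rintro j hj ν ⟨h₁, h₂, ⟨rk', h₃⟩, h₄⟩
    have hρ' := hρ.update (x := .inl .round) (by simp) hj
    refine ⟨h₁.denote (by simp [growSweep, growStep, Prog.Keeps])
      (by simp [growSweep, growStep, Prog.KeepsCtr])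
      (by simp [growSweep, growStep, Prog.NoHeader]) hρ', ?_,
      h₃.sweep h₁ h₂ hρ', ?_⟩
    · rwa [Prog.denote_bit_of_keeps _
        (by simp [growSweep, growStep, Prog.Keeps])]
    · by_cases hcl : Closed V ν
      · exact .inl (by rwa [growSweep_of_closed h₁.val hcl hρ'])
      · right
        have hlt := h₄.resolve_left hcl
        refine Nat.lt_of_le_of_lt hlt (Finset.card_lt_card ?_)
        have hin : ∀ {f i g}, ν.bit f i g = true → i < n ∧ g < m + 1 := by
          intro f i g hi
          by_contra hn
          rw [h₁.bounded f i g (by omega)] at hi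
          exact Bool.false_ne_true hi
        rw [Finset.ssubset_iff_of_subset]
        · simp only [Closed, not_forall] at hcl
          obtain ⟨i, k, g, e₁, e₂, e₃, e₄⟩ := hcl
          refine ⟨i, ?_, ?_⟩
          · exact Finset.mem_filter.2 ⟨Finset.mem_range.2 (hin e₁).1,
              (reaches_growSweep ⟨h₁.val, rfl, e₃⟩ (hin e₁).1 (hin e₃).1 (hin e₁).2 e₁ e₂
                hρ').reach⟩
          · simp [reached, e₄]
        · intro i hi
          obtain ⟨hi, hi'⟩ := Finset.mem_filter.1 hi
          exact Finset.mem_filter.2 ⟨hi, (Reaches.sweep ⟨h₁.val, rfl, hi'⟩ hρ').reach⟩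

end MatrixProgram

/-! ### Selecting a source and executing the chain of transfers -/

namespace MatrixProgram

open Function

variable {n m : ℕ}

theorem Mem.Bounded.lt {μ : Mem} (h : μ.Bounded n m) {f : Fld} {i g : ℕ}
    (hi : μ.bit f i g = true) : i < n ∧ g < m + 1 := by
  by_contra hn
  rw [h f i g (by omega)] at hi
  exact Bool.false_ne_true hi

theorem load_set_true {μ : Mem} {i g : ℕ} (h : μ.bit .own i g = false) (hg : g < m + 1) (j : ℕ) :
    load m ((μ.set .own i g true).bit .own) j =
      load m (μ.bit .own) j + if j = i then 1 else 0 := by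
  unfold load
  split_ifs with hj
  · subst hj
    have : (Finset.range (m + 1)).filter (fun c => (μ.set .own j g true).bit .own j c = true) =
        insert g ((Finset.range (m + 1)).filter fun c => μ.bit .own j c = true) := by
      ext c
      simp only [Mem.bit_set, Finset.mem_filter, Finset.mem_insert, Finset.mem_range]
      by_cases hc : c = g
      · simp [hc, hg]
      · simp [hc]
    rw [this, Finset.card_insert_of_notMem (by simp [h])]
  · simp [Mem.bit_set, hj]

theorem load_set_false {μ : Mem} {i g : ℕ} (h : μ.bit .own i g = true) (hg : g < m + 1) (j : ℕ) :
    load m ((μ.set .own i g false).bit .own) j + (if j = i then 1 else 0) =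
      load m (μ.bit .own) j := by
  rw [← load_set_true (by simp [Mem.bit_set]) hg, Mem.set_set]
  congr
  ext f i' g'
  · simp only [Mem.bit_set]
    split_ifs with hc
    · rw [hc.1, hc.2.1, hc.2.2, h]
    · rfl
  · rfl

/-- Prepares the search for goods that can be transferred to the target. -/
def resetSearch : Prog :=
  .seq (clearFld .reach) (.seq (clearFld .cur) (.seq (clearFld .give) (.seq (clearFld .recv)
    (.set .target .header .reach true))))

theorem resetSearch_spec {V : ℕ → ℕ → Bool} {μ : Mem} (h : Ready n m V μ) {ρ : Var → ℕ}
    (hρ : Env n m ρ) :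
    Search n V (ρ (.inl .target)) (fun _ => 0) (resetSearch.denote n m ρ μ) ∧
      ∀ i g, (resetSearch.denote n m ρ μ).bit .cur i g = false := by
  -- Each of the four fields is wiped by its own pass and spared by the others; the final write
  -- marks the target as the only agent reached.
  have key : ∀ f, f = .reach ∨ f = .cur ∨ f = .give ∨ f = .recv → ∀ i g,
      (resetSearch.denote n m ρ μ).bit f i g =
        decide (f = .reach ∧ i = ρ (.inl .target) ∧ g = 0) := by
    intro f hf i g
    have h₁ := h.bounded
    have h₂ := (clearFld .reach).bounded_denote (by simp [clearFld, clearCol, Prog.NoHeader]) hρ h₁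
    have h₃ := (clearFld .cur).bounded_denote (by simp [clearFld, clearCol, Prog.NoHeader]) hρ h₂
    have h₄ := (clearFld .give).bounded_denote (by simp [clearFld, clearCol, Prog.NoHeader]) hρ h₃
    have keeps : ∀ {f f'}, f ≠ f' → ∀ ν, ((clearFld f').denote n m ρ ν).bit f = ν.bit f :=
      fun hff' ν => Prog.denote_bit_of_keeps _ (by simpa [clearFld, clearCol, Prog.Keeps]) ρ ν
    simp only [resetSearch, Prog.denote, Mem.bit_set, hρ.header]
    rcases hf with rfl | rfl | rfl | rfl
    · rw [keeps (by simp), keeps (by simp), keeps (by simp), bit_clearFld _ _ h₁]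
      simp
    · rw [keeps (by simp), keeps (by simp), bit_clearFld _ _ h₂]
      simp
    · rw [keeps (by simp), bit_clearFld _ _ h₃]
      simp
    · rw [bit_clearFld _ _ h₄]
      simp
  refine ⟨⟨?_, ?_, ?_, ?_, ?_, ?_, ?_⟩, fun i g => ?_⟩
  · simp [key]
  · intro i hi
    have hi' := hi
    rw [key _ (by simp)] at hi'
    refine Finset.card_pos.2 ⟨i, Finset.mem_filter.2 ⟨?_, hi⟩⟩
    have := hρ.lt (.inl .target)
    simp only [true_and, and_true, decide_eq_true_eq] at hi'
    rw [hi']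
    exact Finset.mem_range.2 this
  · simp [key]
  · intro i hi hit
    simp [key, hit] at hi
  · simp [key]
  · simp [key]
  · simp [key]
  · simp [key]

/-- Checks whether an agent reached by the search owns more goods than the target, even after a
transfer. -/
def candStep : Prog :=
  .seq (.set .source .header .cand false) (.test .source .header .reach
    (.seq (countDiff .source .target) (.seq .dec
      (.seq (.pos (.set .source .header .cand true) .skip) clearCtr))) .skip)

/-- Finds the agents from which it is useful to transfer a good to the target. -/
def cands : Prog := .for_ (.inl .source) candStep

/-- The decrement after `countDiff` demands a surplus of at least two goods, so that a transfer
strictly improves the balance. -/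
theorem denote_candStep {ρ : Var → ℕ} (hρ : Env n m ρ) {μ : Mem} (h : μ.ctr = 0) :
    candStep.denote n m ρ μ = μ.set .cand (ρ (.inl .source)) 0
      (decide (μ.bit .reach (ρ (.inl .source)) 0 = true ∧
        load m (μ.bit .own) (ρ (.inl .target)) + 1 < load m (μ.bit .own) (ρ (.inl .source)))) := by
  have hown : (μ.set .cand (ρ (.inl .source)) 0 false).bit .own = μ.bit .own := by
    funext i g
    simp [Mem.bit_set]
  have hreach : (μ.set .cand (ρ (.inl .source)) 0 false).bit .reach = μ.bit .reach := by
    funext i g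
    simp [Mem.bit_set]
  have hctr : (μ.set .cand (ρ (.inl .source)) 0 false).ctr = 0 := h
  have hle := load_le (m := m) (μ.bit .own) (ρ (.inl .source))
  simp only [candStep, Prog.denote, hρ.header, denote_countDiff, hown, hreach, hctr, zero_add]
  by_cases hr : μ.bit .reach (ρ (.inl .source)) 0 = true
  · simp only [hr, true_and, if_true]
    by_cases hl : load m (μ.bit .own) (ρ (.inl .target)) + 1 <
        load m (μ.bit .own) (ρ (.inl .source))
    · rw [if_pos (by omega), denote_clearCtr _ (by simp only [Mem.set]; omega), decide_eq_true hl]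
      ext f i g
      · simp only [Mem.bit_set]
        split_ifs <;> simp_all [Mem.set]
      · exact h.symm
    · rw [if_neg (by omega), denote_clearCtr _ (by dsimp only; omega), decide_eq_false hl]
      ext f i g
      · rfl
      · exact h.symm
  · simp [hr]

theorem cands_spec {V : ℕ → ℕ → Bool} {μ : Mem} (h : Ready n m V μ) {ρ : Var → ℕ}
    (hρ : Env n m ρ) :
    Ready n m V (cands.denote n m ρ μ) ∧ ∀ s < n, (cands.denote n m ρ μ).bit .cand s 0 =
      decide (μ.bit .reach s 0 = true ∧
        load m (μ.bit .own) (ρ (.inl .target)) + 1 < load m (μ.bit .own) s) := by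
  have := Prog.for_inv (n := n) (m := m) (x := .inl .source) (p := candStep) (ρ := ρ) (μ := μ)
    (fun j ν => ν.ctr = 0 ∧ ν.bit .own = μ.bit .own ∧ ν.bit .reach = μ.bit .reach ∧
      ∀ s < j, ν.bit .cand s 0 = decide (μ.bit .reach s 0 = true ∧
        load m (μ.bit .own) (ρ (.inl .target)) + 1 < load m (μ.bit .own) s))
    ⟨h.ctr, rfl, rfl, fun s hs => absurd hs (Nat.not_lt_zero s)⟩ ?_
  · refine ⟨⟨?_, this.1, ?_⟩, this.2.2.2⟩
    · exact (Prog.denote_bit_of_keeps _ (by simp [cands, candStep, countDiff, clearCtr, Prog.Keeps])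
        _ _).trans h.val
    · exact Prog.bounded_denote _ (by simp [cands, candStep, countDiff, clearCtr, Prog.NoHeader]) hρ
        h.bounded
  · rintro j hj ν ⟨h₁, h₂, h₃, h₄⟩
    rw [denote_candStep (hρ.update (by simp) hj) h₁, h₂, h₃]
    simp only [update_self, ne_eq, reduceCtorEq, not_false_eq_true, update_of_ne, Sum.inl.injEq]
    refine ⟨h₁, ?_, ?_, fun s hs => ?_⟩
    · rw [← h₂]
      funext i g
      simp [Mem.bit_set]
    · rw [← h₃]
      funext i g
      simp [Mem.bit_set]
    · rw [Mem.bit_set]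
      split_ifs with hsj
      · rw [hsj.2.1]
      · exact h₄ s (by simp only [true_and, and_true] at hsj; omega)

/-- Gives a good to its receiver and moves on to this agent. -/
def receive : Prog :=
  .for_ (.inl .dest) (.test .dest .good .recv
    (.seq (.set .dest .good .own true) (.set .dest .header .cur true)) .skip)

/-- Transfers a good. -/
def transfer : Prog :=
  .seq (.set .source .good .own false) (.seq (.set .source .header .cur false) receive)

/-- Transfers the good that the current agent has to give away. -/
def walkStep : Prog :=
  .test .source .header .cur (.for_ (.inr .good) (.test .source .good .give transfer .skip)) .skip

/-- Transfers goods along a chain to the target. -/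
def walk : Prog := .for_ (.inl .round) (.for_ (.inl .source) walkStep)

/-- The memory after the transfer of the good `g` from `c` to `k`. -/
def Mem.transfer (μ : Mem) (c g k : ℕ) : Mem :=
  (((μ.set .own c g false).set .cur c 0 false).set .own k g true).set .cur k 0 true

theorem denote_receive {μ : Mem} {k : ℕ} {ρ : Var → ℕ} (hρ : Env n m ρ) (hk : k < n)
    (h : ∀ i, μ.bit .recv i (ρ (.inr .good)) = true ↔ i = k) :
    receive.denote n m ρ μ = (μ.set .own k (ρ (.inr .good)) true).set .cur k 0 true := by
  have := Prog.for_inv (n := n) (m := m) (x := .inl .dest) (ρ := ρ) (μ := μ)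
    (p := .test .dest .good .recv
      (.seq (.set .dest .good .own true) (.set .dest .header .cur true)) .skip)
    (fun j ν => ν = if k < j then (μ.set .own k (ρ (.inr .good)) true).set .cur k 0 true else μ)
    (by simp) ?_
  · rwa [dim, if_pos hk] at this
  · rintro j hj ν rfl
    have hr : (if k < j then (μ.set .own k (ρ (.inr .good)) true).set .cur k 0 true else μ).bit
        .recv j (ρ (.inr .good)) = μ.bit .recv j (ρ (.inr .good)) := by
      split_ifs
      · simp [Mem.bit_set]
      · rfl
    simp only [Prog.denote, update_self, ne_eq, reduceCtorEq, not_false_eq_true, update_of_ne,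
      hρ.header, hr, h]
    by_cases hjk : j = k
    · subst hjk
      simp
    · rw [if_neg hjk]
      congr 1
      simp only [eq_iff_iff]
      omega

theorem denote_transfer {μ : Mem} {k : ℕ} {ρ : Var → ℕ} (hρ : Env n m ρ) (hk : k < n)
    (h : ∀ i, μ.bit .recv i (ρ (.inr .good)) = true ↔ i = k) :
    transfer.denote n m ρ μ = μ.transfer (ρ (.inl .source)) (ρ (.inr .good)) k := by
  simp only [transfer, Prog.denote]
  rw [denote_receive hρ hk, hρ.header]
  · rfl
  · simpa [Mem.bit_set] using h

/-- Since the good given by the current agent and its receiver are unique, the loops over goods and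
receivers act exactly once. -/
theorem denote_walkStep {μ : Mem} {g k : ℕ} {ρ : Var → ℕ} (hρ : Env n m ρ) (hk : k < n)
    (hg : g < m + 1) (h : ∀ i, μ.bit .recv i g = true ↔ i = k)
    (h' : ∀ c, μ.bit .give (ρ (.inl .source)) c = true ↔ c = g)
    (hc : μ.bit .cur (ρ (.inl .source)) 0 = true) :
    walkStep.denote n m ρ μ = μ.transfer (ρ (.inl .source)) g k := by
  rw [walkStep, Prog.denote, hρ.header, if_pos hc]
  have := Prog.for_inv (n := n) (m := m) (x := .inr .good) (ρ := ρ) (μ := μ)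
    (p := .test .source .good .give transfer .skip)
    (fun j ν => ν = if g < j then μ.transfer (ρ (.inl .source)) g k else μ) (by simp) ?_
  · rwa [dim, if_pos hg] at this
  · rintro j hj ν rfl
    have hr : (if g < j then μ.transfer (ρ (.inl .source)) g k else μ).bit .give =
        μ.bit .give := by
      split_ifs
      · funext i c
        simp [Mem.transfer, Mem.bit_set]
      · rfl
    rw [Prog.denote, hr]
    simp only [update_self, ne_eq, reduceCtorEq, not_false_eq_true, update_of_ne]
    by_cases hjg : j = g
    · subst hjg
      rw [if_pos ((h' _).2 rfl), if_neg (lt_irrefl _), if_pos (Nat.lt_succ_self _),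
        denote_transfer (hρ.update (by simp) hj) hk]
      · simp
      · simpa using h
    · rw [if_neg (fun hj => hjg ((h' _).1 hj)), Prog.denote]
      congr 1
      simp only [eq_iff_iff]
      omega

/-- The memory during the transfers along a chain that starts at `s` and has arrived at `c`. -/
structure Walk (n m : ℕ) (V : ℕ → ℕ → Bool) (rk : ℕ → ℕ) (μ₀ : Mem) (s c : ℕ) (μ : Mem) :
    Prop where
  ready : Ready n m V μ
  alloc : IsAlloc V (μ.bit .own)
  give : μ.bit .give = μ₀.bit .give
  recv : μ.bit .recv = μ₀.bit .recv
  cur : ∀ i, μ.bit .cur i 0 = true ↔ i = c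
  reach : μ₀.bit .reach c 0 = true
  own : ∀ {i g}, rk i ≤ rk c → μ₀.bit .own i g = true → μ.bit .own i g = true
  load : ∀ i, load m (μ.bit .own) i + (if i = s then 1 else 0) =
    load m (μ₀.bit .own) i + if i = c then 1 else 0

/-- The turn passes to an agent of smaller rank. Agents of rank at most that of the current one have
not lost any good yet, so the good assigned by the search is still there to be given. -/
theorem Walk.step {V : ℕ → ℕ → Bool} {rk : ℕ → ℕ} {μ₀ μ : Mem} {s t c : ℕ}
    (h : Walk n m V rk μ₀ s c μ) (h₀ : Search n V t rk μ₀) {ρ : Var → ℕ} (hρ : Env n m ρ) :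
    walkStep.denote n m ρ μ = μ ∧ (ρ (.inl .source) = c → c = t) ∨
      ρ (.inl .source) = c ∧ c ≠ t ∧ ∃ k, rk k < rk c ∧ Walk n m V rk μ₀ s k (walkStep.denote n m ρ μ) := by
  by_cases hc : ρ (.inl .source) = c
  swap
  · refine .inl ⟨?_, fun h => absurd h hc⟩
    rw [walkStep, Prog.denote, hρ.header, if_neg (fun h' => hc ((h.cur _).1 h'))]
    rfl
  by_cases hct : c = t
  · refine .inl ⟨?_, fun _ => hct⟩
    rw [walkStep, Prog.denote]
    split_ifs
    · refine Prog.for_inv (n := n) (m := m) (x := .inr .good) (fun _ ν => ν = μ) rfl ?_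
      rintro j hj ν rfl
      rw [Prog.denote, if_neg, Prog.denote]
      intro hg
      simp only [update_self, ne_eq, reduceCtorEq, not_false_eq_true, update_of_ne, hc,
        h.give] at hg
      exact (h₀.give hg).2.2.1 hct
    · rfl
  refine .inr ⟨hc, hct, ?_⟩
  obtain ⟨g, hg⟩ := h₀.total h.reach hct
  obtain ⟨hown, -, -, k, hkr, hkV, hkreach, hrk⟩ := h₀.give hg
  rw [← h.recv] at hkr
  have hkg := h.ready.bounded.lt hkr
  have hck : c ≠ k := by
    rintro rfl
    exact lt_irrefl _ hrk
  have hcg := h.own le_rfl hown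
  have hko : μ.bit .own k g = false := by
    rw [← Bool.not_eq_true]
    exact fun hk => hck (h.alloc.unique hcg hk)
  refine ⟨k, hrk, ?_⟩
  have hready := h.ready.denote (p := walkStep)
    (by simp [walkStep, transfer, receive, Prog.Keeps])
    (by simp [walkStep, transfer, receive, Prog.KeepsCtr])
    (by simp [walkStep, transfer, receive, Prog.NoHeader]) hρ
  have e := denote_walkStep (μ := μ) (g := g) hρ hkg.1 hkg.2
    (fun i => ⟨fun hi => by rw [h.recv] at hi hkr; exact h₀.recv_unique hi hkr, fun hi => hi ▸ hkr⟩)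
    (fun c' => by
      rw [h.give, hc]
      exact ⟨fun hc' => h₀.give_unique hc' hg, fun hc' => hc' ▸ hg⟩)
    ((h.cur _).2 hc)
  rw [e, hc] at hready ⊢
  have howns : (μ.transfer c g k).bit .own =
      ((μ.set .own c g false).set .own k g true).bit .own := by
    funext i g'
    simp [Mem.transfer, Mem.bit_set]
  have hbit : ∀ i g', (μ.transfer c g k).bit .own i g' = true ↔
      (i = k ∧ g' = g) ∨ (¬(i = c ∧ g' = g) ∧ μ.bit .own i g' = true) := by
    intro i g'
    rw [howns]
    simp only [Mem.bit_set, true_and]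
    by_cases hi : i = k ∧ g' = g
    · simp [hi]
    · by_cases hi' : i = c ∧ g' = g
      · simp [hi']
      · simp [hi, hi']
  refine ⟨hready, ⟨fun {i g'} hi => ?_, fun {i j g'} hi hj => ?_, fun {i g'} hi => ?_⟩, ?_, ?_,
    fun i => ?_, hkreach, fun {i g'} hi ho => ?_, fun i => ?_⟩
  · rcases (hbit _ _).1 hi with ⟨rfl, rfl⟩ | ⟨-, hi⟩
    · exact hkV
    · exact h.alloc.valued hi
  · rcases (hbit _ _).1 hi with ⟨rfl, rfl⟩ | ⟨hi', hi''⟩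
    · rcases (hbit _ _).1 hj with ⟨rfl, -⟩ | ⟨hj', hj⟩
      · rfl
      · exact absurd ⟨h.alloc.unique hj hcg, rfl⟩ hj'
    · rcases (hbit _ _).1 hj with ⟨rfl, rfl⟩ | ⟨hj', hj''⟩
      · exact absurd ⟨h.alloc.unique hi'' hcg, rfl⟩ hi'
      · exact h.alloc.unique hi'' hj''
  · obtain ⟨j, hj⟩ := h.alloc.covered hi
    by_cases hj' : j = c ∧ g' = g
    · exact ⟨k, (hbit _ _).2 (.inl ⟨rfl, hj'.2⟩)⟩
    · exact ⟨j, (hbit _ _).2 (.inr ⟨hj', hj⟩)⟩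
  · rw [← h.give]
    funext i g'
    simp [Mem.transfer, Mem.bit_set]
  · rw [← h.recv]
    funext i g'
    simp [Mem.transfer, Mem.bit_set]
  · have := h.cur i
    simp only [Mem.transfer, Mem.bit_set, reduceCtorEq, false_and, if_false, true_and, and_true]
    by_cases hi : i = k
    · simp [hi]
    · by_cases hi' : i = c
      · simp [hi', hck]
      · simp [hi, hi', this]
  · refine (hbit _ _).2 (.inr ⟨?_, h.own (hi.trans hrk.le) ho⟩)
    rintro ⟨rfl, -⟩
    omega
  · have h₁ := h.load i
    have h₂ := load_set_false hcg hkg.2 i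
    have h₃ := load_set_true (μ := μ.set .own c g false) (i := k) (g := g)
      (by simp [Mem.bit_set, hko]) hkg.2 i
    rw [howns, h₃]
    omega

/-- The rank of the current agent is below `n` and drops in every round until the target is reached,
so `n` rounds are enough. -/
theorem walk_spec {V : ℕ → ℕ → Bool} {rk : ℕ → ℕ} {μ₀ μ : Mem} {s t : ℕ}
    (h : Walk n m V rk μ₀ s s μ) (h₀ : Search n V t rk μ₀) {ρ : Var → ℕ} (hρ : Env n m ρ) :
    Walk n m V rk μ₀ s t (walk.denote n m ρ μ) := by
  have hn : ∀ {c ν}, Walk n m V rk μ₀ s c ν → c < n ∧ rk c < n := by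
    intro c ν hc
    refine ⟨(hc.ready.bounded.lt ((hc.cur c).2 rfl)).1, (h₀.rk_lt hc.reach).trans_le ?_⟩
    simpa [reached] using Finset.card_filter_le (Finset.range n)
      fun i => μ₀.bit .reach i 0 = true
  have hround := Prog.for_inv (n := n) (m := m) (x := .inl .round)
    (p := .for_ (.inl .source) walkStep) (ρ := ρ) (μ := μ)
    (fun d ν => ∃ c, Walk n m V rk μ₀ s c ν ∧ (c = t ∨ rk c + d < n)) ⟨s, h, .inr (hn h).2⟩ ?_
  · obtain ⟨c, hc, rfl | hlt⟩ := hround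
    · exact hc
    · simp only [dim] at hlt
      omega
  rintro d hd ν ⟨c, hc, hct⟩
  -- Within a round the agents are visited in increasing order. While the turn is still with `c`,
  -- the bound `j ≤ c` says that the visit to `c` is yet to come.
  have hsource := Prog.for_inv (n := n) (m := m) (x := .inl .source)
    (p := walkStep) (ρ := update ρ (.inl .round) d) (μ := ν)
    (fun j ν => ∃ c', Walk n m V rk μ₀ s c' ν ∧
      ((c' = c ∧ j ≤ c) ∨ c' = t ∨ rk c' + (d + 1) < n)) ⟨c, hc, .inl ⟨rfl, Nat.zero_le c⟩⟩ ?_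
  · obtain ⟨c', hc', ⟨rfl, hle⟩ | h'⟩ := hsource
    · have := (hn hc').1
      simp only [dim] at hle
      omega
    · exact ⟨c', hc', h'⟩
  rintro j hj ν' ⟨c', hc', h'⟩
  have hρ' := (hρ.update (x := .inl .round) (by simp) hd).update (x := .inl .source) (by simp) hj
  rcases hc'.step h₀ hρ' with ⟨e, e'⟩ | ⟨-, hct', k, hk, e'⟩
  · rw [e]
    refine ⟨c', hc', ?_⟩
    rw [update_self] at e'
    rcases h' with ⟨rfl, hle⟩ | h'
    · rcases hle.eq_or_lt with hj | hj
      · exact .inr (.inl (e' hj))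
      · exact .inl ⟨rfl, hj⟩
    · exact .inr h'
  · refine ⟨k, e', ?_⟩
    rcases h' with ⟨rfl, hle⟩ | h' | h'
    · rcases hct with hct | hct
      · exact absurd hct hct'
      · exact .inr (.inr (by omega))
    · exact absurd h' hct'
    · exact .inr (.inr (by omega))

end MatrixProgram

/-! ### Local search and its termination by a quadratic potential -/

namespace MatrixProgram

open Function

variable {n m : ℕ}

/-- No chain of transfers to the agent `t` starts at an agent that owns at least two goods
more. -/
def NoImprovement (m : ℕ) (V own : ℕ → ℕ → Bool) (t : ℕ) : Prop :=
  ∃ R : ℕ → Prop, R t ∧ (∀ i k g, R k → V k g = true → own i g = true → R i) ∧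
    ∀ s, R s → load m own s ≤ load m own t + 1

/-- The potential of an allocation, which decreases when a good is transferred along a chain. -/
def potential (n m : ℕ) (own : ℕ → ℕ → Bool) : ℕ := ∑ i ∈ Finset.range n, load m own i ^ 2

/-- Searches for a chain of transfers to the target and executes it. -/
def search : Prog :=
  .seq resetSearch (.seq grow (.seq cands (.seq (pick .header .cand .cur) walk)))

/-- Induction on the rank along the recorded chain: closed sets containing the target contain
everything the search has reached. Hence a candidate found by the search refutes every certificate
of `NoImprovement`. -/
theorem Search.reach_of_closed {V : ℕ → ℕ → Bool} {t : ℕ} {rk : ℕ → ℕ} {μ : Mem}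
    (h : Search n V t rk μ) {R : ℕ → Prop} (ht : R t)
    (hR : ∀ i k g, R k → V k g = true → μ.bit .own i g = true → R i) {s : ℕ}
    (hs : μ.bit .reach s 0 = true) : R s := by
  induction hr : rk s using Nat.strong_induction_on generalizing s with
  | _ r ih =>
    subst hr
    by_cases hst : s = t
    · rwa [hst]
    · obtain ⟨g, hg⟩ := h.total hs hst
      obtain ⟨hown, -, -, k, -, hV, hk, hlt⟩ := h.give hg
      exact hR s k g (ih _ hlt hk rfl) hV hown

/-- If `a` and `b` are the loads of source and target, then `(a - 1) ^ 2 + (b + 1) ^ 2 = a ^ 2 + b ^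
2 - 2 * (a - b - 1)`, where `a - b - 1 ≥ 1`. Intermediate agents of the chain keep their loads. -/
theorem potential_add_two_le {own own' : ℕ → ℕ → Bool} {s t : ℕ} (hs : s < n) (ht : t < n)
    (hlt : load m own t + 1 < load m own s)
    (h : ∀ i, load m own' i + (if i = s then 1 else 0) =
      load m own i + if i = t then 1 else 0) :
    potential n m own' + 2 ≤ potential n m own := by
  have hst : s ≠ t := by
    rintro rfl
    omega
  have hsum : ∑ i ∈ Finset.range n,
      (load m own' i ^ 2 + if i = s then 2 * load m own s - 1 else 0) =
      ∑ i ∈ Finset.range n, (load m own i ^ 2 + if i = t then 2 * load m own t + 1 else 0) := by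
    refine Finset.sum_congr rfl fun i _ => ?_
    have hi := h i
    by_cases his : i = s
    · subst his
      simp only [if_true, hst, if_false] at hi ⊢
      have e : 2 * load m own i - 1 = 2 * load m own' i + 1 := by omega
      rw [e, Nat.add_zero, ← show _ = load m own i from hi]
      ring
    · by_cases hit : i = t
      · subst hit
        simp only [his, if_true, if_false] at hi ⊢
        rw [Nat.add_zero] at hi
        rw [hi]
        ring
      · simp only [his, hit, if_false] at hi ⊢
        rw [Nat.add_zero, Nat.add_zero] at hi
        rw [hi]
  rw [Finset.sum_add_distrib, Finset.sum_add_distrib, Finset.sum_ite_eq', Finset.sum_ite_eq',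
    if_pos (Finset.mem_range.2 hs), if_pos (Finset.mem_range.2 ht)] at hsum
  simp only [potential]
  omega

theorem search_spec {V : ℕ → ℕ → Bool} {μ : Mem} (h : Ready n m V μ)
    (ha : IsAlloc V (μ.bit .own)) {ρ : Var → ℕ} (hρ : Env n m ρ) :
    Ready n m V (search.denote n m ρ μ) ∧ IsAlloc V ((search.denote n m ρ μ).bit .own) ∧
      ((search.denote n m ρ μ).bit .own = μ.bit .own ∧
          NoImprovement m V (μ.bit .own) (ρ (.inl .target)) ∨
        potential n m ((search.denote n m ρ μ).bit .own) + 2 ≤ potential n m (μ.bit .own) ∧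
          ¬ NoImprovement m V (μ.bit .own) (ρ (.inl .target))) := by
  obtain ⟨hsearch, hcur⟩ := resetSearch_spec h hρ
  have h₁ := h.denote (p := resetSearch)
    (by simp [resetSearch, clearFld, clearCol, Prog.Keeps])
    (by simp [resetSearch, clearFld, clearCol, Prog.KeepsCtr])
    (by simp [resetSearch, clearFld, clearCol, Prog.NoHeader]) hρ
  have hown₁ : (resetSearch.denote n m ρ μ).bit .own = μ.bit .own :=
    Prog.denote_bit_of_keeps _ (by simp [resetSearch, clearFld, clearCol, Prog.Keeps]) _ _
  rw [search, Prog.denote]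
  generalize resetSearch.denote n m ρ μ = μ₁ at *
  obtain ⟨hclosed, rk, hsearch⟩ := grow_spec h₁ (hown₁ ▸ ha) hsearch hρ
  have h₂ := h₁.denote (p := grow) (by simp [grow, growSweep, growStep, Prog.Keeps])
    (by simp [grow, growSweep, growStep, Prog.KeepsCtr])
    (by simp [grow, growSweep, growStep, Prog.NoHeader]) hρ
  have hown₂ : (grow.denote n m ρ μ₁).bit .own = μ.bit .own :=
    (Prog.denote_bit_of_keeps _ (by simp [grow, growSweep, growStep, Prog.Keeps]) _ _).trans hown₁
  have hcur₂ : ∀ i g, (grow.denote n m ρ μ₁).bit .cur i g = false := by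
    rwa [Prog.denote_bit_of_keeps _ (by simp [grow, growSweep, growStep, Prog.Keeps])]
  rw [Prog.denote]
  generalize grow.denote n m ρ μ₁ = μ₂ at *
  obtain ⟨h₃, hcand⟩ := cands_spec h₂ hρ
  have keeps₃ : ∀ f, f ≠ .cand → (cands.denote n m ρ μ₂).bit f = μ₂.bit f := fun f hf =>
    Prog.denote_bit_of_keeps _ (by simp [cands, candStep, countDiff, clearCtr, Prog.Keeps, hf]) _ _
  rw [Prog.denote]
  generalize cands.denote n m ρ μ₂ = μ₃ at *
  have h₄ := h₃.denote (p := pick .header .cand .cur) (by simp [pick, clearCol, Prog.Keeps])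
    (by simp [pick, clearCol, Prog.KeepsCtr]) (by simp [pick, clearCol, Prog.NoHeader]) hρ
  have keeps₄ : ∀ f, f ≠ .cand → f ≠ .cur →
      ((pick .header .cand .cur).denote n m ρ μ₃).bit f = μ₂.bit f := fun f hf hf' =>
    (Prog.denote_bit_of_keeps _ (by simp [pick, clearCol, Prog.Keeps, hf']) _ _).trans (keeps₃ f hf)
  have hpick := pick_spec (n := n) (m := m) .header (show Fld.cand ≠ .cur by simp) ρ μ₃
  rw [Prog.denote]
  generalize (pick .header .cand .cur).denote n m ρ μ₃ = μ₄ at *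
  rw [hρ.header] at hpick
  rcases hpick with ⟨hno, rfl⟩ | ⟨s, hs, hsc, hpick, -⟩
  -- Without a candidate nobody is current, so the walk is idle, and the set of reached agents
  -- certifies that no improvement exists.
  · have hwalk : walk.denote n m ρ μ₄ = μ₄ := by
      refine Prog.for_inv (fun _ ν => ν = μ₄) rfl fun d hd ν hν => ?_
      subst hν
      refine Prog.for_inv (fun _ ν' => ν' = ν) rfl fun i hi ν' hν' => ?_
      subst hν'
      rw [walkStep, Prog.denote, keeps₃ _ (by simp), hcur₂]
      rfl
    rw [hwalk, keeps₃ _ (by simp), hown₂]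
    refine ⟨h₃, ha, .inl ⟨rfl, fun i => μ₂.bit .reach i 0 = true, hsearch.target,
      fun i k g hk hV hown => hclosed (hown₂ ▸ hown) hV hk, fun s hs => ?_⟩⟩
    have hs' := (h₂.bounded.lt hs).1
    have := hcand s hs'
    rw [hno s hs', hown₂] at this
    by_contra hlt
    exact of_decide_eq_false this.symm ⟨hs, not_le.1 hlt⟩
  · have hc := hcand s hs
    rw [hsc] at hc
    obtain ⟨hreach, hlt⟩ := of_decide_eq_true hc.symm
    have hw : Walk n m V rk μ₂ s s μ₄ := by
      refine ⟨h₄, ?_, keeps₄ _ (by simp) (by simp), keeps₄ _ (by simp) (by simp), fun i => ?_,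
        hreach, fun _ hi => ?_, fun i => ?_⟩
      · rwa [keeps₄ _ (by simp) (by simp), hown₂]
      · constructor
        · intro hi
          rw [hpick i (h₄.bounded.lt hi).1] at hi
          exact of_decide_eq_true hi
        · rintro rfl
          rw [hpick i hs]
          exact decide_eq_true rfl
      · rwa [keeps₄ _ (by simp) (by simp)]
      · rw [keeps₄ _ (by simp) (by simp)]
    have hw' := walk_spec hw hsearch hρ
    rw [hown₂] at hlt
    have hload := hw'.load
    rw [hown₂] at hload
    refine ⟨hw'.ready, hw'.alloc, .inr ⟨potential_add_two_le hs (hρ.lt (.inl .target)) hlt hload,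
      ?_⟩⟩
    rintro ⟨R, hRt, hR, hRle⟩
    have := hRle s (hsearch.reach_of_closed hRt (by rwa [hown₂]) hreach)
    omega

/-- Searches for chains of transfers to all targets. -/
def improve : Prog := .for_ (.inl .target) search

theorem improve_spec {V : ℕ → ℕ → Bool} {μ : Mem} (h : Ready n m V μ)
    (ha : IsAlloc V (μ.bit .own)) {ρ : Var → ℕ} (hρ : Env n m ρ) :
    Ready n m V (improve.denote n m ρ μ) ∧ IsAlloc V ((improve.denote n m ρ μ).bit .own) ∧
      ((improve.denote n m ρ μ).bit .own = μ.bit .own ∧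
          (∀ t < n, NoImprovement m V (μ.bit .own) t) ∨
        potential n m ((improve.denote n m ρ μ).bit .own) + 2 ≤ potential n m (μ.bit .own) ∧
          ∃ t < n, ¬ NoImprovement m V (μ.bit .own) t) := by
  refine Prog.for_inv (n := n) (m := m) (x := .inl .target) (fun j ν => Ready n m V ν ∧
    IsAlloc V (ν.bit .own) ∧ (ν.bit .own = μ.bit .own ∧
      (∀ t < j, NoImprovement m V (μ.bit .own) t) ∨
        potential n m (ν.bit .own) + 2 ≤ potential n m (μ.bit .own) ∧
          ∃ t < n, ¬ NoImprovement m V (μ.bit .own) t))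
    ⟨h, ha, .inl ⟨rfl, fun t ht => absurd ht (Nat.not_lt_zero t)⟩⟩ ?_
  rintro j hj ν ⟨h₁, h₂, h₃⟩
  have hs := search_spec h₁ h₂ (hρ.update (x := .inl .target) (by simp) hj)
  rw [update_self] at hs
  refine ⟨hs.1, hs.2.1, ?_⟩
  rcases h₃ with ⟨e, h₃⟩ | ⟨h₃, h₄⟩
  · rw [e] at hs
    rcases hs.2.2 with ⟨h₅, h₆⟩ | ⟨h₅, h₆⟩
    · refine .inl ⟨h₅, fun t ht => ?_⟩
      rcases Nat.lt_succ_iff_lt_or_eq.1 ht with ht | rfl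
      · exact h₃ t ht
      · exact h₆
    · exact .inr ⟨h₅, j, hj, h₆⟩
  · refine .inr ⟨?_, h₄⟩
    rcases hs.2.2 with ⟨h₅, -⟩ | ⟨h₅, -⟩
    · rwa [h₅]
    · omega

/-- Bundles are disjoint, so the loads sum to at most `m + 1`, and one factor of each square is at
most `m + 1` as well. -/
theorem potential_le {V own : ℕ → ℕ → Bool} (h : IsAlloc V own) :
    potential n m own ≤ (m + 1) * (m + 1) := by
  have hsum : ∑ i ∈ Finset.range n, load m own i ≤ m + 1 := by
    have hd : Set.PairwiseDisjoint (Finset.range n : Set ℕ)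
        fun i => (Finset.range (m + 1)).filter fun g => own i g = true := by
      intro i _ j _ hij
      refine Finset.disjoint_left.2 fun g hi hj => hij ?_
      exact h.unique (Finset.mem_filter.1 hi).2 (Finset.mem_filter.1 hj).2
    calc ∑ i ∈ Finset.range n, load m own i = _ := (Finset.card_biUnion hd).symm
      _ ≤ (Finset.range (m + 1)).card := Finset.card_le_card
          (Finset.biUnion_subset.2 fun i _ => Finset.filter_subset _ _)
      _ = m + 1 := Finset.card_range _
  calc potential n m own ≤ ∑ i ∈ Finset.range n, (m + 1) * load m own i :=
        Finset.sum_le_sum fun i _ => by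
          rw [sq]
          exact Nat.mul_le_mul_right _ (load_le own i)
    _ = (m + 1) * ∑ i ∈ Finset.range n, load m own i := (Finset.mul_sum _ _ _).symm
    _ ≤ _ := Nat.mul_le_mul_left _ hsum

/-- Improves the allocation until it cannot be improved any more. -/
def improveAll : Prog := .for_ (.inr .outer) (.for_ (.inr .inner) improve)

/-- As long as improvements remain, `c` passes have lowered the potential by at least `2 * c`. The
two nested column loops provide `(m + 1) ^ 2` passes, more than the potential allows. -/
theorem improveAll_spec {V : ℕ → ℕ → Bool} {μ : Mem} (h : Ready n m V μ)
    (ha : IsAlloc V (μ.bit .own)) {ρ : Var → ℕ} (hρ : Env n m ρ) :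
    Ready n m V (improveAll.denote n m ρ μ) ∧
      IsAlloc V ((improveAll.denote n m ρ μ).bit .own) ∧
      ∀ t < n, NoImprovement m V ((improveAll.denote n m ρ μ).bit .own) t := by
  let P (c : ℕ) (ν : Mem) : Prop := Ready n m V ν ∧ IsAlloc V (ν.bit .own) ∧
    ((∀ t < n, NoImprovement m V (ν.bit .own) t) ∨
      potential n m (ν.bit .own) + 2 * c ≤ (m + 1) * (m + 1))
  have step : ∀ {ρ} (_ : Env n m ρ) c ν, P c ν → P (c + 1) (improve.denote n m ρ ν) := by
    rintro ρ hρ c ν ⟨h₁, h₂, h₃⟩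
    obtain ⟨h₄, h₅, h₆⟩ := improve_spec h₁ h₂ hρ
    refine ⟨h₄, h₅, ?_⟩
    rcases h₆ with ⟨e, h₆⟩ | ⟨h₆, t, ht, hn⟩
    · left
      rwa [e]
    · rcases h₃ with h₃ | h₃
      · exact absurd (h₃ t ht) hn
      · right
        omega
  have hP : P ((m + 1) * (m + 1)) (improveAll.denote n m ρ μ) := by
    refine Prog.for_inv (n := n) (m := m) (x := .inr .outer)
      (fun j ν => P (j * (m + 1)) ν) ⟨h, ha, .inr ?_⟩ fun j hj ν hν => ?_
    · simpa using potential_le ha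
    · rw [Nat.succ_mul]
      exact Prog.for_inv (n := n) (m := m) (x := .inr .inner)
        (fun j' ν => P (j * (m + 1) + j') ν) hν fun j' hj' ν hν =>
          step ((hρ.update (by simp) hj).update (by simp) hj') _ _ hν
  refine ⟨hP.1, hP.2.1, hP.2.2.resolve_right fun hle => ?_⟩
  have : 0 < (m + 1) * (m + 1) := by positivity
  omega

end MatrixProgram

/-! ### Assigning the goods that nobody values; the complete algorithm -/

namespace MatrixProgram

open Function

variable {n m : ℕ}

/-- Compares the loads of two agents. -/
def compareLoads : Prog :=
  .seq (countDiff .source .dest) (.seq (.pos (.set .source .header .cand false) .skip) clearCtr)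

/-- Finds the agents that own the least number of goods. -/
def leastLoad : Prog :=
  .for_ (.inl .source) (.seq (.set .source .header .cand true) (.for_ (.inl .dest) compareLoads))

theorem denote_compareLoads {ρ : Var → ℕ} (hρ : Env n m ρ) {μ : Mem} (h : μ.ctr = 0) :
    compareLoads.denote n m ρ μ = if load m (μ.bit .own) (ρ (.inl .source)) ≤
      load m (μ.bit .own) (ρ (.inl .dest)) then μ else μ.set .cand (ρ (.inl .source)) 0 false := by
  have hle := load_le (m := m) (μ.bit .own) (ρ (.inl .source))
  simp only [compareLoads, Prog.denote, denote_countDiff, h, hρ.header, zero_add]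
  by_cases hl : load m (μ.bit .own) (ρ (.inl .source)) ≤ load m (μ.bit .own) (ρ (.inl .dest))
  · rw [if_pos hl, if_neg (by omega), denote_clearCtr _ (by dsimp only; omega)]
    ext f i g
    · rfl
    · exact h.symm
  · rw [if_neg hl, if_pos (by omega), denote_clearCtr _ (by simp only [Mem.set]; omega)]
    ext f i g
    · rfl
    · exact h.symm

theorem leastLoad_spec {V : ℕ → ℕ → Bool} {μ : Mem} (h : Ready n m V μ) {ρ : Var → ℕ}
    (hρ : Env n m ρ) :
    Ready n m V (leastLoad.denote n m ρ μ) ∧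
      ∀ i < n, ((leastLoad.denote n m ρ μ).bit .cand i 0 = true ↔
        ∀ k < n, load m (μ.bit .own) i ≤ load m (μ.bit .own) k) := by
  have := Prog.for_inv (n := n) (m := m) (x := .inl .source) (ρ := ρ) (μ := μ)
    (p := .seq (.set .source .header .cand true) (.for_ (.inl .dest) compareLoads))
    (fun j ν => ν.ctr = 0 ∧ ν.bit .own = μ.bit .own ∧ ∀ i < j, (ν.bit .cand i 0 = true ↔
        ∀ k < n, load m (μ.bit .own) i ≤ load m (μ.bit .own) k))
    ⟨h.ctr, rfl, fun i hi => absurd hi (Nat.not_lt_zero i)⟩ ?_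
  · refine ⟨⟨?_, this.1, ?_⟩, this.2.2⟩
    · exact (Prog.denote_bit_of_keeps _
        (by simp [leastLoad, compareLoads, countDiff, clearCtr, Prog.Keeps]) _ _).trans h.val
    · exact Prog.bounded_denote _
        (by simp [leastLoad, compareLoads, countDiff, clearCtr, Prog.NoHeader]) hρ h.bounded
  · rintro i hi ν ⟨h₁, h₂, h₃⟩
    have hρ' := hρ.update (x := .inl .source) (by simp) hi
    have := Prog.for_inv (n := n) (m := m) (x := .inl .dest) (p := compareLoads)
      (ρ := update ρ (.inl .source) i) (μ := ν.set .cand i 0 true)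
      (fun j ν' => ν'.ctr = 0 ∧ ν'.bit .own = μ.bit .own ∧
        (∀ i' < i, ν'.bit .cand i' 0 = ν.bit .cand i' 0) ∧ (ν'.bit .cand i 0 = true ↔
        ∀ k < j, load m (μ.bit .own) i ≤ load m (μ.bit .own) k)) ?_ ?_
    · rw [Prog.denote, Prog.denote, hρ'.header, update_self]
      refine ⟨this.1, this.2.1, fun i' hi' => ?_⟩
      rcases Nat.lt_succ_iff_lt_or_eq.1 hi' with hi' | rfl
      · rw [this.2.2.1 i' hi', h₃ i' hi']
      · exact this.2.2.2
    · refine ⟨h₁, ?_, fun i' hi' => ?_, ?_⟩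
      · rw [← h₂]
        funext i' g
        simp [Mem.bit_set]
      · simp [Mem.bit_set, hi'.ne]
      · simp [Mem.bit_set]
    · rintro k hk ν' ⟨h₄, h₅, h₆, h₇⟩
      rw [denote_compareLoads (hρ'.update (by simp) hk) h₄]
      simp only [update_self, ne_eq, reduceCtorEq, not_false_eq_true, update_of_ne, Sum.inl.injEq,
        h₅]
      split_ifs with hl
      · refine ⟨h₄, h₅, h₆, h₇.trans ⟨fun h k' hk' => ?_, fun h k' hk' => h k' (by omega)⟩⟩
        rcases Nat.lt_succ_iff_lt_or_eq.1 hk' with hk' | rfl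
        · exact h k' hk'
        · exact hl
      · refine ⟨h₄, ?_, fun i' hi' => ?_, ?_⟩
        · rw [← h₅]
          funext i' g
          simp [Mem.bit_set]
        · simp [Mem.bit_set, hi'.ne, h₆ i' hi']
        · simp only [Mem.bit_set, and_self, if_true, Bool.false_eq_true, false_iff, not_forall]
          exact ⟨k, Nat.lt_succ_self k, hl⟩

/-- Gives a good to an agent if no agent values it. -/
def giveIfZero : Prog :=
  .seq (.set .source .good .give true)
    (.seq (.for_ (.inl .dest) (.test .dest .good .val (.set .source .good .give false) .skip))
      (.test .source .good .give (.set .source .good .own true) .skip))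

/-- Gives all goods that no agent values to the agent selected. -/
def giveZeros : Prog :=
  .for_ (.inl .source) (.test .source .header .cur (.for_ (.inr .good) giveIfZero) .skip)

/-- The field `give` serves as a scratch bit that survives exactly if no agent values the good. -/
theorem bit_giveIfZero (ρ : Var → ℕ) (μ : Mem) (i g : ℕ) :
    (giveIfZero.denote n m ρ μ).bit .own i g = true ↔ μ.bit .own i g = true ∨
      i = ρ (.inl .source) ∧ g = ρ (.inr .good) ∧ ∀ k < n, μ.bit .val k g = false := by
  rw [giveIfZero, Prog.denote, Prog.denote, Prog.denote]
  have h := Prog.for_inv (n := n) (m := m) (x := .inl .dest) (ρ := ρ)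
    (p := .test .dest .good .val (.set .source .good .give false) .skip)
    (μ := μ.set .give (ρ (.inl .source)) (ρ (.inr .good)) true)
    (fun j ν => ν.bit .val = μ.bit .val ∧ ν.bit .own = μ.bit .own ∧
      (ν.bit .give (ρ (.inl .source)) (ρ (.inr .good)) = true ↔
        ∀ k < j, μ.bit .val k (ρ (.inr .good)) = false)) ?_ ?_
  · generalize (Prog.for_ (.inl .dest) (.test .dest .good .val
      (.set .source .good .give false) .skip)).denote n m ρ
        (μ.set .give (ρ (.inl .source)) (ρ (.inr .good)) true) = ν at h
    rw [Prog.denote, Prog.denote, Prog.denote]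
    obtain ⟨-, h₂, h₃⟩ := h
    simp only [dim] at h₃
    by_cases hg : ν.bit .give (ρ (.inl .source)) (ρ (.inr .good)) = true
    · rw [if_pos hg, Mem.bit_set, h₂]
      have h₃ := h₃.1 hg
      by_cases hi : i = ρ (.inl .source) ∧ g = ρ (.inr .good)
      · rw [if_pos ⟨rfl, hi⟩]
        simpa [hi] using .inr h₃
      · rw [if_neg fun h => hi h.2]
        tauto
    · rw [if_neg hg, h₂]
      refine (or_iff_left ?_).symm
      rintro ⟨rfl, rfl, h⟩
      exact hg (h₃.2 h)
  · refine ⟨?_, ?_, ?_⟩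
    · funext i g
      simp [Mem.bit_set]
    · funext i g
      simp [Mem.bit_set]
    · simp [Mem.bit_set]
  · rintro k hk ν ⟨h₁, h₂, h₃⟩
    simp only [Prog.denote, update_self, ne_eq, reduceCtorEq, not_false_eq_true, update_of_ne,
      Sum.inl.injEq, h₁]
    split_ifs with hv
    · refine ⟨?_, ?_, ?_⟩
      · rw [← h₁]
        funext i g
        simp [Mem.bit_set]
      · rw [← h₂]
        funext i g
        simp [Mem.bit_set]
      · simp only [Mem.bit_set, and_self, if_true, Bool.false_eq_true, false_iff, not_forall]
        exact ⟨k, Nat.lt_succ_self k, by simp [hv]⟩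
    · refine ⟨h₁, h₂, h₃.trans ⟨fun h k' hk' => ?_, fun h k' hk' => h k' (by omega)⟩⟩
      rcases Nat.lt_succ_iff_lt_or_eq.1 hk' with hk' | rfl
      · exact h k' hk'
      · exact Bool.eq_false_iff.2 hv

/-- Column `0` may be handed out along with the zero goods; this is harmless because the output uses
only the columns from `1` on. -/
theorem bit_giveZeros {ρ : Var → ℕ} (hρ : Env n m ρ) {μ : Mem} {l : ℕ} (hl : l < n)
    (hcur : ∀ i < n, μ.bit .cur i 0 = decide (i = l)) (i g : ℕ) :
    (giveZeros.denote n m ρ μ).bit .own i g = true ↔ μ.bit .own i g = true ∨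
      i = l ∧ g < m + 1 ∧ ∀ k < n, μ.bit .val k g = false := by
  have keeps : ∀ f, f = .val ∨ f = .cur → ∀ (ρ : Var → ℕ) ν,
      (giveIfZero.denote n m ρ ν).bit f = ν.bit f := by
    intro f hf ρ ν
    exact Prog.denote_bit_of_keeps _ (by rcases hf with rfl | rfl <;> simp [giveIfZero, Prog.Keeps])
      _ _
  have h := (Prog.for_inv (n := n) (m := m) (x := .inl .source) (ρ := ρ) (μ := μ)
    (p := .test .source .header .cur (.for_ (.inr .good) giveIfZero) .skip)
    (fun j ν => ν.bit .val = μ.bit .val ∧ ν.bit .cur = μ.bit .cur ∧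
      (ν.bit .own i g = true ↔ μ.bit .own i g = true ∨
        l < j ∧ i = l ∧ g < m + 1 ∧ ∀ k < n, μ.bit .val k g = false)) ⟨rfl, rfl, by simp⟩ ?_).2.2
  · rw [show dim n m (.inl .source) = n from rfl] at h
    simpa [hl, giveZeros] using h
  rintro j hj ν ⟨h₁, h₂, h₃⟩
  rw [Prog.denote, (hρ.update (x := .inl .source) (by simp) hj).header, update_self, h₂,
    hcur j hj]
  by_cases hjl : j = l
  · subst hjl
    simp only [decide_true, if_true]
    have := Prog.for_inv (n := n) (m := m) (x := .inr .good) (ρ := update ρ (.inl .source) j)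
      (μ := ν) (p := giveIfZero)
      (fun c ν' => ν'.bit .val = μ.bit .val ∧ ν'.bit .cur = μ.bit .cur ∧
        (ν'.bit .own i g = true ↔ μ.bit .own i g = true ∨
          i = j ∧ g < c ∧ ∀ k < n, μ.bit .val k g = false))
      ⟨h₁, h₂, by simpa using h₃⟩ ?_
    · refine ⟨this.1, this.2.1, this.2.2.trans ?_⟩
      simp [dim]
    · rintro c hc ν' ⟨h₄, h₅, h₆⟩
      refine ⟨(keeps _ (by simp) _ _).trans h₄, (keeps _ (by simp) _ _).trans h₅, ?_⟩
      rw [bit_giveIfZero, h₆, h₄]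
      simp only [update_self, ne_eq, reduceCtorEq, not_false_eq_true, update_of_ne,
        Nat.lt_succ_iff_lt_or_eq]
      tauto
  · simp only [hjl, decide_false, Bool.false_eq_true, if_false, Prog.denote]
    refine ⟨h₁, h₂, h₃.trans ?_⟩
    rw [show l < j + 1 ↔ l < j by omega]

/-- Gives all goods that no agent values to an agent that owns the least number of goods. -/
def finish : Prog := .seq leastLoad (.seq (pick .header .cand .cur) giveZeros)

theorem finish_spec (hn : 0 < n) {V : ℕ → ℕ → Bool} {μ : Mem} (h : Ready n m V μ) {ρ : Var → ℕ}
    (hρ : Env n m ρ) :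
    (finish.denote n m ρ μ).ctr = 0 ∧ ∃ l < n,
      (∀ k < n, load m (μ.bit .own) l ≤ load m (μ.bit .own) k) ∧
      ∀ i g, (finish.denote n m ρ μ).bit .own i g = true ↔ μ.bit .own i g = true ∨
        i = l ∧ g < m + 1 ∧ ∀ k < n, V k g = false := by
  obtain ⟨h₁, hcand⟩ := leastLoad_spec h hρ
  have hown₁ : (leastLoad.denote n m ρ μ).bit .own = μ.bit .own :=
    Prog.denote_bit_of_keeps _ (by simp [leastLoad, compareLoads, countDiff, clearCtr, Prog.Keeps])
      _ _
  rw [finish, Prog.denote, Prog.denote]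
  generalize leastLoad.denote n m ρ μ = μ₁ at *
  have h₂ := h₁.denote (p := pick .header .cand .cur) (by simp [pick, clearCol, Prog.Keeps])
    (by simp [pick, clearCol, Prog.KeepsCtr]) (by simp [pick, clearCol, Prog.NoHeader]) hρ
  have hown₂ : ((pick .header .cand .cur).denote n m ρ μ₁).bit .own = μ.bit .own :=
    (Prog.denote_bit_of_keeps _ (by simp [pick, clearCol, Prog.Keeps]) _ _).trans hown₁
  have hpick := pick_spec (n := n) (m := m) .header (show Fld.cand ≠ .cur by simp) ρ μ₁
  generalize (pick .header .cand .cur).denote n m ρ μ₁ = μ₂ at *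
  rw [hρ.header] at hpick
  refine ⟨(Prog.denote_ctr_of_keepsCtr _ (by simp [giveZeros, giveIfZero, Prog.KeepsCtr])
    _ _).trans h₂.ctr, ?_⟩
  rcases hpick with ⟨hno, -⟩ | ⟨l, hl, hlc, hcur, -⟩
  -- This case is impossible: as `0 < n`, some agent has the least load and is marked as a
  -- candidate.
  · obtain ⟨l, hl, hmin⟩ := Finset.exists_min_image (Finset.range n) (load m (μ.bit .own))
      ⟨0, Finset.mem_range.2 hn⟩
    have hl := Finset.mem_range.1 hl
    have := (hcand l hl).2 fun k hk => hmin k (Finset.mem_range.2 hk)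
    rw [hno l hl] at this
    exact absurd this Bool.false_ne_true
  · refine ⟨l, hl, (hcand l hl).1 hlc, fun i g => ?_⟩
    rw [bit_giveZeros hρ hl hcur, hown₂, h₂.val]

/-- The algorithm that computes a maximum Nash welfare allocation. -/
def maxNashWelfare : Prog := .seq initAlloc (.seq improveAll finish)

theorem maxNashWelfare_wf : maxNashWelfare.WF ∅ := by decide

theorem maxNashWelfare_spec (hn : 0 < n) {X : ℕ → ℕ → Bool}
    (hX : ∀ i g, n ≤ i ∨ m < g → X i g = false) :
    (maxNashWelfare.denote n m (fun _ => 0) (Mem.ofMatrix X)).ctr = 0 ∧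
      ∃ own, IsAlloc X own ∧ (∀ t < n, NoImprovement m X own t) ∧ ∃ l < n,
        (∀ k < n, load m own l ≤ load m own k) ∧
        ∀ i g, (maxNashWelfare.denote n m (fun _ => 0) (Mem.ofMatrix X)).bit .own i g = true ↔
          own i g = true ∨ i = l ∧ g < m + 1 ∧ ∀ k < n, X k g = false := by
  have hρ : Env n m fun _ => 0 := by
    refine ⟨fun x => ?_, rfl⟩
    rcases x with x | x
    · exact hn
    · exact Nat.succ_pos m
  have h : Ready n m X (Mem.ofMatrix X) := by
    refine ⟨?_, rfl, fun f i g hig => ?_⟩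
    · funext i g
      simp [Mem.ofMatrix]
    · simp [Mem.ofMatrix, hX i g hig]
  obtain ⟨h₁, ha₁⟩ := initAlloc_spec h (fun i g => by simp [Mem.ofMatrix]) hρ
  obtain ⟨h₂, ha₂, hno⟩ := improveAll_spec h₁ ha₁ hρ
  obtain ⟨h₃, l, hl, hmin, h₄⟩ := finish_spec hn h₂ hρ
  exact ⟨h₃, _, ha₂, hno, l, hl, hmin, h₄⟩

end MatrixProgram

/-! ### From matrices back to fair division instances, and the main theorem -/

namespace FairDivision

open MatrixProgram

open Classical in
/-- The matrix of values of a binary instance, with a header column of zeros. -/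
noncomputable def BinaryInstance.matrix (I : BinaryInstance) (i g : ℕ) : Bool :=
  decide (∃ (a : Fin I.n) (b : Fin I.m), i = a ∧ g = b + 1 ∧ I.v a b = 1)

theorem BinaryInstance.matrix_succ (I : BinaryInstance) (a : Fin I.n) (b : Fin I.m) :
    I.matrix a (b + 1) = true ↔ I.v a b = 1 := by
  rw [matrix, decide_eq_true_eq]
  constructor
  · rintro ⟨a', b', ha, hb, h⟩
    rwa [Fin.ext ha, Fin.ext (Nat.succ_injective hb)]
  · exact fun h => ⟨a, b, rfl, rfl, h⟩

theorem BinaryInstance.matrix_zero (I : BinaryInstance) (i : ℕ) : I.matrix i 0 = false := by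
  refine decide_eq_false ?_
  rintro ⟨-, b, -, hb, -⟩
  exact absurd hb.symm (Nat.succ_ne_zero _)

theorem BinaryInstance.matrix_eq_false (I : BinaryInstance) (i g : ℕ) (h : I.n ≤ i ∨ I.m < g) :
    I.matrix i g = false := by
  refine decide_eq_false ?_
  rintro ⟨a, b, rfl, rfl, -⟩
  have := a.2
  have := b.2
  omega

theorem BinaryInstance.encode_eq (I : BinaryInstance) :
    I.encode = encodeMatrix fun (i : Fin I.n) (g : Fin I.m) => I.matrix i (g + 1) := by
  rw [encode]
  congr
  funext i g
  rw [Bool.eq_iff_iff, decide_eq_true_eq, I.matrix_succ]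

/-- The bundles of an allocation that is given by a matrix with a header column. -/
def bundles {n m : ℕ} (own : ℕ → ℕ → Bool) (i : Fin n) : Finset (Fin m) :=
  {g | own i (g + 1) = true}

theorem card_bundles {n m : ℕ} {own : ℕ → ℕ → Bool} (h : ∀ i, own i 0 = false) (i : Fin n) :
    (bundles own i : Finset (Fin m)).card = load m own i := by
  rw [load, ← Finset.card_map ⟨fun g : Fin m => (g : ℕ) + 1,
    fun a b hab => Fin.ext (Nat.succ_injective hab)⟩]
  congr 1
  ext g
  simp only [bundles, Finset.mem_map, Finset.mem_filter, Finset.mem_univ, true_and,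
    Finset.mem_range]
  constructor
  · rintro ⟨b, hb, rfl⟩
    exact ⟨Nat.succ_lt_succ b.2, hb⟩
  · rintro ⟨hg, hown⟩
    cases g with
    | zero => simp [h] at hown
    | succ g => exact ⟨⟨g, by omega⟩, hown, rfl⟩

theorem BinaryInstance.pos_iff (I : BinaryInstance) (i : Fin I.n) (g : Fin I.m) :
    0 < I.v i g ↔ I.v i g = 1 := by
  rcases I.binary i g with h | h <;> simp [h]

theorem BinaryInstance.card_bundles (I : BinaryInstance) {own : ℕ → ℕ → Bool}
    (ha : IsAlloc I.matrix own) (i : Fin I.n) :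
    (bundles own i : Finset (Fin I.m)).card = load I.m own i := by
  refine FairDivision.card_bundles (fun i => ?_) i
  by_contra h
  have := ha.valued (Bool.not_eq_false _ ▸ h)
  simp [I.matrix_zero] at this

/-- The certificates of `NoImprovement` are predicates on all natural numbers; restricted to actual
agents, they become the closed sets required for balance. -/
theorem BinaryInstance.isBalanced (I : BinaryInstance) {own : ℕ → ℕ → Bool}
    (ha : IsAlloc I.matrix own) (hno : ∀ t < I.n, NoImprovement I.m I.matrix own t) :
    IsBalanced I.v (bundles own) := by
  have mem : ∀ {i : Fin I.n} {g : Fin I.m}, g ∈ bundles own i ↔ own i (g + 1) = true := by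
    simp [bundles]
  refine ⟨⟨fun i j hij => ?_, ?_⟩, fun i g hg => ?_, fun t => ?_⟩
  · refine Finset.disjoint_left.2 fun g hi hj => hij (Fin.ext ?_)
    exact ha.unique (mem.1 hi) (mem.1 hj)
  · ext g
    simp only [Finset.mem_biUnion, Finset.mem_univ, true_and, mem, positiveGoods,
      Finset.mem_filter, I.pos_iff]
    constructor
    · rintro ⟨i, hi⟩
      exact ⟨i, (I.matrix_succ i g).1 (ha.valued hi)⟩
    · rintro ⟨i, hi⟩
      obtain ⟨j, hj⟩ := ha.covered ((I.matrix_succ i g).2 hi)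
      have hjn : j < I.n := by
        by_contra hn
        have := ha.valued hj
        rw [I.matrix_eq_false j _ (.inl (not_lt.1 hn))] at this
        exact Bool.false_ne_true this
      exact ⟨⟨j, hjn⟩, hj⟩
  · exact (I.matrix_succ i g).1 (ha.valued (mem.1 hg))
  · obtain ⟨R, hRt, hR, hle⟩ := hno t t.2
    classical
    refine ⟨Finset.univ.filter fun i => R i, by simpa, fun i k g hk hv hg => ?_, fun s hs => ?_⟩
    · simp only [Finset.mem_filter, Finset.mem_univ, true_and] at hk ⊢
      exact hR i k (g + 1) hk ((I.matrix_succ k g).2 hv) (mem.1 hg)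
    · rw [I.card_bundles ha, I.card_bundles ha]
      exact hle s (by simpa using hs)

/-- The allocation that the algorithm computes. -/
noncomputable def BinaryInstance.allocation (I : BinaryInstance) : Fin I.n → Finset (Fin I.m) :=
  bundles ((maxNashWelfare.denote I.n I.m (fun _ => 0) (Mem.ofMatrix I.matrix)).bit .own)

theorem BinaryInstance.allocation_spec (I : BinaryInstance) :
    IsAllocation I.allocation ∧ IsMNW I.v I.allocation ∧ IsEFX0 I.v I.allocation := by
  obtain ⟨-, own, ha, hno, l, hl, hmin, h⟩ := maxNashWelfare_spec I.n_pos I.matrix_eq_false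
  have hb := I.isBalanced ha hno
  -- The output is the balanced allocation with the zero goods added to the bundle of the agent `l`
  -- of least load, which is the form treated by `IsBalanced.spec`.
  have e : I.allocation = Function.update (bundles own) ⟨l, hl⟩
      (bundles own ⟨l, hl⟩ ∪ zeroGoods I.v) := by
    funext i
    ext g
    have hz : (∀ k < I.n, I.matrix k (g + 1) = false) ↔ g ∈ zeroGoods I.v := by
      simp only [zeroGoods, Finset.mem_filter, Finset.mem_univ, true_and]
      constructor
      · intro hk k
        refine (I.binary k g).resolve_right fun hv => ?_
        rw [← I.matrix_succ, hk k k.2] at hv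
        exact Bool.false_ne_true hv
      · intro hk k hkn
        rw [← Bool.not_eq_true]
        intro hv
        rw [I.matrix_succ ⟨k, hkn⟩ g, hk] at hv
        exact zero_ne_one hv
    simp only [allocation, bundles, Finset.mem_filter, Finset.mem_univ, true_and, h, hz]
    have hg : (g : ℕ) + 1 < I.m + 1 := by omega
    by_cases hi : i = ⟨l, hl⟩
    · subst hi
      simp [hg]
    · rw [Function.update_of_ne hi]
      have hil : (i : ℕ) ≠ l := fun h => hi (Fin.ext h)
      simp [hil, bundles]
  rw [e]
  exact hb.spec I.binary fun j => by
    rw [I.card_bundles ha, I.card_bundles ha]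
    exact hmin j j.2

end FairDivision

theorem theorem3 :
    ∃ A : (I : FairDivision.BinaryInstance) → Fin I.n → Finset (Fin I.m),
      (∀ I : FairDivision.BinaryInstance,
        FairDivision.IsAllocation (A I) ∧
        FairDivision.IsMNW I.v (A I) ∧
        FairDivision.IsEFX0 I.v (A I)) ∧
      Nonempty (Turing.TM2ComputableInPolyTime
        FairDivision.BinaryInstance.encode
        (id : List (Option Bool) → List (Option Bool))
        (fun I => FairDivision.encodeAllocation (A I))) := by
  refine ⟨FairDivision.BinaryInstance.allocation,
    FairDivision.BinaryInstance.allocation_spec, ?_⟩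
  have h := MatrixProgram.maxNashWelfare.computableInPolyTime MatrixProgram.maxNashWelfare_wf
    (fun I : FairDivision.BinaryInstance => I.n) (fun I => I.m) (fun I => I.n_pos)
    (fun I => I.matrix) (fun I => I.matrix_zero)
    (fun I => (MatrixProgram.maxNashWelfare_spec I.n_pos I.matrix_eq_false).1)
  have e₁ : FairDivision.BinaryInstance.encode = fun I : FairDivision.BinaryInstance =>
      FairDivision.encodeMatrix fun (i : Fin I.n) (g : Fin I.m) => I.matrix i (g + 1) :=
    funext fun I => I.encode_eq
  have e₂ : (fun I : FairDivision.BinaryInstance => FairDivision.encodeAllocation I.allocation) =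
      fun I => FairDivision.encodeMatrix fun (i : Fin I.n) (g : Fin I.m) =>
        (MatrixProgram.maxNashWelfare.denote I.n I.m (fun _ => 0)
          (MatrixProgram.Mem.ofMatrix I.matrix)).bit .own i (g + 1) := by
    funext I
    rw [FairDivision.encodeAllocation]
    congr
    funext i g
    simp [FairDivision.BinaryInstance.allocation, FairDivision.bundles]
  rw [e₁, e₂]
  exact h
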